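/- Let $M,N\ge 1$ be integers and let $q\in\mathbb{C}\setminus\{0\}$ not be a root of unity. Put $I=\{1,\dots,M+N-1\}$; $l_i=1$ for $1\le i\le M$ and $l_i=-1$ for $M<i\le M+N$; $q_i=q^{l_i}$; let $(\epsilon_i,\epsilon_j)=l_i\delta_{i,j}$ and $c_{i,j}=(\epsilon_i-\epsilon_{i+1},\epsilon_j-\epsilon_{j+1})$ for $i,j\in I$. Write $[n]_u=\frac{u^n-u^{-n}}{u-u^{-1}}$, and $[a,b]_u=ab-(-1)^{|a||b|}u\,ba$ for homogeneous $a,b$ in a superalgebra, $[a,b]=[a,b]_1$. Let $U=U_q(\mathcal{L}\mathfrak{sl}(M,N))$ be the superalgebra over $\mathbb{C}$ with generators $X_{i,n}^{\pm},K_i^{\pm1},h_{i,s}$ ($i\in I$, $n\in\mathbb{Z}$, $s\in\mathbb{Z}\setminus\{0\}$), where the $X_{M,n}^\pm$ are odd and all other generators are even, and with the following relations for all $i,j\in I$, $m,n,k,u\in\mathbb{Z}$, $s,t\in\mathbb{Z}\setminus\{0\}$: 1. $K_iK_i^{-1}=1=K_i^{-1}K_i$, $[K_i,K_j]=[K_i,h_{j,s}]=[h_{i,s},h_{j,t}]=0$;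 2. $K_iX_{j,n}^{\pm}K_i^{-1}=q^{\pm c_{i,j}}X_{j,n}^{\pm}$, $[h_{i,s},X_{j,n}^{\pm}]=\pm\frac{[s\,l_i c_{i,j}]_{q_i}}{s}X_{j,n+s}^{\pm}$; 3. $[X_{i,m}^+,X_{j,n}^-]=\delta_{i,j}\frac{\phi_{i,m+n}^+-\phi_{i,m+n}^-}{q_i-q_i^{-1}}$, where $\sum_{n\in\mathbb{Z}}\phi_{i,n}^{\pm}z^n=K_i^{\pm1}\exp\bigl(\pm(q_i-q_i^{-1})\sum_{s>0}h_{i,\pm s}z^{\pm s}\bigr)$; 4. $[X_{i,m}^{\pm},X_{j,n}^{\pm}]=0$ if $c_{i,j}=0$; 5. $X_{i,m+1}^{\pm}X_{j,n}^{\pm}-q^{\pm c_{i,j}}X_{j,n}^{\pm}X_{i,m+1}^{\pm}=q^{\pm c_{i,j}}X_{i,m}^{\pm}X_{j,n+1}^{\pm}-X_{j,n+1}^{\pm}X_{i,m}^{\pm}$ if $c_{i,j}\ne0$; 6. (Serre) $[X_{i,m}^{\pm},[X_{i,n}^{\pm},X_{j,k}^{\pm}]_{q^{-1}}]_q+[X_{i,n}^{\pm},[X_{i,m}^{\pm},X_{j,k}^{\pm}]_{q^{-1}}]_q=0$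 if $c_{i,j}=\pm1$ and $i\ne M$; 7. (oscillation) $[[[X_{M-1,m}^{\pm},X_{M,n}^{\pm}]_{q^{-1}},X_{M+1,k}^{\pm}]_q,X_{M,u}^{\pm}]+[[[X_{M-1,m}^{\pm},X_{M,u}^{\pm}]_{q^{-1}},X_{M+1,k}^{\pm}]_q,X_{M,n}^{\pm}]=0$ if $M,N>1$. Let $U^{\pm}$ be the subalgebra of $U$ generated by all $X_{i,n}^{\pm}$, and $U^0$ the subalgebra generated by all $K_i^{\pm1}$ and $h_{i,s}$; these are sub-superalgebras. Then: (a) the multiplication map $U^-\otimes U^0\otimes U^+\to U$, $a\otimes b\otimes c\mapsto abc$, is an isomorphism of vector superspaces (a parity-preserving linear bijection); (b) $U^+$ (resp. $U^-$) is isomorphic, by the map sending generators to the generators of the same name, to the superalgebra presented by the generators $X_{i,n}^+$ (resp. $X_{i,n}^-$), $i\in I$, $n\in\mathbb{Z}$, with relations 4--7 with the sign $+$ (resp. $-$); (c) $U^0$ is isomorphic, by the map sending generators to the generators of the same name, to the algebra $\mathbb{C}[h_{i,s}: i\in I, s\in\mathbb{Z}\setminus\{0\}][K_i,K_i^{-1}: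 i\in I]$ of Laurent polynomials in the $K_i$ over the polynomial algebra in the $h_{i,s}$. -/

import Mathlib

open scoped TensorProduct

namespace QAffine

noncomputable section

/-! ### Superalgebras given by generators, their parities, and relations -/

section Presentation

variable {G : Type} (p : G → ZMod 2)

/-- The parity-`ε` part of the free algebra: the span of the words of parity `ε`. -/
def freeGrade (ε : ZMod 2) : Submodule ℂ (FreeAlgebra ℂ G) :=
  Submodule.span ℂ {x | ∃ w : List G, (w.map p).sum = ε ∧ x = (w.map (FreeAlgebra.ι ℂ)).prod}

/-- The parity-`ε` part of the superalgebra presented by the generators `g : G` with parities `p g`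
and the relations `rel`: the span of the (images of the) words of parity `ε`. -/
def presGrade (rel : FreeAlgebra ℂ G → FreeAlgebra ℂ G → Prop) (ε : ZMod 2) :
    Submodule ℂ (RingQuot rel) :=
  (freeGrade p ε).map (RingQuot.mkAlgHom ℂ rel).toLinearMap

end Presentation

/-- The induced `ℤ/2`-grading on a subalgebra of a superalgebra. -/
def subGrade {A : Type} [Ring A] [Algebra ℂ A] (𝒜 : ZMod 2 → Submodule ℂ A)
    (B : Subalgebra ℂ A) (ε : ZMod 2) : Submodule ℂ B :=
  (𝒜 ε).comap B.val.toLinearMap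

/-- The `ℤ/2`-grading on the tensor product of two vector superspaces. -/
def tensorGrade {V W : Type} [AddCommMonoid V] [Module ℂ V] [AddCommMonoid W] [Module ℂ W]
    (𝒱 : ZMod 2 → Submodule ℂ V) (𝒲 : ZMod 2 → Submodule ℂ W) (ε : ZMod 2) :
    Submodule ℂ (V ⊗[ℂ] W) :=
  ⨆ a : ZMod 2, LinearMap.range (TensorProduct.map (𝒱 a).subtype (𝒲 (ε - a)).subtype)

/-- `f` is an isomorphism of vector superspaces. -/
structure IsSuperIso {V W : Type} [AddCommMonoid V] [Module ℂ V] [AddCommMonoid W] [Module ℂ W]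
    (𝒱 : ZMod 2 → Submodule ℂ V) (𝒲 : ZMod 2 → Submodule ℂ W) (f : V →ₗ[ℂ] W) : Prop where
  bijective : Function.Bijective f
  map_grade : ∀ ε, (𝒱 ε).map f = 𝒲 ε

/-- The super-bracket `[a, b]_u = a b - (-1)^{|a||b|} u b a` of elements `a`, `b` of
parities `pa`, `pb`. -/
def sbr {A : Type} [Ring A] [Algebra ℂ A] (pa pb : ZMod 2) (u : ℂ) (a b : A) : A :=
  a * b - ((if pa = 1 ∧ pb = 1 then -1 else 1) * u) • (b * a)

/-- The coefficient of `z ^ n` in `exp f`, for a power series `f` without constant term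
(so that `f ^ k` does not contribute for `k > n`) over a possibly noncommutative algebra. -/
def expCoeff {A : Type} [Ring A] [Algebra ℂ A] (f : PowerSeries A) (n : ℕ) : A :=
  ∑ k ∈ Finset.range (n + 1), ((k.factorial : ℂ)⁻¹) • PowerSeries.coeff n (f ^ k)

/-- The quantum integer `[n]_u`. -/
def qInt (u : ℂ) (n : ℤ) : ℂ := (u ^ n - u ^ (-n)) / (u - u⁻¹)

/-! ### Cartan data of `sl(M,N)` -/

/-- The nodes `1, …, M + N - 1` of the Dynkin diagram. -/
abbrev Node (M N : ℕ) : Type := {i : ℕ // 1 ≤ i ∧ i < M + N}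

/-- `l_i`, for `1 ≤ i ≤ M + N`. -/
def lsgn (M : ℕ) (i : ℕ) : ℤ := if i ≤ M then 1 else -1

/-- The form `(ε_i, ε_j) = l_i δ_{i,j}`. -/
def epsForm (M : ℕ) (i j : ℕ) : ℤ := if i = j then lsgn M i else 0

/-- `c_{i,j} = (ε_i - ε_{i+1}, ε_j - ε_{j+1})`. -/
def cart (M : ℕ) (i j : ℕ) : ℤ :=
  epsForm M i j - epsForm M i (j + 1) - epsForm M (i + 1) j + epsForm M (i + 1) (j + 1)

/-- `q_i = q ^ {l_i}`. -/
def qi (M : ℕ) (q : ℂ) (i : ℕ) : ℂ := q ^ lsgn M i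

/-- The parity of the node `i` (that is, of `X_{i,n}^±`). -/
def par (M : ℕ) (i : ℕ) : ZMod 2 := if i = M then 1 else 0

/-! ### The relations -/

/-- The relations that involve only the `X_{i,n}^+` (for `e = 1`), or only the `X_{i,n}^-`
(for `e = -1`): the relations of degree 2, the Serre relations of degree 3 and the oscillation
relations of degree 4. -/
inductive NilRel (M N : ℕ) (q : ℂ) (e : ℤˣ) {A : Type} [Ring A] [Algebra ℂ A]
    (X : Node M N → ℤ → A) : A → A → Prop
  | comm (i j : Node M N) (m n : ℤ) (hc : cart M i j = 0) :
      NilRel M N q e X (sbr (par M i) (par M j) 1 (X i m) (X j n)) 0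
  | quad (i j : Node M N) (m n : ℤ) (hc : cart M i j ≠ 0) :
      NilRel M N q e X
        (X i (m + 1) * X j n - q ^ ((e : ℤ) * cart M i j) • (X j n * X i (m + 1)))
        (q ^ ((e : ℤ) * cart M i j) • (X i m * X j (n + 1)) - X j (n + 1) * X i m)
  | serre (i j : Node M N) (m n k : ℤ) (hc : cart M i j = 1 ∨ cart M i j = -1)
      (hi : (i : ℕ) ≠ M) :
      NilRel M N q e X
        (sbr (par M i) (par M i + par M j) q (X i m)
            (sbr (par M i) (par M j) q⁻¹ (X i n) (X j k)) +
          sbr (par M i) (par M i + par M j) q (X i n)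
            (sbr (par M i) (par M j) q⁻¹ (X i m) (X j k))) 0
  | osc (a b c : Node M N) (m n k u : ℤ) (hM : 1 < M) (hN : 1 < N)
      (ha : (a : ℕ) = M - 1) (hb : (b : ℕ) = M) (hc : (c : ℕ) = M + 1) :
      NilRel M N q e X
        (sbr (par M a + par M b + par M c) (par M b) 1
            (sbr (par M a + par M b) (par M c) q
              (sbr (par M a) (par M b) q⁻¹ (X a m) (X b n)) (X c k)) (X b u) +
          sbr (par M a + par M b + par M c) (par M b) 1
            (sbr (par M a + par M b) (par M c) q
              (sbr (par M a) (par M b) q⁻¹ (X a m) (X b u)) (X c k)) (X b n)) 0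

/-- The Drinfeld generators. A sign is an element of `ℤˣ = {1, -1}`: `X e i n` is `X_{i,n}^e`,
`h i s` is `h_{i,s}` and `K e i` is `K_i^e`. -/
inductive Gen (M N : ℕ) : Type
  | X (e : ℤˣ) (i : Node M N) (n : ℤ)
  | h (i : Node M N) (s : {s : ℤ // s ≠ 0})
  | K (e : ℤˣ) (i : Node M N)

/-- The parities of the generators. -/
def Gen.parity {M N : ℕ} : Gen M N → ZMod 2
  | .X _ i _ => par M i
  | .h _ _ => 0
  | .K _ _ => 0

section Free

variable {M N : ℕ}

/-- `X_{i,n}^e` in the free algebra. -/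
def fX (e : ℤˣ) (i : Node M N) (n : ℤ) : FreeAlgebra ℂ (Gen M N) := FreeAlgebra.ι ℂ (.X e i n)

/-- `h_{i,s}` in the free algebra. -/
def fh (i : Node M N) (s : {s : ℤ // s ≠ 0}) : FreeAlgebra ℂ (Gen M N) := FreeAlgebra.ι ℂ (.h i s)

/-- `K_i^e` in the free algebra. -/
def fK (e : ℤˣ) (i : Node M N) : FreeAlgebra ℂ (Gen M N) := FreeAlgebra.ι ℂ (.K e i)

/-- `e (q_i - q_i⁻¹) ∑_{s > 0} h_{i,es} w^s`, as a power series in `w = z^e`. -/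
def hSeries (q : ℂ) (e : ℤˣ) (i : Node M N) : PowerSeries (FreeAlgebra ℂ (Gen M N)) :=
  PowerSeries.mk fun s : ℕ =>
    if hs : s = 0 then 0
    else ((e : ℤ) * (qi M q i - (qi M q i)⁻¹) : ℂ) •
      fh i ⟨(e : ℤ) * (s : ℤ), mul_ne_zero e.ne_zero (Int.natCast_ne_zero.mpr hs)⟩

/-- `φ_{i,n}^e`: the coefficient of `z^n = w^{en}` in
`K_i^e exp (e (q_i - q_i⁻¹) ∑_{s > 0} h_{i,es} w^s)`, where `w = z^e`. -/
def phi (q : ℂ) (e : ℤˣ) (i : Node M N) (n : ℤ) : FreeAlgebra ℂ (Gen M N) :=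
  if 0 ≤ (e : ℤ) * n then fK e i * expCoeff (hSeries q e i) ((e : ℤ) * n).toNat else 0

end Free

/-- The defining relations of `U_q(Lsl(M,N))`. -/
inductive Rel (M N : ℕ) (q : ℂ) : FreeAlgebra ℂ (Gen M N) → FreeAlgebra ℂ (Gen M N) → Prop
  | K_inv (e : ℤˣ) (i : Node M N) : Rel M N q (fK e i * fK (-e) i) 1
  | K_K (i j : Node M N) : Rel M N q (fK 1 i * fK 1 j) (fK 1 j * fK 1 i)
  | K_h (i j : Node M N) (s : {s : ℤ // s ≠ 0}) : Rel M N q (fK 1 i * fh j s) (fh j s * fK 1 i)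
  | h_h (i j : Node M N) (s t : {s : ℤ // s ≠ 0}) : Rel M N q (fh i s * fh j t) (fh j t * fh i s)
  | K_X (e : ℤˣ) (i j : Node M N) (n : ℤ) :
      Rel M N q (fK 1 i * fX e j n * fK (-1) i) (q ^ ((e : ℤ) * cart M i j) • fX e j n)
  | h_X (e : ℤˣ) (i j : Node M N) (s : {s : ℤ // s ≠ 0}) (n : ℤ) :
      Rel M N q (fh i s * fX e j n - fX e j n * fh i s)
        (((e : ℤ) * (qInt (qi M q i) ((s : ℤ) * lsgn M i * cart M i j) / (s : ℤ)) : ℂ) •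
          fX e j (n + s))
  | X_X (i j : Node M N) (m n : ℤ) :
      Rel M N q (sbr (par M i) (par M j) 1 (fX 1 i m) (fX (-1) j n))
        (if i = j then (qi M q i - (qi M q i)⁻¹)⁻¹ • (phi q 1 i (m + n) - phi q (-1) i (m + n))
          else 0)
  | nil (e : ℤˣ) (a b : FreeAlgebra ℂ (Gen M N)) (hab : NilRel M N q e (fX e) a b) : Rel M N q a b

/-! ### The quantum affine superalgebra and its subalgebras -/

/-- The quantum affine superalgebra `U_q(Lsl(M,N))`. -/
abbrev U (M N : ℕ) (q : ℂ) : Type := RingQuot (Rel M N q)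

/-- The `ℤ/2`-grading of `U_q(Lsl(M,N))`. -/
def UGrade (M N : ℕ) (q : ℂ) : ZMod 2 → Submodule ℂ (U M N q) :=
  presGrade Gen.parity (Rel M N q)

section Elements

variable (M N : ℕ) (q : ℂ)

/-- `X_{i,n}^e ∈ U_q(Lsl(M,N))`. -/
def uX (e : ℤˣ) (i : Node M N) (n : ℤ) : U M N q := RingQuot.mkAlgHom ℂ (Rel M N q) (fX e i n)

/-- `h_{i,s} ∈ U_q(Lsl(M,N))`. -/
def uh (i : Node M N) (s : {s : ℤ // s ≠ 0}) : U M N q := RingQuot.mkAlgHom ℂ (Rel M N q) (fh i s)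

/-- `K_i^e ∈ U_q(Lsl(M,N))`. -/
def uK (e : ℤˣ) (i : Node M N) : U M N q := RingQuot.mkAlgHom ℂ (Rel M N q) (fK e i)

/-- `U_q^+` (for `e = 1`) and `U_q^-` (for `e = -1`). -/
def Unil (e : ℤˣ) : Subalgebra ℂ (U M N q) :=
  Algebra.adjoin ℂ {x | ∃ i n, x = uX M N q e i n}

/-- `U_q^0`. -/
def Uzero : Subalgebra ℂ (U M N q) :=
  Algebra.adjoin ℂ ({x | ∃ e i, x = uK M N q e i} ∪ {x | ∃ i s, x = uh M N q i s})

/-- The multiplication `U_q^- ⊗ U_q^0 ⊗ U_q^+ → U_q(Lsl(M,N))`, `a ⊗ b ⊗ c ↦ a b c`. -/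
def triMul : (Unil M N q (-1) ⊗[ℂ] Uzero M N q) ⊗[ℂ] Unil M N q 1 →ₗ[ℂ] U M N q :=
  LinearMap.mul' ℂ (U M N q) ∘ₗ
    TensorProduct.map
      (LinearMap.mul' ℂ (U M N q) ∘ₗ
        TensorProduct.map (Unil M N q (-1)).val.toLinearMap (Uzero M N q).val.toLinearMap)
      (Unil M N q 1).val.toLinearMap

/-- The relations of the presented algebra `PNil` on the free algebra on the `X_{i,n}^e`
(`e` fixed). -/
abbrev PRel (e : ℤˣ) :
    FreeAlgebra ℂ (Node M N × ℤ) → FreeAlgebra ℂ (Node M N × ℤ) → Prop :=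
  NilRel M N q e fun i n => FreeAlgebra.ι ℂ (i, n)

/-- The superalgebra presented by the generators `X_{i,n}^e` (`e` fixed) and the relations of
degree 2, the Serre relations and the oscillation relations. -/
abbrev PNil (e : ℤˣ) : Type := RingQuot (PRel M N q e)

/-- The generator `X_{i,n}^e` of `PNil`. -/
def pX (e : ℤˣ) (i : Node M N) (n : ℤ) : PNil M N q e :=
  RingQuot.mkAlgHom ℂ (PRel M N q e) (FreeAlgebra.ι ℂ (i, n))

/-- The `ℤ/2`-grading of `PNil`. -/
def PGrade (e : ℤˣ) : ZMod 2 → Submodule ℂ (PNil M N q e) :=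
  presGrade (fun g : Node M N × ℤ => par M g.1) (PRel M N q e)

/-- The algebra `ℂ[h_{i,s}][K_i, K_i⁻¹]` of Laurent polynomials in the `K_i` over the polynomial
algebra in the `h_{i,s}`. -/
abbrev Laurent : Type :=
  AddMonoidAlgebra (MvPolynomial (Node M N × {s : ℤ // s ≠ 0}) ℂ) (Node M N →₀ ℤ)

/-- The variable `h_{i,s}`. -/
def lh (i : Node M N) (s : {s : ℤ // s ≠ 0}) : Laurent M N :=
  AddMonoidAlgebra.single 0 (MvPolynomial.X (i, s))

/-- The variable `K_i`, for `e = 1`, and its inverse, for `e = -1`. -/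
def lK (e : ℤˣ) (i : Node M N) : Laurent M N :=
  AddMonoidAlgebra.single (Finsupp.single i (e : ℤ)) 1

end Elements

/-! ### The gradings are superalgebra gradings -/

section Grading

variable {G : Type} (p : G → ZMod 2)

theorem freeGrade_word (w : List G) :
    (w.map (FreeAlgebra.ι ℂ)).prod ∈ freeGrade p (w.map p).sum :=
  Submodule.subset_span ⟨w, rfl, rfl⟩

theorem freeGrade_ι (g : G) : FreeAlgebra.ι ℂ g ∈ freeGrade p (p g) := by
  simpa using freeGrade_word p [g]

theorem freeGrade_one : (1 : FreeAlgebra ℂ G) ∈ freeGrade p 0 := by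
  simpa using freeGrade_word p []

theorem freeGrade_mul {a b : ZMod 2} {x y : FreeAlgebra ℂ G} (hx : x ∈ freeGrade p a)
    (hy : y ∈ freeGrade p b) : x * y ∈ freeGrade p (a + b) := by
  have h := Submodule.mul_mem_mul hx hy
  rw [freeGrade, freeGrade, Submodule.span_mul_span] at h
  refine Submodule.span_mono ?_ h
  rintro _ ⟨_, ⟨v, rfl, rfl⟩, _, ⟨w, rfl, rfl⟩, rfl⟩
  exact ⟨v ++ w, by simp, by simp⟩

/-- A subalgebra generated by homogeneous elements is spanned by its homogeneous elements. -/
theorem adjoin_le_iSup {A : Type} [Ring A] [Algebra ℂ A] (𝒜 : ZMod 2 → Submodule ℂ A)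
    [SetLike.GradedMonoid 𝒜] (S : Set A) (hS : ∀ x ∈ S, ∃ ε, x ∈ 𝒜 ε) (x : A)
    (hx : x ∈ Algebra.adjoin ℂ S) :
    x ∈ ⨆ ε, (𝒜 ε ⊓ Subalgebra.toSubmodule (Algebra.adjoin ℂ S)) := by
  induction hx using Algebra.adjoin_induction with
  | mem x hx =>
    obtain ⟨ε, h⟩ := hS x hx
    exact Submodule.mem_iSup_of_mem ε ⟨h, Algebra.subset_adjoin hx⟩
  | algebraMap r =>
    rw [Algebra.algebraMap_eq_smul_one]
    exact Submodule.smul_mem _ _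
      (Submodule.mem_iSup_of_mem 0 ⟨SetLike.GradedOne.one_mem, Subalgebra.one_mem _⟩)
  | add a b _ _ ha hb => exact Submodule.add_mem _ ha hb
  | mul a b _ _ ha hb =>
    have h := Submodule.mul_mem_mul ha hb
    rw [Submodule.iSup_mul] at h
    revert h
    refine fun h => (iSup_le fun i => ?_ : (_ : Submodule ℂ A) ≤ _) h
    rw [Submodule.mul_iSup]
    refine iSup_le fun j => ?_
    rw [Submodule.mul_le]
    intro m hm n hn
    exact Submodule.mem_iSup_of_mem (i + j)
      ⟨SetLike.GradedMul.mul_mem hm.1 hn.1, Subalgebra.mul_mem _ hm.2 hn.2⟩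

instance freeGrade_graded : SetLike.GradedMonoid (freeGrade p) where
  one_mem := freeGrade_one p
  mul_mem _ _ _ _ hx hy := freeGrade_mul p hx hy

theorem freeGrade_sup : (⨆ ε, freeGrade p ε) = ⊤ := by
  rw [eq_top_iff]
  rintro x -
  have hx : x ∈ Algebra.adjoin ℂ (Set.range (FreeAlgebra.ι ℂ : G → _)) := by
    rw [FreeAlgebra.adjoin_range_ι]; trivial
  have hle : (⨆ ε, (freeGrade p ε ⊓ Subalgebra.toSubmodule
      (Algebra.adjoin ℂ (Set.range (FreeAlgebra.ι ℂ : G → _))))) ≤ ⨆ ε, freeGrade p ε :=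
    iSup_mono fun ε => inf_le_left
  refine hle (adjoin_le_iSup (freeGrade p) _ ?_ x hx)
  rintro _ ⟨g, rfl⟩
  exact ⟨_, freeGrade_ι p g⟩

/-- The sign `(-1)^ε`. -/
def sgn (ε : ZMod 2) : ℂ := if ε = 1 then -1 else 1

theorem sgn_add (a b : ZMod 2) : sgn (a + b) = sgn a * sgn b := by
  have h : ∀ a : ZMod 2, a = 0 ∨ a = 1 := by decide
  have h2 : (1 : ZMod 2) + 1 = 0 := by decide
  rcases h a with rfl | rfl <;> rcases h b with rfl | rfl <;> simp [sgn, h2]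

/-- The parity involution of the free algebra. -/
def freeInv : FreeAlgebra ℂ G →ₐ[ℂ] FreeAlgebra ℂ G :=
  FreeAlgebra.lift ℂ fun g => sgn (p g) • FreeAlgebra.ι ℂ g

theorem freeInv_of_mem {ε : ZMod 2} {x : FreeAlgebra ℂ G} (hx : x ∈ freeGrade p ε) :
    freeInv p x = sgn ε • x := by
  induction hx using Submodule.span_induction with
  | mem x hx =>
    obtain ⟨w, rfl, rfl⟩ := hx
    induction w with
    | nil => simp [sgn]
    | cons g w ih =>
      rw [List.map_cons, List.prod_cons, List.map_cons, List.sum_cons, map_mul, ih, sgn_add,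
        freeInv, FreeAlgebra.lift_ι_apply, Algebra.smul_mul_assoc, Algebra.mul_smul_comm, smul_smul]
  | zero => rw [map_zero, smul_zero]
  | add x y _ _ hx hy => rw [map_add, hx, hy, smul_add]
  | smul c x _ hx => rw [map_smul, hx, smul_smul, smul_smul, mul_comm]

theorem isInternal_of_disjoint {A : Type} [AddCommGroup A] [Module ℂ A]
    (𝒜 : ZMod 2 → Submodule ℂ A) (hd : ∀ x ∈ 𝒜 0, x ∈ 𝒜 1 → x = 0) (htop : ⨆ ε, 𝒜 ε = ⊤) :
    DirectSum.IsInternal 𝒜 := by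
  have h2 : ∀ a : ZMod 2, a = 0 ∨ a = 1 := by decide
  have huniv : (Set.univ : Set (ZMod 2)) = {0, 1} := by
    ext a
    simpa using h2 a
  rw [DirectSum.isInternal_submodule_iff_isCompl _ (i := 0) (j := 1) (by decide) huniv]
  refine ⟨Submodule.disjoint_def.mpr hd, ?_⟩
  rw [codisjoint_iff, eq_top_iff, ← htop]
  refine iSup_le fun ε => ?_
  rcases h2 ε with rfl | rfl
  exacts [le_sup_left, le_sup_right]

theorem eq_zero_of_sgn_smul {A : Type} [AddCommGroup A] [Module ℂ A] (x : A)
    (h : sgn 0 • x = sgn 1 • x) : x = 0 := by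
  have h' : sgn 0 - sgn 1 ≠ 0 := by norm_num [sgn]
  refine (smul_eq_zero.mp ?_).resolve_left h'
  rw [sub_smul, h, sub_self]

/-- Subalgebras generated by homogeneous elements are sub-superalgebras. -/
theorem subGrade_isInternal {A : Type} [Ring A] [Algebra ℂ A] (𝒜 : ZMod 2 → Submodule ℂ A)
    [SetLike.GradedMonoid 𝒜] (hd : ∀ x ∈ 𝒜 0, x ∈ 𝒜 1 → x = 0)
    (S : Set A) (hS : ∀ x ∈ S, ∃ ε, x ∈ 𝒜 ε) :
    DirectSum.IsInternal (subGrade 𝒜 (Algebra.adjoin ℂ S)) := by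
  refine isInternal_of_disjoint _ (fun x h0 h1 => Subtype.ext (hd x h0 h1)) ?_
  rw [eq_top_iff]
  rintro ⟨x, hx⟩ -
  have hmap : (⨆ ε, (𝒜 ε ⊓ Subalgebra.toSubmodule (Algebra.adjoin ℂ S))) ≤
      (⨆ ε, subGrade 𝒜 (Algebra.adjoin ℂ S) ε).map
        (Algebra.adjoin ℂ S).val.toLinearMap := by
    rw [Submodule.map_iSup]
    refine iSup_mono fun ε => ?_
    rintro y ⟨hy, hy'⟩
    exact ⟨⟨y, hy'⟩, hy, rfl⟩
  obtain ⟨y, hy, hyx⟩ := hmap (adjoin_le_iSup 𝒜 S hS x hx)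
  have hxy : y = ⟨x, hx⟩ := Subtype.ext hyx
  exact hxy ▸ hy

variable (rel : FreeAlgebra ℂ G → FreeAlgebra ℂ G → Prop)

instance presGrade_graded : SetLike.GradedMonoid (presGrade p rel) where
  one_mem := ⟨1, freeGrade_one p, map_one (RingQuot.mkAlgHom ℂ rel)⟩
  mul_mem := by
    rintro i j _ _ ⟨x, hx, rfl⟩ ⟨y, hy, rfl⟩
    exact ⟨x * y, freeGrade_mul p hx hy, map_mul (RingQuot.mkAlgHom ℂ rel) x y⟩

variable {rel}

theorem presGrade_disjoint
    (hrel : ∀ a b, rel a b → ∃ ε, a ∈ freeGrade p ε ∧ b ∈ freeGrade p ε)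
    (x : RingQuot rel) (h0 : x ∈ presGrade p rel 0) (h1 : x ∈ presGrade p rel 1) : x = 0 := by
  obtain ⟨s, hs⟩ : ∃ s : RingQuot rel → RingQuot rel,
      ∀ ε, ∀ x ∈ presGrade p rel ε, s x = sgn ε • x := by
    refine ⟨RingQuot.liftAlgHom ℂ ⟨(RingQuot.mkAlgHom ℂ rel).comp (freeInv p), ?_⟩, ?_⟩
    · intro a b hab
      obtain ⟨ε, ha, hb⟩ := hrel a b hab
      rw [AlgHom.comp_apply, AlgHom.comp_apply, freeInv_of_mem p ha, freeInv_of_mem p hb,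
        map_smul, map_smul, RingQuot.mkAlgHom_rel ℂ hab]
    · rintro ε _ ⟨x, hx, rfl⟩
      rw [AlgHom.toLinearMap_apply, RingQuot.liftAlgHom_mkAlgHom_apply, AlgHom.comp_apply,
        freeInv_of_mem p hx, map_smul]
  have e1 := hs 1 x h1
  rw [hs 0 x h0] at e1
  exact eq_zero_of_sgn_smul x e1

/-- A presentation with homogeneous relations defines a superalgebra. -/
theorem presGrade_isInternal
    (hrel : ∀ a b, rel a b → ∃ ε, a ∈ freeGrade p ε ∧ b ∈ freeGrade p ε) :
    DirectSum.IsInternal (presGrade p rel) := by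
  refine isInternal_of_disjoint _ (presGrade_disjoint p hrel) ?_
  unfold presGrade
  rw [← Submodule.map_iSup, freeGrade_sup, Submodule.map_top, LinearMap.range_eq_top]
  exact RingQuot.mkAlgHom_surjective ℂ rel

end Grading

section Homogeneous

variable {M N : ℕ} {q : ℂ}

theorem sbr_mem {G : Type} (p : G → ZMod 2) {a b : ZMod 2} {x y : FreeAlgebra ℂ G} {u : ℂ}
    (hx : x ∈ freeGrade p a) (hy : y ∈ freeGrade p b) :
    sbr a b u x y ∈ freeGrade p (a + b) :=
  Submodule.sub_mem _ (freeGrade_mul p hx hy)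
    (Submodule.smul_mem _ _ (add_comm b a ▸ freeGrade_mul p hy hx))

theorem nilRel_homogeneous {G : Type} (p : G → ZMod 2) {e : ℤˣ}
    {X : Node M N → ℤ → FreeAlgebra ℂ G} (hX : ∀ (i : Node M N) (n : ℤ), X i n ∈ freeGrade p (par M i))
    (a b : FreeAlgebra ℂ G) (h : NilRel M N q e X a b) :
    ∃ ε, a ∈ freeGrade p ε ∧ b ∈ freeGrade p ε := by
  cases h with
  | comm i j m n hc => exact ⟨_, sbr_mem p (hX i m) (hX j n), Submodule.zero_mem _⟩
  | quad i j m n hc =>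
    refine ⟨par M i + par M j, Submodule.sub_mem _ (freeGrade_mul p (hX _ _) (hX _ _))
      (Submodule.smul_mem _ _ ?_), Submodule.sub_mem _ (Submodule.smul_mem _ _
        (freeGrade_mul p (hX _ _) (hX _ _))) ?_⟩ <;>
    · rw [add_comm]
      exact freeGrade_mul p (hX _ _) (hX _ _)
  | serre i j m n k hc hi =>
    exact ⟨_, Submodule.add_mem _ (sbr_mem p (hX _ _) (sbr_mem p (hX _ _) (hX _ _)))
      (sbr_mem p (hX _ _) (sbr_mem p (hX _ _) (hX _ _))), Submodule.zero_mem _⟩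
  | osc a b c m n k u hM hN ha hb hc =>
    exact ⟨_, Submodule.add_mem _
      (sbr_mem p (sbr_mem p (sbr_mem p (hX _ _) (hX _ _)) (hX _ _)) (hX _ _))
      (sbr_mem p (sbr_mem p (sbr_mem p (hX _ _) (hX _ _)) (hX _ _)) (hX _ _)),
      Submodule.zero_mem _⟩

theorem fX_mem (e : ℤˣ) (i : Node M N) (n : ℤ) :
    fX e i n ∈ freeGrade Gen.parity (par M i) := freeGrade_ι Gen.parity (.X e i n)

theorem fh_mem (i : Node M N) (s : {s : ℤ // s ≠ 0}) :
    fh i s ∈ freeGrade Gen.parity 0 := freeGrade_ι Gen.parity (.h i s)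

theorem fK_mem (e : ℤˣ) (i : Node M N) :
    fK e i ∈ freeGrade Gen.parity 0 := freeGrade_ι Gen.parity (.K e i)

theorem even_mul {G : Type} (p : G → ZMod 2) {x y : FreeAlgebra ℂ G} (hx : x ∈ freeGrade p 0)
    (hy : y ∈ freeGrade p 0) : x * y ∈ freeGrade p 0 := by
  simpa using freeGrade_mul p hx hy

theorem coeff_pow_even {G : Type} (p : G → ZMod 2) (f : PowerSeries (FreeAlgebra ℂ G))
    (hf : ∀ n, PowerSeries.coeff n f ∈ freeGrade p 0) (k n : ℕ) :
    PowerSeries.coeff n (f ^ k) ∈ freeGrade p 0 := by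
  induction k generalizing n with
  | zero =>
    rw [pow_zero, PowerSeries.coeff_one]
    split_ifs
    exacts [freeGrade_one p, Submodule.zero_mem _]
  | succ k ih =>
    rw [pow_succ, PowerSeries.coeff_mul]
    exact Submodule.sum_mem _ fun x _ => even_mul p (ih _) (hf _)

theorem phi_mem (e : ℤˣ) (i : Node M N) (n : ℤ) : phi q e i n ∈ freeGrade Gen.parity 0 := by
  unfold phi
  split_ifs
  · refine even_mul _ (fK_mem e i) (Submodule.sum_mem _ fun k _ => Submodule.smul_mem _ _ ?_)
    refine coeff_pow_even _ _ (fun n => ?_) _ _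
    rw [hSeries, PowerSeries.coeff_mk]
    split_ifs
    exacts [Submodule.zero_mem _, Submodule.smul_mem _ _ (fh_mem _ _)]
  · exact Submodule.zero_mem _

theorem rel_homogeneous (a b : FreeAlgebra ℂ (Gen M N)) (h : Rel M N q a b) :
    ∃ ε, a ∈ freeGrade Gen.parity ε ∧ b ∈ freeGrade Gen.parity ε := by
  cases h with
  | K_inv e i => exact ⟨0, even_mul _ (fK_mem _ _) (fK_mem _ _), freeGrade_one _⟩
  | K_K i j =>
    exact ⟨0, even_mul _ (fK_mem _ _) (fK_mem _ _), even_mul _ (fK_mem _ _) (fK_mem _ _)⟩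
  | K_h i j s =>
    exact ⟨0, even_mul _ (fK_mem _ _) (fh_mem _ _), even_mul _ (fh_mem _ _) (fK_mem _ _)⟩
  | h_h i j s t =>
    exact ⟨0, even_mul _ (fh_mem _ _) (fh_mem _ _), even_mul _ (fh_mem _ _) (fh_mem _ _)⟩
  | K_X e i j n =>
    refine ⟨par M j, ?_, Submodule.smul_mem _ _ (fX_mem _ _ _)⟩
    simpa using freeGrade_mul _ (freeGrade_mul _ (fK_mem 1 i) (fX_mem e j n)) (fK_mem (-1) i)
  | h_X e i j s n =>
    refine ⟨par M j, Submodule.sub_mem _ ?_ ?_, Submodule.smul_mem _ _ (fX_mem _ _ _)⟩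
    · simpa using freeGrade_mul _ (fh_mem i s) (fX_mem e j n)
    · simpa using freeGrade_mul _ (fX_mem e j n) (fh_mem i s)
  | X_X i j m n =>
    refine ⟨_, sbr_mem _ (fX_mem _ _ _) (fX_mem _ _ _), ?_⟩
    split_ifs with hij
    · subst hij
      have h2 : ∀ a : ZMod 2, a + a = 0 := by decide
      rw [h2]
      exact Submodule.smul_mem _ _ (Submodule.sub_mem _ (phi_mem _ _ _) (phi_mem _ _ _))
    · exact Submodule.zero_mem _
  | nil e a b hab => exact nilRel_homogeneous _ (fX_mem e) _ _ hab

/-- `U_q(Lsl(M,N))` is a superalgebra. -/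
instance UGrade_graded : SetLike.GradedMonoid (UGrade M N q) := presGrade_graded _ _

theorem UGrade_isInternal : DirectSum.IsInternal (UGrade M N q) :=
  presGrade_isInternal _ rel_homogeneous

/-- `PNil` is a superalgebra. -/
instance PGrade_graded (e : ℤˣ) : SetLike.GradedMonoid (PGrade M N q e) := presGrade_graded _ _

theorem PGrade_isInternal (e : ℤˣ) : DirectSum.IsInternal (PGrade M N q e) :=
  presGrade_isInternal _ (nilRel_homogeneous _ fun i n => freeGrade_ι _ (i, n))

/-- `U_q^±` and `U_q^0` are sub-superalgebras of `U_q(Lsl(M,N))`. -/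
theorem Unil_isInternal (e : ℤˣ) :
    DirectSum.IsInternal (subGrade (UGrade M N q) (Unil M N q e)) := by
  refine subGrade_isInternal (UGrade M N q) (presGrade_disjoint _ rel_homogeneous) _ ?_
  rintro _ ⟨i, n, rfl⟩
  exact ⟨_, _, fX_mem e i n, rfl⟩

theorem Uzero_isInternal : DirectSum.IsInternal (subGrade (UGrade M N q) (Uzero M N q)) := by
  refine subGrade_isInternal (UGrade M N q) (presGrade_disjoint _ rel_homogeneous) _ ?_
  rintro _ (⟨e, i, rfl⟩ | ⟨i, s, rfl⟩)
  exacts [⟨_, _, fK_mem e i, rfl⟩, ⟨_, _, fh_mem i s, rfl⟩]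

end Homogeneous

end

end QAffine

/-! Write `N^±` for the presented algebras (`Nil`), `L` for the Laurent algebra and `ψ_{i,n} =
(φ_{i,n}^+ - φ_{i,n}^-)/(q_i - q_i⁻¹)`. Surjectivity of multiplication is a straightening argument
(`IsDrinfeld.top_le`). The substance is that nothing collapses: the natural map `N^- ⊗ L ⊗ N^+ → U`
is injective (`triMul_triMap_injective`). All three claims follow, since this map factors through
`U^- ⊗ U^0 ⊗ U^+` by a tensor product of surjections.

Injectivity is proved by letting `U` act on the space `N^- ⊗ (N^+ ⊗ L)` and recovering a tensor from
its value at `1 ⊗ 1 ⊗ 1`. On `W = N^+ ⊗ L` the factor `N^+` multiplies from the left, the `K_i` act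
through scaling automorphisms of `N^+`, and the `h_{i,s}` through derivations shifting the mode. The
same recipe applies to `N^- ⊗ W`. There `X_{i,m}^+` is forced to act by `x ⊗ w ↦ ±x ⊗ X_{i,m}^+ w +
[X_{i,m}^+, x](1 ⊗ w)`, where the supercommutator is the twisted derivation with `X_{j,n}^- ↦
δ_{i,j} ψ_{i,m+n}`.

Such a derivation must respect the relations of `N^-`. It is encoded as a homomorphism to upper
triangular 2×2 matrices, so the point is that the corner entries of all relations agree
(`corner_eq`). The currents `φ_i^±` satisfy an exchange relation with every `X_j`
(`IsWeight.phi_exchange`), which settles the relations of degree 2. The Serre and oscillation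
corners are linear in `ψ`, so `φ^+` and `φ^-` may be treated separately, and each of these vanishes
on a half line of modes. A product of two first-order difference operators in the modes moves `φ`
past the other currents, and then the relations of degree 2 give zero. Since a one-sided solution of
such a recurrence is zero (`OneSided.eq_zero_of_rec_two`), the corner vanishes.

The relations between the `X^+` must also hold on the module (`indE_sat`). The difference of the two
sides of such a relation kills `1 ⊗ W`, because `W` is a module over `N^+`. It commutes up to a
scalar with every `X_{j,n}^-`, by the same corner computation with the two signs exchanged. As `N^-`
generates the module from `1 ⊗ W`, the difference is zero (`ind_op_eq_zero`). -/

open scoped TensorProduct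

namespace QAffine

noncomputable section

/-! ### Exchange relations between currents -/

section Exchange

set_option linter.unusedSimpArgs false

/-- A sequence that vanishes on a half line. -/
def OneSided {B : Type} [Zero B] (F : ℤ → B) : Prop :=
  (∃ b, ∀ k < b, F k = 0) ∨ ∃ b, ∀ k > b, F k = 0

theorem OneSided.of_imp {B C : Type} [Zero B] [Zero C] {F : ℤ → B} {G : ℤ → C}
    (hF : OneSided F) (h : ∀ k, F k = 0 → G k = 0) : OneSided G :=
  hF.imp (fun ⟨b, hb⟩ => ⟨b, fun k hk => h k (hb k hk)⟩)
    fun ⟨b, hb⟩ => ⟨b, fun k hk => h k (hb k hk)⟩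

theorem OneSided.shift {B : Type} [Zero B] {F : ℤ → B} (hF : OneSided F) (p : ℤ) :
    OneSided fun k => F (k + p) :=
  hF.imp (fun ⟨b, hb⟩ => ⟨b - p, fun k hk => hb _ (by omega)⟩)
    fun ⟨b, hb⟩ => ⟨b - p, fun k hk => hb _ (by omega)⟩

theorem OneSided.reflect {B : Type} [Zero B] {F : ℤ → B} (hF : OneSided F) :
    OneSided fun k => F (-k) :=
  hF.symm.imp (fun ⟨b, hb⟩ => ⟨-b, fun k hk => hb _ (by omega)⟩)
    fun ⟨b, hb⟩ => ⟨-b, fun k hk => hb _ (by omega)⟩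

variable {A : Type} [Ring A] [Algebra ℂ A]

theorem eq_zero_of_smul {c : ℂ} (hc : c ≠ 0) {x : A} (h : c • x = 0) : x = 0 :=
  (smul_eq_zero.mp h).resolve_left hc

/-- A one-sided sequence annihilated by a product of two linear difference operators vanishes. -/
theorem OneSided.eq_zero_of_rec_two {F : ℤ → ℤ → ℤ → A} (hF : OneSided F) {a b c d : ℂ}
    (ha : a ≠ 0) (hd : d ≠ 0)
    (h : ∀ k n u, a • F (k + 1 + 1) n u + b • F (k + 1) (n + 1) u + c • F (k + 1) n (u + 1) +
      d • F k (n + 1) (u + 1) = 0) (k n u : ℤ) : F k n u = 0 := by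
  rcases hF with ⟨B, hB⟩ | ⟨B, hB⟩
  · have key : ∀ j : ℕ, ∀ k < B + j, F k = 0 := by
      intro j
      induction j with
      | zero => intro k hk; exact hB k (by simpa using hk)
      | succ j ih =>
        intro k hk
        funext n u
        have e := h (k - 2) n u
        rw [ih (k - 2 + 1) (by push_cast at hk; omega), ih (k - 2) (by push_cast at hk; omega),
          show k - 2 + 1 + 1 = k by ring] at e
        simp only [Pi.zero_apply, smul_zero, add_zero] at e
        exact eq_zero_of_smul ha e
    rw [key ((k - B).toNat + 1) k (by push_cast; omega)]
    rfl
  · have key : ∀ j : ℕ, ∀ k > B - j, F k = 0 := by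
      intro j
      induction j with
      | zero => intro k hk; exact hB k (by simpa using hk)
      | succ j ih =>
        intro k hk
        funext n u
        have e := h k (n - 1) (u - 1)
        rw [ih (k + 1 + 1) (by push_cast at hk; omega), ih (k + 1) (by push_cast at hk; omega),
          sub_add_cancel, sub_add_cancel] at e
        simp only [Pi.zero_apply, smul_zero, zero_add] at e
        exact eq_zero_of_smul hd e
    rw [key ((B - k).toNat + 1) k (by push_cast; omega)]
    rfl

theorem OneSided.eq_zero_of_rec {F : ℤ → ℤ → A} (hF : OneSided F) {a b : ℂ}
    (ha : a ≠ 0) (hb : b ≠ 0)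
    (h : ∀ k n, a • F (k + 1) n + b • F k (n + 1) = 0) (k n : ℤ) : F k n = 0 := by
  -- The third index is a dummy: the first-order recurrence is added to its shift by one in `k`,
  -- which has the shape of a second-order one with end coefficients `a` and `b`.
  refine OneSided.eq_zero_of_rec_two (F := fun k n _ => F k n)
    (hF.of_imp fun k hk => by rw [hk]; rfl) (b := b) (c := a) ha hb (fun k n _ => ?_) k n 0
  linear_combination (norm := module) h (k + 1) n + h k n

/-- The exchange relation `P_{m+1} x_n - t x_n P_{m+1} = t P_m x_{n+1} - x_{n+1} P_m`. -/
def QRel (t : ℂ) (P x : ℤ → A) : Prop :=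
  ∀ m n, P (m + 1) * x n - t • (x n * P (m + 1)) = t • (P m * x (n + 1)) - x (n + 1) * P m

theorem QRel.swap {t : ℂ} {P x : ℤ → A} (h : QRel t P x) : QRel t x P := fun m n => by
  linear_combination (norm := module) h n m

theorem QRel.shift {t : ℂ} {P x : ℤ → A} (h : QRel t P x) (p : ℤ) :
    QRel t (fun k => P (k + p)) x := fun m n => by
  have := h (m + p) n
  rwa [show m + p + 1 = m + 1 + p by ring] at this

theorem QRel.smul {t : ℂ} {P x : ℤ → A} (h : QRel t P x) (c : ℂ) :
    QRel t (fun k => c • P k) x := fun m n => by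
  simp only [smul_mul_assoc, mul_smul_comm]
  linear_combination (norm := module) c • h m n

theorem QRel.add {t : ℂ} {P P' x : ℤ → A} (h : QRel t P x) (h' : QRel t P' x) :
    QRel t (fun k => P k + P' k) x := fun m n => by
  simp only [add_mul, mul_add]
  linear_combination (norm := module) h m n + h' m n

/-- Reversing the modes inverts the exchange scalar. This reduces the oscillation corners for the
sign `-` to those for the sign `+`. -/
theorem QRel.reflect {t : ℂ} (ht : t ≠ 0) {P x : ℤ → A} (h : QRel t P x) :
    QRel t⁻¹ (fun k => P (-k)) (fun k => x (-k)) := fun m n => by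
  have := h (-(m + 1)) (-(n + 1))
  rw [show -(m + 1) + 1 = -m by ring, show -(n + 1) + 1 = -n by ring] at this
  have h2 := congrArg (fun y => t⁻¹ • y) this
  simp only [smul_sub, smul_smul, inv_mul_cancel₀ ht, one_smul] at h2
  linear_combination (norm := module) -h2

/-- `QRel`, cleared of denominators. -/
theorem QRel.clear {p : ℂ} (hp : p ≠ 0) {P x : ℤ → A} (h : QRel p⁻¹ P x) (m n : ℤ) :
    p • (P (m + 1) * x n) - x n * P (m + 1) - P m * x (n + 1) + p • (x (n + 1) * P m) = 0 := by
  have h2 := congrArg (fun y => p • y) (h m n)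
  simp only [smul_sub, smul_smul, mul_inv_cancel₀ hp, one_smul] at h2
  linear_combination (norm := module) h2

/-- For `t = 1` the relation says that the commutator depends only on `k + n`, and a one-sided
function of that kind is zero. -/
theorem QRel.commute {P x : ℤ → A} (h : QRel 1 P x) (hP : OneSided P) (k n : ℤ) :
    P k * x n = x n * P k := by
  rw [← sub_eq_zero]
  refine OneSided.eq_zero_of_rec (F := fun k n => P k * x n - x n * P k) (a := 1) (b := -1)
    (hP.of_imp fun k hk => ?_) one_ne_zero (by norm_num) (fun k n => ?_) k n
  · funext n; simp [hk]
  · linear_combination (norm := module) h k n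

/-- The Serre corner with `P` in the slot of the neighbour. The recurrence is the operator `(T_k - p
T_m)(T_k - p T_n)`, with `T` the mode shifts. By the exchange relation each factor carries `P` to
the left across one `x`; what remains is a multiple of `P_{k+1}` times the quadratic relation of `x`
with itself. -/
theorem serre_corner_right {p : ℂ} (hp : p ≠ 0) {P x : ℤ → A} (hP : OneSided P)
    (hx : QRel (p ^ 2) x x) (hPx : QRel p⁻¹ P x) (k m n : ℤ) :
    p • (x m * x n * P k + x n * x m * P k) - (p ^ 2 + 1) • (x m * P k * x n + x n * P k * x m) +
      p • (P k * x n * x m + P k * x m * x n) = 0 := by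
  refine OneSided.eq_zero_of_rec_two
    (F := fun k m n => p • (x m * x n * P k + x n * x m * P k) -
      (p ^ 2 + 1) • (x m * P k * x n + x n * P k * x m) +
      p • (P k * x n * x m + P k * x m * x n)) (a := 1) (b := -p) (c := -p) (d := p ^ 2)
    (hP.of_imp fun k hk => ?_) one_ne_zero (pow_ne_zero _ hp) (fun k m n => ?_) k m n
  · funext m n; simp [hk]
  · have R := hPx.clear hp
    have Q := hx
    linear_combination (norm := (simp only [mul_sub, sub_mul, mul_add, add_mul, smul_mul_assoc,
        mul_smul_comm, mul_assoc, mul_zero, zero_mul]; module))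
      (-p) • (x m * R (k + 1) n - p • (x (m + 1) * R k n)
        + p • (R (k + 1) m * x n) - R k m * x (n + 1))
      + (p ^ 2 + 1) • (R (k + 1) m * x n - p • (R k m * x (n + 1)))
      + (-p) • (x n * R (k + 1) m - p • (x (n + 1) * R k m)
        + p • (R (k + 1) n * x m) - R k n * x (m + 1))
      + (p ^ 2 + 1) • (R (k + 1) n * x m - p • (R k n * x (m + 1)))
      + (1 - p ^ 2) • (P (k + 1) * Q m n)

/-- The Serre corner with `P` in place of one of the two equal generators. The operator is `(p² T_k
- T_n)(T_k - p T_l)`: the first factor moves `P` across `x`, the second across `y`, leaving a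
multiple of `P_{k+1}` times the exchange relation of `x` and `y`. -/
theorem serre_corner_left {p : ℂ} (hp : p ≠ 0) {P x y : ℤ → A} (hP : OneSided P)
    (hPx : QRel (p ^ 2) P x) (hPy : QRel p⁻¹ P y) (hxy : QRel p⁻¹ x y) (k n l : ℤ) :
    p • (P k * x n * y l + x n * P k * y l + y l * x n * P k + y l * P k * x n) -
      (p ^ 2 + 1) • (P k * y l * x n + x n * y l * P k) = 0 := by
  refine OneSided.eq_zero_of_rec_two
    (F := fun k n l => p • (P k * x n * y l + x n * P k * y l + y l * x n * P k + y l * P k * x n) -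
      (p ^ 2 + 1) • (P k * y l * x n + x n * y l * P k))
    (a := p ^ 2) (b := -1) (c := -p ^ 3) (d := p)
    (hP.of_imp fun k hk => ?_) (pow_ne_zero _ hp) hp (fun k n l => ?_) k n l
  · funext m n; simp [hk]
  · have Ry := hPy.clear hp
    have S := hxy.clear hp
    have Rx := hPx
    linear_combination (norm := (simp only [mul_sub, sub_mul, mul_add, add_mul, smul_mul_assoc,
        mul_smul_comm, mul_assoc, mul_zero, zero_mul]; module))
      (-p) • (Rx (k + 1) n * y l - p • (Rx k n * y (l + 1))
        + y l * Rx (k + 1) n - p • (y (l + 1) * Rx k n)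
        + Ry (k + 1) l * x n - p ^ 2 • (Ry k l * x (n + 1))
        + p ^ 2 • (Ry (k + 1) l * x n) - Ry k l * x (n + 1))
      + (p ^ 2 + 1) • (p ^ 2 • (x n * Ry (k + 1) l) - x (n + 1) * Ry k l
        + p • (Rx (k + 1) n * y l) - Rx k n * y (l + 1))
      + ((p ^ 2 + 1) * (p ^ 2 - 1)) • (P (k + 1) * S n l)

/-! ### Corners of the oscillation relation -/

/-- `q [[a, b]_{q⁻¹}, c]_q` for `c` even. -/
def tri (q : ℂ) (a b c : A) : A :=
  q • (a * b * c) - b * a * c - q ^ 2 • (c * a * b) + q • (c * b * a)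

theorem tri_zero_left (q : ℂ) (b c : A) : tri q 0 b c = 0 := by simp [tri]

theorem tri_zero_mid (q : ℂ) (a c : A) : tri q a 0 c = 0 := by simp [tri]

theorem tri_zero_right (q : ℂ) (a b : A) : tri q a b 0 = 0 := by simp [tri]

/-- Here `P` sits in the slot of `X_{M-1}` and the operator is `(T_k - q T_n)(T_k - q T_u)`. One
factor collapses `tri` to `P` times the inner bracket `D = [b, c]_q` (`step`). After the other
factor, only symmetrized brackets of `D` with `b` remain; `Z0` and `Z1` kill them, using that the
`b` anticommute and, for `Z1`, the exchange of `b` and `c`. -/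
theorem osc_corner_left {q : ℂ} (hq : q ≠ 0) {P b c : ℤ → A} (hP : OneSided P)
    (hPb : QRel q⁻¹ P b) (hPc : ∀ k l, P k * c l = c l * P k) (hbc : QRel q b c)
    (hbb : ∀ m n, b m * b n + b n * b m = 0) (k n u l : ℤ) :
    tri q (P k) (b n) (c l) * b u + b u * tri q (P k) (b n) (c l) +
      (tri q (P k) (b u) (c l) * b n + b n * tri q (P k) (b u) (c l)) = 0 := by
  have R := hPb.clear hq
  obtain ⟨D, hD⟩ : ∃ D : ℤ → A, ∀ n, D n = b n * c l - q • (c l * b n) := ⟨_, fun _ => rfl⟩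
  have step : ∀ k n, tri q (P (k + 1)) (b n) (c l) - q • tri q (P k) (b (n + 1)) (c l) =
      (1 - q ^ 2) • (P k * D (n + 1)) := fun k n => by
    rw [hD, tri, tri]
    linear_combination (norm := (simp only [mul_sub, sub_mul, mul_add, add_mul, smul_mul_assoc,
        mul_smul_comm, mul_assoc, mul_zero, zero_mul]; module))
      R k n * c l - q • (c l * R k n) - (q ^ 3 - q) • (hPc k l * b (n + 1))
  have Z0 : ∀ n u, q • (D n * b u) + b u * D n + q • (D u * b n) + b n * D u = 0 := fun n u => by
    rw [hD, hD]
    linear_combination (norm := (simp only [mul_sub, sub_mul, mul_add, add_mul, smul_mul_assoc,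
        mul_smul_comm, mul_assoc, mul_zero, zero_mul]; module))
      (-q ^ 2) • (c l * hbb n u) + hbb n u * c l
  have Z1 : ∀ n u, D (n + 1) * b u + q • (b u * D (n + 1)) +
      (D (u + 1) * b n + q • (b n * D (u + 1))) = 0 := fun n u => by
    rw [hD, hD]
    linear_combination (norm := (simp only [mul_sub, sub_mul, mul_add, add_mul, smul_mul_assoc,
        mul_smul_comm, mul_assoc, mul_zero, zero_mul]; module))
      hbc n l * b u + q • (b u * hbc n l) + hbc u l * b n + q • (b n * hbc u l)
      - c (l + 1) * hbb n u + q ^ 2 • (hbb n u * c (l + 1))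
  refine OneSided.eq_zero_of_rec_two
    (F := fun k n u => tri q (P k) (b n) (c l) * b u + b u * tri q (P k) (b n) (c l) +
      (tri q (P k) (b u) (c l) * b n + b n * tri q (P k) (b u) (c l)))
    (a := 1) (b := -q) (c := -q) (d := q ^ 2)
    (hP.of_imp fun k hk => ?_) one_ne_zero (pow_ne_zero _ hq) (fun k n u => ?_) k n u
  · funext m n; simp [hk, tri_zero_left]
  · linear_combination (norm := (simp only [mul_sub, sub_mul, mul_add, add_mul, smul_mul_assoc,
        mul_smul_comm, mul_assoc, mul_zero, zero_mul]; module))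
      step (k + 1) n * b u - q • (step k n * b (u + 1))
      + b u * step (k + 1) n - q • (b (u + 1) * step k n)
      + step (k + 1) u * b n - q • (step k u * b (n + 1))
      + b n * step (k + 1) u - q • (b (n + 1) * step k u)
      - (1 - q ^ 2) • (R k u * D (n + 1) + R k n * D (u + 1))
      + (1 - q ^ 2) • (P (k + 1) * Z1 n u) - (1 - q ^ 2) • (P k * Z0 (n + 1) (u + 1))

/-- The mirror image, with `P` in the slot of `X_{M+1}`: the operator is `(q T_k - T_n)(q T_k -
T_u)` and the inner bracket is `E = q [a, b]_{q⁻¹}`. -/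
theorem osc_corner_right {q : ℂ} (hq : q ≠ 0) {P a b : ℤ → A} (hP : OneSided P)
    (hPb : QRel q P b) (hPa : ∀ k m, P k * a m = a m * P k) (hab : QRel q⁻¹ a b)
    (hbb : ∀ m n, b m * b n + b n * b m = 0) (k n u m : ℤ) :
    tri q (a m) (b n) (P k) * b u + b u * tri q (a m) (b n) (P k) +
      (tri q (a m) (b u) (P k) * b n + b n * tri q (a m) (b u) (P k)) = 0 := by
  have r := hab.clear hq
  have R := hPb
  obtain ⟨E, hE⟩ : ∃ E : ℤ → A, ∀ n, E n = q • (a m * b n) - b n * a m := ⟨_, fun _ => rfl⟩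
  have step : ∀ k n, q • tri q (a m) (b n) (P (k + 1)) - tri q (a m) (b (n + 1)) (P k) =
      (1 - q ^ 2) • (P (k + 1) * E n) := fun k n => by
    rw [hE, tri, tri]
    linear_combination (norm := (simp only [mul_sub, sub_mul, mul_add, add_mul, smul_mul_assoc,
        mul_smul_comm, mul_assoc, mul_zero, zero_mul]; module))
      (-q) • (a m * R k n) + R k n * a m - q • (hPa (k + 1) m * b n)
      + q ^ 2 • (hPa k m * b (n + 1)) + q • (b n * hPa (k + 1) m) - b (n + 1) * hPa k m
  have Z0 : ∀ n u, q • (E n * b u) + b u * E n + q • (E u * b n) + b n * E u = 0 := fun n u => by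
    rw [hE, hE]
    linear_combination (norm := (simp only [mul_sub, sub_mul, mul_add, add_mul, smul_mul_assoc,
        mul_smul_comm, mul_assoc, mul_zero, zero_mul]; module))
      (q ^ 2) • (a m * hbb n u) - hbb n u * a m
  have Z1 : ∀ n u, E n * b (u + 1) + q • (b (u + 1) * E n) +
      (E u * b (n + 1) + q • (b (n + 1) * E u)) = 0 := fun n u => by
    rw [hE, hE]
    linear_combination (norm := (simp only [mul_sub, sub_mul, mul_add, add_mul, smul_mul_assoc,
        mul_smul_comm, mul_assoc, mul_zero, zero_mul]; module))
      q • (r m n * b u) + b u * r m n + q • (r m u * b n) + b n * r m u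
      - q ^ 2 • (a (m + 1) * hbb n u) + hbb n u * a (m + 1)
      + q • (a m * (hbb n (u + 1) + hbb u (n + 1)))
      - q • ((hbb n (u + 1) + hbb u (n + 1)) * a m)
  refine OneSided.eq_zero_of_rec_two
    (F := fun k n u => tri q (a m) (b n) (P k) * b u + b u * tri q (a m) (b n) (P k) +
      (tri q (a m) (b u) (P k) * b n + b n * tri q (a m) (b u) (P k)))
    (a := q ^ 2) (b := -q) (c := -q) (d := 1)
    (hP.of_imp fun k hk => ?_) (pow_ne_zero _ hq) one_ne_zero (fun k n u => ?_) k n u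
  · funext m n; simp [hk, tri_zero_right]
  · linear_combination (norm := (simp only [mul_sub, sub_mul, mul_add, add_mul, smul_mul_assoc,
        mul_smul_comm, mul_assoc, mul_zero, zero_mul]; module))
      q • (step (k + 1) n * b u) - step k n * b (u + 1)
      + q • (b u * step (k + 1) n) - b (u + 1) * step k n
      + q • (step (k + 1) u * b n) - step k u * b (n + 1)
      + q • (b n * step (k + 1) u) - b (n + 1) * step k u
      - (1 - q ^ 2) • (R (k + 1) u * E n + R (k + 1) n * E u)
      + (1 - q ^ 2) • (P (k + 1 + 1) * Z0 n u) - (1 - q ^ 2) • (P (k + 1) * Z1 n u)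

/-- Here `P` replaces one of the two odd generators. The expression collects the terms in which `P`
carries one fixed mode: inside `tri` from one half of the relation, outside from the other. Since
`P` commutes with `b`, the recurrence runs in the modes of `a` and `c`, with operator `(q T_k -
T_l)(T_k - q T_m)`. -/
theorem osc_corner_mid {q : ℂ} (hq : q ≠ 0) {P a b c : ℤ → A} (hP : OneSided P)
    (hPa : QRel q⁻¹ P a) (hPc : QRel q P c) (hPb : ∀ k n, P k * b n = b n * P k)
    (hac : ∀ m l, a m * c l = c l * a m) (hab : QRel q⁻¹ a b) (hbc : QRel q b c)
    (k m l n : ℤ) :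
    tri q (a m) (P k) (c l) * b n - b n * tri q (a m) (P k) (c l) +
      (P k * tri q (a m) (b n) (c l) - tri q (a m) (b n) (c l) * P k) = 0 := by
  have r := hab.clear hq
  have EA : ∀ k m, a m * P (k + 1) - q • (a (m + 1) * P k) =
      q • (P (k + 1) * a m) - P k * a (m + 1) := fun k m => by
    linear_combination (norm := module) -hPa.clear hq k m
  have EC : ∀ k l, q • (c l * P (k + 1)) - c (l + 1) * P k =
      P (k + 1) * c l - q • (P k * c (l + 1)) := fun k l => by
    linear_combination (norm := module) -hPc k l
  have bP : ∀ k n, b n * P k = P k * b n := fun k n => (hPb k n).symm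
  have bP' : ∀ k n z, b n * (P k * z) = P k * (b n * z) := fun k n z => by
    rw [← mul_assoc, bP, mul_assoc]
  have ca : ∀ m l, c l * a m = a m * c l := fun k n => (hac k n).symm
  have ca' : ∀ m l z, c l * (a m * z) = a m * (c l * z) := fun k n z => by
    rw [← mul_assoc, ca, mul_assoc]
  -- With `P` inside, the operator collapses `tri` to one monomial; `step2` measures the failure of
  -- `P` outside to commute with `tri`; `step3` says that the two contributions cancel.
  have step1 : ∀ k m l, q • tri q (a m) (P (k + 1 + 1)) (c l)
      - q ^ 2 • tri q (a (m + 1)) (P (k + 1)) (c l) - tri q (a m) (P (k + 1)) (c (l + 1))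
      + q • tri q (a (m + 1)) (P k) (c (l + 1)) =
      (q ^ 2 - 1) ^ 2 • (P (k + 1) * a m * c (l + 1)) := fun k m l => by
    simp only [tri]
    linear_combination (norm := (simp only [mul_sub, sub_mul, mul_add, add_mul, smul_mul_assoc,
        mul_smul_comm, mul_assoc, mul_zero, zero_mul, bP, bP', ca, ca']; module))
      q • (q • (EA (k + 1) m * c l) - EA k m * c (l + 1))
      - q ^ 2 • (a m * EC (k + 1) l - q • (a (m + 1) * EC k l)
        + EA (k + 1) m * c l - q • (EA k m * c (l + 1)))
      + q • (EC (k + 1) l * a m - q • (EC k l * a (m + 1)))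
  have step2 : ∀ k m l,
      q • (tri q (a m) (b n) (c l) * P (k + 1 + 1))
      - q ^ 2 • (tri q (a (m + 1)) (b n) (c l) * P (k + 1))
      - tri q (a m) (b n) (c (l + 1)) * P (k + 1)
      + q • (tri q (a (m + 1)) (b n) (c (l + 1)) * P k) =
      q • (P (k + 1 + 1) * tri q (a m) (b n) (c l))
      - q ^ 2 • (P (k + 1) * tri q (a (m + 1)) (b n) (c l))
      - P (k + 1) * tri q (a m) (b n) (c (l + 1))
      + q • (P k * tri q (a (m + 1)) (b n) (c (l + 1)))
      - (q ^ 2 - 1) • (P (k + 1) * tri q (a m) (b n) (c (l + 1))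
        - P (k + 1) * tri q (a (m + 1)) (b n) (c l)) := fun k m l => by
    simp only [tri]
    linear_combination (norm := (simp only [mul_sub, sub_mul, mul_add, add_mul, smul_mul_assoc,
        mul_smul_comm, mul_assoc, mul_zero, zero_mul, bP, bP', ca, ca']; module))
      q • (a m * b n * EC (k + 1) l - q • (a (m + 1) * b n * EC k l)
        + EA (k + 1) m * b n * c l - q • (EA k m * b n * c (l + 1)))
      - b n * (a m * EC (k + 1) l - q • (a (m + 1) * EC k l)
        + EA (k + 1) m * c l - q • (EA k m * c (l + 1)))
      - q ^ 2 • ((a m * EC (k + 1) l - q • (a (m + 1) * EC k l)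
        + EA (k + 1) m * c l - q • (EA k m * c (l + 1))) * b n)
      + q • (q • (c l * b n * EA (k + 1) m) - c (l + 1) * b n * EA k m
        + q • (EC (k + 1) l * b n * a m) - EC k l * b n * a (m + 1))
  have step3 : ∀ m l, (q ^ 2 - 1) • (a m * c (l + 1) * b n - b n * a m * c (l + 1))
      + tri q (a m) (b n) (c (l + 1)) - tri q (a (m + 1)) (b n) (c l) = 0 := fun m l => by
    simp only [tri]
    linear_combination (norm := (simp only [mul_sub, sub_mul, mul_add, add_mul, smul_mul_assoc,
        mul_smul_comm, mul_assoc, mul_zero, zero_mul, bP, bP', ca, ca']; module))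
      q • (c l * r m n) - r m n * c l - a m * hbc n l + q • (hbc n l * a m)
  refine OneSided.eq_zero_of_rec_two
    (F := fun k m l => tri q (a m) (P k) (c l) * b n - b n * tri q (a m) (P k) (c l) +
      (P k * tri q (a m) (b n) (c l) - tri q (a m) (b n) (c l) * P k))
    (a := q) (b := -q ^ 2) (c := -1) (d := q)
    (hP.of_imp fun k hk => ?_) hq hq (fun k m l => ?_) k m l
  · funext m n; simp [hk, tri_zero_mid]
  · linear_combination (norm := (simp only [mul_sub, sub_mul, mul_add, add_mul, smul_mul_assoc,
        mul_smul_comm, mul_assoc, mul_zero, zero_mul, bP, bP']; module))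
      step1 k m l * b n - b n * step1 k m l - step2 k m l
      + (q ^ 2 - 1) • (P (k + 1) * step3 m l)

end Exchange

/-! ### Exponentials of currents -/

section ExpCoeff

theorem coeff_pow_eq_zero {R : Type} [CommRing R] {f : PowerSeries R}
    (hf : PowerSeries.coeff 0 f = 0) {n k : ℕ} (h : n < k) : PowerSeries.coeff n (f ^ k) = 0 := by
  have hX : PowerSeries.X ∣ f := PowerSeries.X_dvd_iff.mpr (by simpa using hf)
  exact PowerSeries.X_pow_dvd_iff.mp (pow_dvd_pow_of_dvd hX k) n h

theorem expCoeff_zero {A : Type} [Ring A] [Algebra ℂ A] (f : PowerSeries A) :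
    expCoeff f 0 = 1 := by
  simp [expCoeff]

/-- The coefficients of the differential equation `E' = f' E` for `E = exp f`, obtained termwise
from `(f^{k+1})' = (k+1) f^k f'`. -/
theorem expCoeff_succ {R : Type} [CommRing R] [Algebra ℂ R] {f : PowerSeries R}
    (hf : PowerSeries.coeff 0 f = 0) (n : ℕ) :
    ((n + 1 : ℕ) : ℂ) • expCoeff f (n + 1) =
      ∑ s ∈ Finset.range (n + 1),
        ((s + 1 : ℕ) : ℂ) • (PowerSeries.coeff (s + 1) f * expCoeff f (n - s)) := by
  have hpow : ∀ k, ((n + 1 : ℕ) : ℂ) • PowerSeries.coeff (n + 1) (f ^ (k + 1)) =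
      ((k + 1 : ℕ) : ℂ) • ∑ s ∈ Finset.range (n + 1),
        ((s + 1 : ℕ) : ℂ) • (PowerSeries.coeff (s + 1) f * PowerSeries.coeff (n - s) (f ^ k)) := by
    intro k
    have h := congrArg (PowerSeries.coeff n) ((PowerSeries.derivative R).leibniz_pow f (k + 1))
    rw [PowerSeries.coeff_derivative, Nat.add_sub_cancel, map_nsmul, smul_eq_mul,
      mul_comm (f ^ k), PowerSeries.coeff_mul,
      Finset.Nat.sum_antidiagonal_eq_sum_range_succ_mk] at h
    simp only [PowerSeries.coeff_derivative] at h
    simp only [Nat.cast_smul_eq_nsmul]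
    rw [nsmul_eq_mul, mul_comm, Nat.cast_succ, h]
    congr 1
    refine Finset.sum_congr rfl fun s _ => ?_
    rw [nsmul_eq_mul]
    push_cast
    ring
  -- Powers `f^k` with `k > n - s` have no coefficient in degree `n - s`, so all the sums can share
  -- one range and be interchanged.
  have hE : ∀ s ∈ Finset.range (n + 1), expCoeff f (n - s) =
      ∑ k ∈ Finset.range (n + 1), ((k.factorial : ℂ)⁻¹) • PowerSeries.coeff (n - s) (f ^ k) := by
    intro s _
    refine Finset.sum_subset (Finset.range_mono (by omega)) fun k _ hk => ?_
    rw [coeff_pow_eq_zero hf (by simpa using hk), smul_zero]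
  rw [Finset.sum_congr rfl fun s hs => by rw [hE s hs], expCoeff, Finset.sum_range_succ', smul_add,
    Finset.smul_sum]
  simp only [pow_zero, PowerSeries.coeff_one, Nat.succ_ne_zero, if_false, smul_zero, add_zero,
    Finset.mul_sum, Finset.smul_sum]
  rw [Finset.sum_comm]
  refine Finset.sum_congr rfl fun k _ => ?_
  rw [smul_comm, hpow, Finset.smul_sum, Finset.smul_sum]
  refine Finset.sum_congr rfl fun s _ => ?_
  rw [mul_smul_comm, smul_smul, smul_comm _ ((s + 1 : ℕ) : ℂ)]
  congr 2
  rw [Nat.factorial_succ, Nat.cast_mul, mul_inv, mul_comm _ (_⁻¹), mul_assoc, inv_mul_cancel₀,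
    mul_one]
  exact Nat.cast_ne_zero.mpr (Nat.succ_ne_zero k)

theorem map_expCoeff {A B : Type} [Ring A] [Algebra ℂ A] [Ring B] [Algebra ℂ B] (g : A →ₐ[ℂ] B)
    (f : PowerSeries A) (n : ℕ) :
    g (expCoeff f n) = expCoeff (PowerSeries.map (g : A →+* B) f) n := by
  simp only [expCoeff, map_sum, map_smul, ← map_pow, PowerSeries.coeff_map]
  rfl

variable {A : Type} [Ring A] [Algebra ℂ A]

/-- If `n E_n = ∑ s a_s E_{n-s}` and `[a_s, X_m] = (Q^s - Q^{-s}) / s X_{m + δ s}`, then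
`(1 - Q x) E X = (1 - Q⁻¹ x) X E`, where `x` shifts the indices of both `E` and `X`. -/
theorem exp_exchange {E X : ℤ → A} {a : ℕ → A} {δ : ℤ} {Q : ℂ} (hE₀ : E 0 = 1)
    (hneg : E (-1) = 0)
    (hE : ∀ n : ℕ, (n : ℂ) • E n =
      ∑ s ∈ Finset.range n, ((s + 1 : ℕ) : ℂ) • (a (s + 1) * E ((n : ℤ) - 1 - s)))
    (ha : ∀ (s : ℕ) m, ((s + 1 : ℕ) : ℂ) • (a (s + 1) * X m) =
      ((s + 1 : ℕ) : ℂ) • (X m * a (s + 1)) +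
        (Q ^ (s + 1) - Q⁻¹ ^ (s + 1)) • X (m + δ * (s + 1))) (n : ℕ) (m : ℤ) :
    E n * X m - Q • (E ((n : ℤ) - 1) * X (m + δ)) =
      X m * E n - Q⁻¹ • (X (m + δ) * E ((n : ℤ) - 1)) := by
  -- The added term `s = n` contains `E_{-1} = 0`; it makes the range agree with that for `n + 1`.
  have hE' : ∀ n : ℕ, (n : ℂ) • E n =
      ∑ s ∈ Finset.range (n + 1), ((s + 1 : ℕ) : ℂ) • (a (s + 1) * E ((n : ℤ) - 1 - s)) := by
    intro n
    rw [Finset.sum_range_succ, ← hE, show (n : ℤ) - 1 - n = -1 by ring, hneg, mul_zero, smul_zero,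
      add_zero]
  obtain ⟨L, hL⟩ : ∃ L : ℤ → ℤ → A, ∀ n m, L n m = E n * X m - Q • (E (n - 1) * X (m + δ)) :=
    ⟨_, fun _ _ => rfl⟩
  obtain ⟨R, hR⟩ : ∃ R : ℤ → ℤ → A, ∀ n m, R n m = X m * E n - Q⁻¹ • (X (m + δ) * E (n - 1)) :=
    ⟨_, fun _ _ => rfl⟩
  -- Both sides of the claim satisfy this recursion, the coefficient form of a first-order
  -- differential equation in the variable of `E`, so they agree once they agree at `n = 0`. The
  -- terms with powers of the scalar telescope through `G`.
  have hLrec : ∀ (n : ℕ) m, ((n + 1 : ℕ) : ℂ) • L ((n + 1 : ℕ) : ℤ) m =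
      ∑ s ∈ Finset.range (n + 1), (((s + 1 : ℕ) : ℂ) • (a (s + 1) * L ((n : ℤ) - s) m) -
        Q ^ (s + 1) • L ((n : ℤ) - s) (m + δ * (s + 1))) := by
    intro n m
    obtain ⟨G, hG⟩ : ∃ G : ℕ → A, ∀ s,
        G s = Q ^ (s + 1) • (E ((n : ℤ) - s) * X (m + δ * (s + 1))) :=
      ⟨_, fun _ => rfl⟩
    have hs : ∀ s : ℕ, ((s + 1 : ℕ) : ℂ) • (a (s + 1) * L ((n : ℤ) - s) m) -
        Q ^ (s + 1) • L ((n : ℤ) - s) (m + δ * (s + 1)) =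
        (((s + 1 : ℕ) : ℂ) • (a (s + 1) * E (((n + 1 : ℕ) : ℤ) - 1 - s))) * X m -
        Q • ((((s + 1 : ℕ) : ℂ) • (a (s + 1) * E ((n : ℤ) - 1 - s))) * X (m + δ)) -
        (G s - G (s + 1)) := by
      intro s
      rw [hL, hL, hG, hG, show ((n + 1 : ℕ) : ℤ) - 1 - s = n - s by push_cast; ring,
        show (n : ℤ) - (s + 1 : ℕ) = n - 1 - s by push_cast; ring,
        show (n : ℤ) - s - 1 = n - 1 - s by ring,
        show m + δ * (((s + 1 : ℕ) : ℤ) + 1) = m + δ * (s + 1) + δ by push_cast; ring]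
      simp only [mul_sub, smul_mul_assoc, mul_smul_comm, mul_assoc]
      module
    rw [Finset.sum_congr rfl fun s _ => hs s, Finset.sum_sub_distrib, Finset.sum_sub_distrib,
      Finset.sum_range_sub', ← Finset.sum_mul, ← hE, ← Finset.smul_sum, ← Finset.sum_mul, ← hE',
      hG, hG, hL, show (n : ℤ) - (n + 1 : ℕ) = -1 by push_cast; ring, hneg,
      show ((n + 1 : ℕ) : ℤ) - 1 = n by push_cast; ring]
    simp only [Nat.cast_zero, sub_zero, zero_add, mul_one, zero_mul, smul_zero, smul_mul_assoc]
    push_cast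
    module
  have hRrec : ∀ (n : ℕ) m, ((n + 1 : ℕ) : ℂ) • R ((n + 1 : ℕ) : ℤ) m =
      ∑ s ∈ Finset.range (n + 1), (((s + 1 : ℕ) : ℂ) • (a (s + 1) * R ((n : ℤ) - s) m) -
        Q ^ (s + 1) • R ((n : ℤ) - s) (m + δ * (s + 1))) := by
    intro n m
    obtain ⟨G, hG⟩ : ∃ G : ℕ → A,
        ∀ s, G s = Q⁻¹ ^ (s + 1) • (X (m + δ * (s + 1)) * E ((n : ℤ) - s)) := ⟨_, fun _ => rfl⟩
    have hs : ∀ s : ℕ, ((s + 1 : ℕ) : ℂ) • (a (s + 1) * R ((n : ℤ) - s) m) -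
        Q ^ (s + 1) • R ((n : ℤ) - s) (m + δ * (s + 1)) =
        X m * (((s + 1 : ℕ) : ℂ) • (a (s + 1) * E (((n + 1 : ℕ) : ℤ) - 1 - s))) -
        Q⁻¹ • (X (m + δ) * (((s + 1 : ℕ) : ℂ) • (a (s + 1) * E ((n : ℤ) - 1 - s)))) -
        (G s - G (s + 1)) := by
      intro s
      have e1 := congrArg (· * E ((n : ℤ) - s)) (ha s m)
      have e2 := congrArg (· * E ((n : ℤ) - 1 - s)) (ha s (m + δ))
      rw [hR, hR, hG, hG, show ((n + 1 : ℕ) : ℤ) - 1 - s = n - s by push_cast; ring,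
        show (n : ℤ) - (s + 1 : ℕ) = n - 1 - s by push_cast; ring,
        show (n : ℤ) - s - 1 = n - 1 - s by ring,
        show m + δ * (((s + 1 : ℕ) : ℤ) + 1) = m + δ * (s + 1) + δ by push_cast; ring]
      rw [show m + δ + δ * ((s : ℤ) + 1) = m + δ * (s + 1) + δ by ring] at e2
      simp only [add_mul, mul_sub, smul_mul_assoc, mul_smul_comm, mul_assoc] at e1 e2 ⊢
      linear_combination (norm := module) e1 - Q⁻¹ • e2
    rw [Finset.sum_congr rfl fun s _ => hs s, Finset.sum_sub_distrib, Finset.sum_sub_distrib,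
      Finset.sum_range_sub', ← Finset.mul_sum, ← hE, ← Finset.smul_sum, ← Finset.mul_sum, ← hE',
      hG, hG, hR, show (n : ℤ) - (n + 1 : ℕ) = -1 by push_cast; ring, hneg,
      show ((n + 1 : ℕ) : ℤ) - 1 = n by push_cast; ring]
    simp only [Nat.cast_zero, sub_zero, zero_add, mul_one, mul_zero, smul_zero, mul_smul_comm]
    push_cast
    module
  have main : ∀ n : ℕ, ∀ m, L n m = R n m := by
    intro n
    induction n using Nat.strong_induction_on with
    | _ n ih =>
      intro m
      rcases n with _ | n
      · rw [hL, hR, Nat.cast_zero, zero_sub, hE₀, hneg]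
        simp
      · have h : ((n + 1 : ℕ) : ℂ) ≠ 0 := Nat.cast_ne_zero.mpr n.succ_ne_zero
        refine smul_right_injective A h ?_
        change _ • _ = _ • _
        rw [hLrec, hRrec]
        refine Finset.sum_congr rfl fun s hs => ?_
        have hsn : s ≤ n := by simpa [Nat.lt_succ_iff] using hs
        rw [← Nat.cast_sub hsn, ih (n - s) (by omega), ih (n - s) (by omega)]
  have := main n m
  rwa [hL, hR] at this

end ExpCoeff

/-! ### Cartan families -/

section Cartan

set_option linter.unusedSectionVars false

variable {M N : ℕ} {A B : Type} [Ring A] [Algebra ℂ A] [Ring B] [Algebra ℂ B]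

/-- The relations of the Cartan part. -/
structure IsCartan (K : ℤˣ → Node M N → A) (h : Node M N → {s : ℤ // s ≠ 0} → A) : Prop where
  K_inv : ∀ e i, K e i * K (-e) i = 1
  K_K : ∀ i j, K 1 i * K 1 j = K 1 j * K 1 i
  K_h : ∀ i j s, K 1 i * h j s = h j s * K 1 i
  h_h : ∀ i j s t, h i s * h j t = h j t * h i s

theorem units_cases (e : ℤˣ) : e = 1 ∨ e = -1 := Int.units_eq_one_or e

theorem laurent_isCartan : IsCartan (lK M N) (lh M N) where
  K_inv e i := by
    rw [lK, lK, AddMonoidAlgebra.single_mul_single, ← Finsupp.single_add, mul_one]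
    simp [AddMonoidAlgebra.one_def]
  K_K i j := mul_comm _ _
  K_h i j s := mul_comm _ _
  h_h i j s t := mul_comm _ _

namespace IsCartan

variable {K : ℤˣ → Node M N → A} {h : Node M N → {s : ℤ // s ≠ 0} → A}

/-- `K_i` as a unit. -/
def unit (C : IsCartan K h) (i : Node M N) : Aˣ where
  val := K 1 i
  inv := K (-1) i
  val_inv := C.K_inv 1 i
  inv_val := by simpa using C.K_inv (-1) i

theorem val_unit_zpow (C : IsCartan K h) (e : ℤˣ) (i : Node M N) :
    ((C.unit i ^ (e : ℤ) : Aˣ) : A) = K e i := by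
  rcases units_cases e with rfl | rfl
  · simp [unit]
  · rw [Units.val_neg, Units.val_one, zpow_neg, zpow_one]; rfl

theorem commute_K_K (C : IsCartan K h) (e e' : ℤˣ) (i j : Node M N) :
    Commute (K e i) (K e' j) := by
  rw [← C.val_unit_zpow e, ← C.val_unit_zpow e']
  have : Commute (C.unit i) (C.unit j) := Units.ext (C.K_K i j)
  exact congrArg Units.val (this.zpow_zpow _ _)

theorem commute_K_h (C : IsCartan K h) (e : ℤˣ) (i j : Node M N) (s : {s : ℤ // s ≠ 0}) :
    Commute (K e i) (h j s) := by
  rw [← C.val_unit_zpow e]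
  have : Commute (C.unit i : A) (h j s) := C.K_h i j s
  exact this.units_zpow_left _

/-- The polynomial variables go to the `h_{i,s}` by evaluation. The exponent group is free abelian,
so its map to the unit group is fixed by sending the basis to the units `K_i`. -/
theorem exists_lift_of_comm {R : Type} [CommRing R] [Algebra ℂ R] {K : ℤˣ → Node M N → R}
    {h : Node M N → {s : ℤ // s ≠ 0} → R} (C : IsCartan K h) :
    ∃ f : Laurent M N →ₐ[ℂ] R, (∀ i s, f (lh M N i s) = h i s) ∧
      ∀ e i, f (lK M N e i) = K e i := by
  let g : (Node M N →₀ ℤ) →+ Additive Rˣ :=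
    Finsupp.liftAddHom fun i => zmultiplesHom (Additive Rˣ) (Additive.ofMul (C.unit i))
  let g' : Multiplicative (Node M N →₀ ℤ) →* R :=
    (Units.coeHom R).comp (AddMonoidHom.toMultiplicativeLeft g)
  refine ⟨AddMonoidAlgebra.liftNCAlgHom (MvPolynomial.aeval fun x => h x.1 x.2) g'
    fun x y => mul_comm _ _, fun i s => ?_, fun e i => ?_⟩
  · rw [lh]
    change AddMonoidAlgebra.liftNC _ _ _ = _
    rw [AddMonoidAlgebra.liftNC_single]
    simp
  · rw [lK]
    change AddMonoidAlgebra.liftNC _ _ _ = _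
    rw [AddMonoidAlgebra.liftNC_single]
    have : g' (Multiplicative.ofAdd (Finsupp.single i (e : ℤ))) = K e i := by
      rw [← C.val_unit_zpow e]
      simp only [g', g, MonoidHom.comp_apply, Units.coeHom_apply]
      congr 1
      change Additive.toMul (Finsupp.liftAddHom _ (Finsupp.single i (e : ℤ))) = _
      rw [Finsupp.liftAddHom_apply_single, zmultiplesHom_apply]
      rfl
    simp [this]

/-- The universal property of the Laurent polynomial algebra, for noncommutative targets. -/
theorem exists_lift (C : IsCartan K h) :
    ∃ f : Laurent M N →ₐ[ℂ] A, (∀ i s, f (lh M N i s) = h i s) ∧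
      ∀ e i, f (lK M N e i) = K e i := by
  let S : Set A := {x | ∃ e i, x = K e i} ∪ {x | ∃ i s, x = h i s}
  have hS : ∀ x ∈ S, ∀ y ∈ S, x * y = y * x := by
    rintro _ (⟨e, i, rfl⟩ | ⟨i, s, rfl⟩) _ (⟨e', j, rfl⟩ | ⟨j, t, rfl⟩)
    · exact C.commute_K_K e e' i j
    · exact C.commute_K_h e i j t
    · exact (C.commute_K_h e' j i s).symm
    · exact C.h_h i j s t
  -- The Cartan family commutes, hence generates a commutative subalgebra, in which the commutative
  -- universal property is available.
  have hcomm := Algebra.isMulCommutative_adjoin ℂ hS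
  let _ : CommRing (Algebra.adjoin ℂ S) :=
    { (inferInstance : Ring (Algebra.adjoin ℂ S)) with
      mul_comm := fun a b => hcomm.is_comm.comm a b }
  have hK : ∀ e i, K e i ∈ Algebra.adjoin ℂ S := fun e i =>
    Algebra.subset_adjoin (Or.inl ⟨e, i, rfl⟩)
  have hh : ∀ i s, h i s ∈ Algebra.adjoin ℂ S := fun i s =>
    Algebra.subset_adjoin (Or.inr ⟨i, s, rfl⟩)
  have C' : IsCartan (A := Algebra.adjoin ℂ S) (fun e i => ⟨K e i, hK e i⟩)
      (fun i s => ⟨h i s, hh i s⟩) :=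
    { K_inv := fun e i => Subtype.ext (C.K_inv e i)
      K_K := fun i j => mul_comm _ _
      K_h := fun i j s => mul_comm _ _
      h_h := fun i j s t => mul_comm _ _ }
  obtain ⟨f, hf, hf'⟩ := C'.exists_lift_of_comm
  exact ⟨(Algebra.adjoin ℂ S).val.comp f, fun i s => congrArg Subtype.val (hf i s),
    fun e i => congrArg Subtype.val (hf' e i)⟩

/-- The algebra homomorphism from the Laurent polynomial algebra defined by a Cartan family. -/
def lift (C : IsCartan K h) : Laurent M N →ₐ[ℂ] A := C.exists_lift.choose

@[simp]
theorem lift_lh (C : IsCartan K h) (i s) : C.lift (lh M N i s) = h i s :=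
  C.exists_lift.choose_spec.1 i s

@[simp]
theorem lift_lK (C : IsCartan K h) (e i) : C.lift (lK M N e i) = K e i :=
  C.exists_lift.choose_spec.2 e i

end IsCartan

theorem lK_mem_adjoin (x : Node M N →₀ ℤ) :
    (AddMonoidAlgebra.single x 1 : Laurent M N) ∈ Algebra.adjoin ℂ
      ({x | ∃ e i, x = lK M N e i} ∪ {x | ∃ i s, x = lh M N i s}) := by
  induction x using Finsupp.induction_linear with
  | zero => exact Subalgebra.one_mem _
  | add x y hx hy =>
    have := Subalgebra.mul_mem _ hx hy
    rwa [AddMonoidAlgebra.single_mul_single, mul_one] at this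
  | single i n =>
    have key : ∀ (e : ℤˣ) (k : ℕ), (AddMonoidAlgebra.single (Finsupp.single i ((e : ℤ) * k)) 1 :
        Laurent M N) = lK M N e i ^ k := by
      intro e k
      rw [lK, AddMonoidAlgebra.single_pow, one_pow, Finsupp.smul_single, nsmul_eq_mul, mul_comm]
    rcases Int.eq_nat_or_neg n with ⟨k, rfl | rfl⟩
    · have := key 1 k
      rw [Units.val_one, one_mul] at this
      rw [this]
      refine Subalgebra.pow_mem _ (Algebra.subset_adjoin ?_) _
      exact Or.inl ⟨_, _, rfl⟩
    · have := key (-1) k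
      rw [Units.val_neg, Units.val_one, neg_one_mul] at this
      rw [this]
      refine Subalgebra.pow_mem _ (Algebra.subset_adjoin ?_) _
      exact Or.inl ⟨_, _, rfl⟩

theorem adjoin_laurent : Algebra.adjoin ℂ
    ({x | ∃ e i, x = lK M N e i} ∪ {x | ∃ i s, x = lh M N i s}) =
      (⊤ : Subalgebra ℂ (Laurent M N)) := by
  rw [eq_top_iff]
  rintro x -
  have hC : ∀ f : MvPolynomial (Node M N × {s : ℤ // s ≠ 0}) ℂ,
      (AddMonoidAlgebra.single 0 f : Laurent M N) ∈ Algebra.adjoin ℂ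
        ({x | ∃ e i, x = lK M N e i} ∪ {x | ∃ i s, x = lh M N i s}) := by
    intro f
    induction f using MvPolynomial.induction_on with
    | C a => exact Subalgebra.algebraMap_mem _ a
    | add f g hf hg => rw [AddMonoidAlgebra.single_add]; exact Subalgebra.add_mem _ hf hg
    | mul_X f x hf =>
      have := Subalgebra.mul_mem _ hf
        (Algebra.subset_adjoin (Or.inr ⟨x.1, x.2, rfl⟩) : lh M N x.1 x.2 ∈ _)
      rwa [lh, AddMonoidAlgebra.single_mul_single, add_zero] at this
  induction x using AddMonoidAlgebra.induction_linear with
  | zero => exact Subalgebra.zero_mem _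
  | add f g hf hg => exact Subalgebra.add_mem _ hf hg
  | single x f =>
    have := Subalgebra.mul_mem _ (hC f) (lK_mem_adjoin x)
    rwa [AddMonoidAlgebra.single_mul_single, zero_add, mul_one] at this

/-- A property of elements of the Laurent polynomial algebra that is closed under the algebra
operations holds if it holds for the generators. -/
theorem laurent_mem (S : Subalgebra ℂ (Laurent M N)) (hK : ∀ e i, lK M N e i ∈ S)
    (hh : ∀ i s, lh M N i s ∈ S) (x : Laurent M N) : x ∈ S := by
  have : Algebra.adjoin ℂ ({x | ∃ e i, x = lK M N e i} ∪ {x | ∃ i s, x = lh M N i s}) ≤ S := by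
    rw [Algebra.adjoin_le_iff]
    rintro _ (⟨e, i, rfl⟩ | ⟨i, s, rfl⟩)
    exacts [hK e i, hh i s]
  rw [adjoin_laurent] at this
  exact this trivial

end Cartan

/-! ### The currents `φ` -/

section Phi

variable {M N : ℕ} {A B : Type} [Ring A] [Algebra ℂ A] [Ring B] [Algebra ℂ B]

/-- `e (q_i - q_i⁻¹) ∑_{s > 0} h_{es} w^s` in any algebra. -/
def serOf (M : ℕ) (q : ℂ) (e : ℤˣ) (i : ℕ) (h : {s : ℤ // s ≠ 0} → A) : PowerSeries A :=
  PowerSeries.mk fun s : ℕ =>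
    if hs : s = 0 then 0
    else ((e : ℤ) * (qi M q i - (qi M q i)⁻¹) : ℂ) •
      h ⟨(e : ℤ) * (s : ℤ), mul_ne_zero e.ne_zero (Int.natCast_ne_zero.mpr hs)⟩

/-- The elements `φ_n^e` in any algebra. -/
def phiOf (M : ℕ) (q : ℂ) (e : ℤˣ) (i : ℕ) (K : A) (h : {s : ℤ // s ≠ 0} → A) (n : ℤ) : A :=
  if 0 ≤ (e : ℤ) * n then K * expCoeff (serOf M q e i h) ((e : ℤ) * n).toNat else 0

theorem map_serOf (f : A →ₐ[ℂ] B) (q : ℂ) (e : ℤˣ) (i : ℕ) (h : {s : ℤ // s ≠ 0} → A) :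
    PowerSeries.map (f : A →+* B) (serOf M q e i h) = serOf M q e i fun s => f (h s) := by
  ext n
  rw [PowerSeries.coeff_map, serOf, serOf, PowerSeries.coeff_mk, PowerSeries.coeff_mk]
  split_ifs
  · exact map_zero f
  · exact map_smul f _ _

theorem map_phiOf (f : A →ₐ[ℂ] B) (q : ℂ) (e : ℤˣ) (i : ℕ) (K : A) (h : {s : ℤ // s ≠ 0} → A)
    (n : ℤ) : f (phiOf M q e i K h n) = phiOf M q e i (f K) (fun s => f (h s)) n := by
  unfold phiOf
  split_ifs
  · rw [map_mul, map_expCoeff, map_serOf]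
  · exact map_zero f

theorem phiOf_oneSided (q : ℂ) (e : ℤˣ) (i : ℕ) (K : A) (h : {s : ℤ // s ≠ 0} → A) :
    OneSided (phiOf M q e i K h) := by
  rcases units_cases e with rfl | rfl
  · exact Or.inl ⟨0, fun k hk => if_neg (by simpa using hk)⟩
  · exact Or.inr ⟨0, fun k hk => if_neg (by simpa using hk)⟩

/-- The commutation relations of a Cartan family with currents `X_j` of sign `e`. -/
structure IsWeight (q : ℂ) (e : ℤˣ) (K : ℤˣ → Node M N → A)
    (h : Node M N → {s : ℤ // s ≠ 0} → A) (X : Node M N → ℤ → A) : Prop where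
  K_X : ∀ i j n, K 1 i * X j n * K (-1) i = q ^ ((e : ℤ) * cart M i j) • X j n
  h_X : ∀ i j s n, h i s * X j n - X j n * h i s =
    ((e : ℤ) * (qInt (qi M q i) ((s : ℤ) * lsgn M i * cart M i j) / (s : ℤ)) : ℂ) • X j (n + s)

variable {q : ℂ} {e : ℤˣ} {K : ℤˣ → Node M N → A} {h : Node M N → {s : ℤ // s ≠ 0} → A}
  {X : Node M N → ℤ → A}

theorem IsWeight.K_mul (C : IsCartan K h) (hW : IsWeight q e K h X) (hq : q ≠ 0) (e' : ℤˣ)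
    (i j : Node M N) (n : ℤ) :
    K e' i * X j n = q ^ ((e' : ℤ) * ((e : ℤ) * cart M i j)) • (X j n * K e' i) := by
  have h1 : K 1 i * X j n = q ^ ((e : ℤ) * cart M i j) • (X j n * K 1 i) := by
    rw [← smul_mul_assoc, ← hW.K_X, mul_assoc _ (K (-1) i)]
    have := C.K_inv (-1) i
    rw [neg_neg] at this
    rw [this, mul_one]
  rcases units_cases e' with rfl | rfl
  · simpa using h1
  · have h2 := congrArg (fun y => K (-1) i * y * K (-1) i) h1
    have e1 : K (-1) i * K 1 i = 1 := by simpa using C.K_inv (-1) i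
    have e2 : K 1 i * K (-1) i = 1 := C.K_inv 1 i
    simp only [mul_smul_comm, smul_mul_assoc] at h2
    rw [← mul_assoc, e1, one_mul, ← mul_assoc, mul_assoc _ (K 1 i), e2, mul_one] at h2
    rw [h2, smul_smul, Units.val_neg, Units.val_one, neg_one_mul, zpow_neg,
      inv_mul_cancel₀ (zpow_ne_zero _ hq), one_smul]

theorem qi_sub_inv_ne_zero (hq : q ≠ 0) (hq' : ∀ n : ℕ, 0 < n → q ^ n ≠ 1) (M i : ℕ) :
    qi M q i - (qi M q i)⁻¹ ≠ 0 := by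
  have h2 : q - q⁻¹ ≠ 0 := by
    intro h
    refine hq' 2 (by norm_num) ?_
    rw [sub_eq_zero] at h
    rw [pow_two]
    nth_rewrite 2 [h]
    exact mul_inv_cancel₀ hq
  unfold qi lsgn
  split_ifs
  · simpa using h2
  · rw [zpow_neg, zpow_one, inv_inv]
    intro h
    apply h2
    linear_combination -h

theorem qi_zpow_lsgn (M i : ℕ) : qi M q i ^ lsgn M i = q := by
  unfold qi lsgn
  split_ifs <;> simp

/-- The exchange relations of `φ_i^{e'}` and `X_j^e`. -/
theorem IsWeight.phi_exchange (C : IsCartan K h) (hW : IsWeight q e K h X) (hq : q ≠ 0)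
    (hq' : ∀ n : ℕ, 0 < n → q ^ n ≠ 1) (e' : ℤˣ) (i j : Node M N) :
    QRel (q ^ ((e : ℤ) * cart M i j)) (phiOf M q e' i (K e' i) (h i)) (X j) := by
  set Q : ℂ := q ^ ((e' : ℤ) * ((e : ℤ) * cart M i j)) with hQ
  have hQ0 : Q ≠ 0 := zpow_ne_zero _ hq
  let E : ℤ → A := fun n => if 0 ≤ n then expCoeff (serOf M q e' i (h i)) n.toNat else 0
  have hEnat : ∀ n : ℕ, E n = expCoeff (serOf M q e' i (h i)) n := fun n => by
    simp [E]
  have hex := exp_exchange (E := E) (X := X j) (δ := e') (Q := Q)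
    (a := fun s => PowerSeries.coeff s (serOf M q e' i (h i)))
    (by simpa using (hEnat 0).trans (expCoeff_zero _)) (by simp [E]) ?_ ?_
  -- Multiplying by `K_i^{e'}` from the left and moving it past `X` multiplies the right-hand side
  -- by `Q`, which turns the scalars `1, Q⁻¹` into the `Q, 1` of an exchange relation.
  · have hK : ∀ (n : ℕ) (m : ℤ), K e' i * E n * X j m -
        Q • (K e' i * E ((n : ℤ) - 1) * X j (m + e')) =
        Q • (X j m * (K e' i * E n)) - X j (m + e') * (K e' i * E ((n : ℤ) - 1)) := by
      intro n m
      have h1 := congrArg (fun y => K e' i * y) (hex n m)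
      simp only [mul_sub, mul_smul_comm] at h1
      rw [← mul_assoc _ (X j m), ← mul_assoc _ (X j (m + e')), hW.K_mul C hq, hW.K_mul C hq] at h1
      simp only [smul_mul_assoc, smul_smul] at h1
      rw [← hQ, inv_mul_cancel₀ hQ0, one_smul] at h1
      simpa only [mul_assoc] using h1
    have hφ : ∀ n : ℤ, phiOf M q e' i (K e' i) (h i) n = K e' i * E (e' * n) := by
      intro n
      simp only [phiOf, E]
      split_ifs <;> simp
    intro m n
    rw [hφ, hφ]
    rcases units_cases e' with rfl | rfl
    · simp only [Units.val_one, one_mul] at hK hQ ⊢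
      -- Below `-1` both coefficients of `E` vanish. The boundary mode `m = -1` is covered by the
      -- case `k = 0`, through `E (-1) = 0`.
      rcases lt_or_ge m (-1) with hm | hm
      · have z1 : E (m + 1) = 0 := if_neg (by omega)
        have z2 : E m = 0 := if_neg (by omega)
        simp [z1, z2]
      · obtain ⟨k, hk⟩ := Int.eq_ofNat_of_zero_le (show 0 ≤ m + 1 by omega)
        have := hK k n
        rw [← hk, add_sub_cancel_right] at this
        rw [← hQ]
        linear_combination (norm := module) this
    · simp only [Units.val_neg, Units.val_one, neg_mul, one_mul] at hK hQ ⊢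
      rcases lt_or_ge 0 m with hm | hm
      · have z1 : E (-(m + 1)) = 0 := if_neg (by omega)
        have z2 : E (-m) = 0 := if_neg (by omega)
        simp only [z1, z2, mul_zero, zero_mul, smul_zero]
      · obtain ⟨k, hk⟩ := Int.eq_ofNat_of_zero_le (show 0 ≤ -m by omega)
        -- The modes of `φ^-` run downwards, so the formula is used with `X` one mode higher and
        -- then multiplied by `Q⁻¹`.
        have := hK k (n + 1)
        rw [← hk, show -m - 1 = -(m + 1) by ring, show n + 1 + -1 = n by ring] at this
        have hQ' : q ^ ((e : ℤ) * cart M i j) = Q⁻¹ := by rw [hQ, zpow_neg, inv_inv]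
        rw [hQ']
        have h2 := congrArg (fun y => Q⁻¹ • y) this
        simp only [smul_sub, smul_smul, inv_mul_cancel₀ hQ0, one_smul] at h2
        linear_combination (norm := module) -h2
  · intro n
    rcases n with _ | n
    · simp
    -- The recursion for the exponential needs a commutative ring, so it is proved for the Laurent
    -- polynomials and transported along `C.lift`.
    · have hrec := expCoeff_succ (f := serOf M q e' i (lh M N i)) (by simp [serOf]) n
      have h2 := congrArg C.lift hrec
      simp only [map_smul, map_sum, map_mul, map_expCoeff, map_serOf, C.lift_lh] at h2
      rw [hEnat, h2]
      refine Finset.sum_congr rfl fun s hs => ?_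
      have hsn : s ≤ n := by simpa [Nat.lt_succ_iff] using hs
      rw [show ((n + 1 : ℕ) : ℤ) - 1 - s = ((n - s : ℕ) : ℤ) by push_cast [hsn]; ring, hEnat]
      congr 2
      have h3 := congrArg (PowerSeries.coeff (s + 1)) (map_serOf (M := M) C.lift q e' i (lh M N i))
      rw [PowerSeries.coeff_map] at h3
      simp only [C.lift_lh] at h3
      exact h3
  · intro s m
    simp only [serOf, PowerSeries.coeff_mk, Nat.succ_ne_zero, dite_false]
    have h1 := hW.h_X i j ⟨(e' : ℤ) * ((s + 1 : ℕ) : ℤ), mul_ne_zero e'.ne_zero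
      (Int.natCast_ne_zero.mpr s.succ_ne_zero)⟩ m
    rw [sub_eq_iff_eq_add] at h1
    simp only [smul_mul_assoc, mul_smul_comm]
    rw [h1]
    have hs : ((s + 1 : ℕ) : ℂ) ≠ 0 := Nat.cast_ne_zero.mpr s.succ_ne_zero
    have hu := qi_sub_inv_ne_zero hq hq' M i
    -- The factor `q_i - q_i⁻¹` of the exponent cancels the denominator of the quantum integer, the
    -- sign `e'` and the `s + 1` cancel the mode in the denominator, and `q_i^{l_i} = q` removes the
    -- dependence on `l_i`.
    have hcoef : ((s + 1 : ℕ) : ℂ) * (((e' : ℤ) * (qi M q i - (qi M q i)⁻¹) : ℂ) *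
        ((e : ℤ) * (qInt (qi M q i) ((e' : ℤ) * ((s + 1 : ℕ) : ℤ) * lsgn M i * cart M i j) /
          (((e' : ℤ) * ((s + 1 : ℕ) : ℤ) : ℤ) : ℂ)))) = Q ^ (s + 1) - Q⁻¹ ^ (s + 1) := by
      have hpow : ∀ z : ℤ, qi M q i ^ (z * lsgn M i * cart M i j) = q ^ (z * cart M i j) := by
        intro z
        rw [show z * lsgn M i * cart M i j = lsgn M i * (z * cart M i j) by ring, zpow_mul,
          qi_zpow_lsgn]
      have hQs : Q ^ (s + 1) = q ^ ((e' : ℤ) * (s + 1 : ℕ) * ((e : ℤ) * cart M i j)) := by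
        rw [hQ, ← zpow_natCast, ← zpow_mul]
        congr 1
        push_cast
        ring
      rw [qInt, inv_pow, hQs, ← zpow_neg,
        show -((e' : ℤ) * ((s + 1 : ℕ) : ℤ) * lsgn M i * cart M i j) =
          -((e' : ℤ) * ((s + 1 : ℕ) : ℤ)) * lsgn M i * cart M i j by ring, hpow, hpow]
      have he' : ((e' : ℤ) : ℂ) ≠ 0 := Int.cast_ne_zero.mpr e'.ne_zero
      push_cast at hs ⊢
      have hrat : ∀ y : ℂ, ((s : ℂ) + 1) * ((e' : ℤ) * (qi M q i - (qi M q i)⁻¹) *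
          ((e : ℤ) * (y / (qi M q i - (qi M q i)⁻¹) / ((e' : ℤ) * ((s : ℂ) + 1))))) =
          (e : ℤ) * y := fun y => by
        generalize qi M q i - (qi M q i)⁻¹ = u at hu
        field_simp
      rw [hrat]
      rcases units_cases e with rfl | rfl
      · simp only [Units.val_one, one_mul, Int.cast_one, neg_mul]
      · simp only [Units.val_neg, Units.val_one, Int.cast_neg, Int.cast_one, neg_mul, one_mul,
          mul_neg, neg_neg, neg_sub]
    rw [← hcoef]
    push_cast
    module

end Phi

/-! ### Cartan matrix -/

section CartanMatrix

theorem epsForm_symm (M i j : ℕ) : epsForm M i j = epsForm M j i := by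
  unfold epsForm
  split_ifs with h h' h' <;> simp_all

theorem cart_symm (M i j : ℕ) : cart M i j = cart M j i := by
  rw [cart, cart, epsForm_symm M i, epsForm_symm M i, epsForm_symm M (i + 1),
    epsForm_symm M (i + 1)]
  ring

theorem cart_self_ne_zero {M i : ℕ} (h : i ≠ M) : cart M i i ≠ 0 := by
  unfold cart epsForm lsgn
  split_ifs <;> omega

theorem cart_self_eq {M i j : ℕ} (hi : i ≠ M) (h : cart M i j = 1 ∨ cart M i j = -1) :
    cart M i i = -2 * cart M i j := by
  revert hi h
  unfold cart epsForm lsgn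
  split_ifs <;> omega

theorem ne_of_cart {M i j : ℕ} (h : cart M i j = 1 ∨ cart M i j = -1) : i ≠ j := by
  rintro rfl
  revert h
  unfold cart epsForm lsgn
  split_ifs <;> omega

theorem cart_odd_self (M : ℕ) : cart M M M = 0 := by
  unfold cart epsForm lsgn
  split_ifs <;> omega

theorem cart_pred {M : ℕ} (hM : 1 < M) : cart M (M - 1) M = -1 := by
  unfold cart epsForm lsgn
  split_ifs <;> omega

theorem cart_succ (M : ℕ) : cart M M (M + 1) = 1 := by
  unfold cart epsForm lsgn
  split_ifs <;> omega

theorem cart_pred_succ {M : ℕ} (hM : 1 < M) : cart M (M - 1) (M + 1) = 0 := by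
  unfold cart epsForm lsgn
  split_ifs <;> omega

theorem par_eq_one_iff {M i : ℕ} : par M i = 1 ↔ i = M := by
  unfold par
  split_ifs with h <;> simp [h]

end CartanMatrix

/-! ### Families satisfying the nilpotent relations -/

section Families

variable {M N : ℕ} {A B : Type} [Ring A] [Algebra ℂ A] [Ring B] [Algebra ℂ B]

/-- The family `X` satisfies all relations of the nilpotent part. -/
def Sat (q : ℂ) (e : ℤˣ) (X : Node M N → ℤ → A) : Prop := ∀ a b, NilRel M N q e X a b → a = b

/-- The family `X` satisfies the relations of degree 2. -/
structure QuadSat (q : ℂ) (e : ℤˣ) (X : Node M N → ℤ → A) : Prop where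
  comm : ∀ (i j : Node M N) (m n : ℤ), cart M i j = 0 →
    sbr (par M i) (par M j) 1 (X i m) (X j n) = 0
  quad : ∀ i j : Node M N, cart M i j ≠ 0 → QRel (q ^ ((e : ℤ) * cart M i j)) (X i) (X j)

theorem Sat.quadSat {q : ℂ} {e : ℤˣ} {X : Node M N → ℤ → A} (h : Sat q e X) : QuadSat q e X where
  comm i j m n hc := h _ _ (.comm i j m n hc)
  quad i j hc m n := h _ _ (.quad i j m n hc)

theorem map_sbr (f : A →ₐ[ℂ] B) (pa pb : ZMod 2) (u : ℂ) (a b : A) :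
    f (sbr pa pb u a b) = sbr pa pb u (f a) (f b) := by
  simp only [sbr, map_sub, map_smul, map_mul]

theorem NilRel.map {q : ℂ} {e : ℤˣ} {X : Node M N → ℤ → A} (f : A →ₐ[ℂ] B) {a b : A}
    (h : NilRel M N q e X a b) : NilRel M N q e (fun i n => f (X i n)) (f a) (f b) := by
  cases h with
  | comm i j m n hc => rw [map_sbr, map_zero]; exact .comm i j m n hc
  | quad i j m n hc =>
    simp only [map_sub, map_smul, map_mul]; exact .quad i j m n hc
  | serre i j m n k hc hi =>
    simp only [map_add, map_sbr, map_zero]; exact .serre i j m n k hc hi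
  | osc a b c m n k u hM hN ha hb hc =>
    simp only [map_add, map_sbr, map_zero]; exact .osc a b c m n k u hM hN ha hb hc

/-- The evaluation of the free algebra on the `X_{i,n}` at a family. -/
def ev (X : Node M N → ℤ → A) : FreeAlgebra ℂ (Node M N × ℤ) →ₐ[ℂ] A :=
  FreeAlgebra.lift ℂ fun g => X g.1 g.2

@[simp]
theorem ev_ι (X : Node M N → ℤ → A) (g : Node M N × ℤ) :
    ev X (FreeAlgebra.ι ℂ g) = X g.1 g.2 := FreeAlgebra.lift_ι_apply _ _

theorem PRel.nilRel_ev {q : ℂ} {e : ℤˣ} (X : Node M N → ℤ → A)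
    {a b : FreeAlgebra ℂ (Node M N × ℤ)} (h : PRel M N q e a b) :
    NilRel M N q e X (ev X a) (ev X b) := by
  have := h.map (ev X)
  simpa only [ev_ι] using this

theorem NilRel.exists_pRel {q : ℂ} {e : ℤˣ} {X : Node M N → ℤ → A} {a b : A}
    (h : NilRel M N q e X a b) : ∃ a' b', PRel M N q e a' b' ∧ ev X a' = a ∧ ev X b' = b := by
  cases h with
  | comm i j m n hc => exact ⟨_, _, .comm i j m n hc, by simp [map_sbr], by simp⟩
  | quad i j m n hc => exact ⟨_, _, .quad i j m n hc, by simp, by simp⟩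
  | serre i j m n k hc hi => exact ⟨_, _, .serre i j m n k hc hi, by simp [map_sbr], by simp⟩
  | osc a b c m n k u hM hN ha hb hc =>
    exact ⟨_, _, .osc a b c m n k u hM hN ha hb hc, by simp [map_sbr], by simp⟩

/-- Every instance of a relation is the evaluation of one fixed instance in the free algebra, where
parity can be read off words and homomorphisms applied. -/
theorem sat_iff_ev {q : ℂ} {e : ℤˣ} {X : Node M N → ℤ → A} :
    Sat q e X ↔ ∀ a b, PRel M N q e a b → ev X a = ev X b := by
  refine ⟨fun h a b hab => h _ _ (PRel.nilRel_ev X hab), fun h a b hab => ?_⟩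
  obtain ⟨a', b', hr, rfl, rfl⟩ := hab.exists_pRel
  exact h a' b' hr

end Families

/-! ### Upper triangular matrices -/

section Upper

set_option linter.unusedSectionVars false
set_option linter.unusedSimpArgs false

variable {A : Type} [Ring A] [Algebra ℂ A]

/-- The upper triangular matrix with diagonal `a`, `b` and corner `d`. -/
def up (a d b : A) : Matrix (Fin 2) (Fin 2) A := !![a, d; 0, b]

theorem up_mul (a d b a' d' b' : A) :
    up a d b * up a' d' b' = up (a * a') (a * d' + d * b') (b * b') := by
  simp [up]

theorem up_add (a d b a' d' b' : A) : up a d b + up a' d' b' = up (a + a') (d + d') (b + b') := by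
  ext i j; fin_cases i <;> fin_cases j <;> simp [up]

theorem up_sub (a d b a' d' b' : A) : up a d b - up a' d' b' = up (a - a') (d - d') (b - b') := by
  ext i j; fin_cases i <;> fin_cases j <;> simp [up]

theorem up_smul (c : ℂ) (a d b : A) : c • up a d b = up (c • a) (c • d) (c • b) := by
  ext i j; fin_cases i <;> fin_cases j <;> simp [up]

theorem up_apply_corner (a d b : A) : up a d b 0 1 = d := rfl

theorem algebraMap_eq_up (c : ℂ) : algebraMap ℂ (Matrix (Fin 2) (Fin 2) A) c =
    up (algebraMap ℂ A c) 0 (algebraMap ℂ A c) := by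
  ext i j; fin_cases i <;> fin_cases j <;> simp [up, Matrix.algebraMap_matrix_apply]

variable {M N : ℕ}

/-- The diagonal entries of upper triangular matrices multiply independently, so only the corner is
new: it is the value at `r` of the derivation, twisted by the two diagonal evaluations, that sends
`X_{i,n}` to `D i n`. -/
theorem ev_up (X D Y : Node M N → ℤ → A) (r : FreeAlgebra ℂ (Node M N × ℤ)) :
    ev (fun i n => up (X i n) (D i n) (Y i n)) r =
      up (ev X r) (ev (fun i n => up (X i n) (D i n) (Y i n)) r 0 1) (ev Y r) := by
  induction r using FreeAlgebra.induction with
  | grade0 c => simp [algebraMap_eq_up, up_apply_corner]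
  | grade1 g => simp [up_apply_corner]
  | mul a b ha hb =>
    rw [map_mul, ha, hb, up_mul, up_apply_corner, map_mul, map_mul]
  | add a b ha hb =>
    rw [map_add, ha, hb, up_add, up_apply_corner, map_add, map_add]

end Upper

/-! ### Twisted derivations -/

section Corner

set_option linter.unusedSectionVars false
set_option linter.unusedSimpArgs false

variable {M N : ℕ} {A : Type} [Ring A] [Algebra ℂ A] {q : ℂ} {e : ℤˣ} {X : Node M N → ℤ → A}

/-- A sum of two one-sided currents having the exchange relations of `φ_i` with the `X_j`. -/
def IsPsi (q : ℂ) (e : ℤˣ) (X : Node M N → ℤ → A) (i : Node M N) (P : ℤ → A) : Prop :=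
  ∃ P₁ P₂ : ℤ → A, OneSided P₁ ∧ OneSided P₂ ∧
    (∀ j : Node M N, QRel (q ^ ((e : ℤ) * cart M i j)) P₁ (X j)) ∧
    (∀ j : Node M N, QRel (q ^ ((e : ℤ) * cart M i j)) P₂ (X j)) ∧ ∀ k, P k = P₁ k + P₂ k

theorem IsPsi.quad {i : Node M N} {P : ℤ → A} (h : IsPsi q e X i P) (j : Node M N) :
    QRel (q ^ ((e : ℤ) * cart M i j)) P (X j) := by
  obtain ⟨P₁, P₂, -, -, h₁, h₂, hP⟩ := h
  rw [show P = fun k => P₁ k + P₂ k from funext hP]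
  exact (h₁ j).add (h₂ j)

theorem IsPsi.commute {i : Node M N} {P : ℤ → A} (h : IsPsi q e X i P) {j : Node M N}
    (hc : cart M i j = 0) (k n : ℤ) : P k * X j n = X j n * P k := by
  obtain ⟨P₁, P₂, o₁, o₂, h₁, h₂, hP⟩ := h
  have h₁ := h₁ j
  have h₂ := h₂ j
  rw [hc, mul_zero, zpow_zero] at h₁ h₂
  rw [hP, add_mul, mul_add, h₁.commute o₁, h₂.commute o₂]

/-- The sign `(-1)^{|i||k|}`. -/
def tw (M i k : ℕ) : ℂ := if par M i = 1 ∧ par M k = 1 then -1 else 1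

theorem tw_of_ne {i k : ℕ} (h : i ≠ k) : tw M i k = 1 :=
  if_neg fun ⟨h₁, h₂⟩ => h ((par_eq_one_iff.mp h₁).trans (par_eq_one_iff.mp h₂).symm)

theorem tw_of_even_left {i k : ℕ} (h : i ≠ M) : tw M i k = 1 :=
  if_neg fun h' => h (par_eq_one_iff.mp h'.1)

theorem tw_odd : tw M M M = -1 := if_pos ⟨par_eq_one_iff.mpr rfl, par_eq_one_iff.mpr rfl⟩

theorem sbr_eq (pa pb : ℕ) (u : ℂ) (a b : A) :
    sbr (par M pa) (par M pb) u a b = a * b - (tw M pa pb * u) • (b * a) := rfl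

theorem sbr_even_left (pb : ZMod 2) (u : ℂ) (a b : A) : sbr 0 pb u a b = a * b - u • (b * a) := by
  simp [sbr]

theorem sbr_even_right (pa : ZMod 2) (u : ℂ) (a b : A) : sbr pa 0 u a b = a * b - u • (b * a) := by
  simp [sbr]

theorem sbr_odd (u : ℂ) (a b : A) : sbr 1 1 u a b = a * b + u • (b * a) := by
  simp [sbr]

/-- The family defining the twisted derivation with `X_{k,n} ↦ δ_{k,i} P_n`. -/
def twFam (X : Node M N → ℤ → A) (i : Node M N) (P : ℤ → A) (k : Node M N) (n : ℤ) :
    Matrix (Fin 2) (Fin 2) A :=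
  up (tw M i k • X k n) (if k = i then P n else 0) (X k n)

theorem twFam_self {i : Node M N} {P : ℤ → A} (n : ℤ) :
    twFam X i P i n = up (tw M i i • X i n) (P n) (X i n) := by simp [twFam]

theorem twFam_ne {i k : Node M N} {P : ℤ → A} (h : k ≠ i) (n : ℤ) :
    twFam X i P k n = up (X k n) 0 (X k n) := by
  rw [twFam, if_neg h, tw_of_ne (fun h' => h (Subtype.ext h'.symm)), one_smul]

/-- If both nodes equal `i`, the node is the odd one and the sign `-1` turns the corner of the
anticommutator into `[P_m, X_n] + [P_n, X_m]`. In every case the current commutes with the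
generators it meets. -/
theorem corner_comm {i : Node M N} {P : ℤ → A} (hP : IsPsi q e X i P) {k l : Node M N}
    (m n : ℤ) (hc : cart M k l = 0) :
    sbr (par M k) (par M l) 1 (twFam X i P k m) (twFam X i P l n) 0 1 = 0 := by
  rw [sbr_eq]
  by_cases hk : k = i
  · subst hk
    by_cases hl : l = k
    · subst hl
      have hM : (l : ℕ) = M := by
        by_contra h
        exact cart_self_ne_zero h hc
      rw [twFam_self, twFam_self, hM, tw_odd]
      simp only [up_mul, up_smul, up_sub, up_apply_corner]
      simp only [smul_mul_assoc, hP.commute hc]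
      module
    · rw [twFam_self, twFam_ne hl, tw_of_ne fun h => hl (Subtype.ext h.symm)]
      simp only [up_mul, up_smul, up_sub, up_apply_corner, hP.commute hc]
      simp
  · by_cases hl : l = i
    · subst hl
      rw [cart_symm] at hc
      rw [twFam_self, twFam_ne hk, tw_of_ne fun h => hk (Subtype.ext h)]
      simp only [up_mul, up_smul, up_sub, up_apply_corner, hP.commute hc]
      simp
    · rw [twFam_ne hk, twFam_ne hl]
      simp only [up_mul, up_smul, up_sub, up_apply_corner]
      simp

theorem corner_quad {i : Node M N} {P : ℤ → A} (hP : IsPsi q e X i P) {k l : Node M N}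
    (m n : ℤ) (hc : cart M k l ≠ 0) :
    (twFam X i P k (m + 1) * twFam X i P l n -
        q ^ ((e : ℤ) * cart M k l) • (twFam X i P l n * twFam X i P k (m + 1))) 0 1 =
      (q ^ ((e : ℤ) * cart M k l) • (twFam X i P k m * twFam X i P l (n + 1)) -
        twFam X i P l (n + 1) * twFam X i P k m) 0 1 := by
  by_cases hk : k = i
  · subst hk
    by_cases hl : l = k
    · subst hl
      have hM : (l : ℕ) ≠ M := by
        intro h
        rw [h] at hc
        exact hc (cart_odd_self M)
      simp only [twFam_self, tw_of_even_left hM, one_smul, up_mul, up_smul, up_sub,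
        up_apply_corner]
      linear_combination (norm := module) hP.quad l m n + (hP.quad l).swap m n
    · simp only [twFam_self, twFam_ne hl, up_mul, up_smul, up_sub, up_apply_corner, mul_zero,
        zero_mul, zero_add, add_zero]
      exact hP.quad l m n
  · by_cases hl : l = i
    · subst hl
      rw [cart_symm] at hc
      simp only [twFam_self, twFam_ne hk, up_mul, up_smul, up_sub, up_apply_corner, mul_zero,
        zero_mul, zero_add, add_zero]
      rw [cart_symm]
      exact (hP.quad k).swap m n
    · simp [twFam_ne hk, twFam_ne hl, up_mul, up_smul, up_sub, up_apply_corner]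

/-- The expanded Serre relation involves only `q + q⁻¹`, which is unchanged by `q ↔ q⁻¹`. One
identity in `p` therefore serves all signs of `e` and of the Cartan entry. -/
theorem unscale {p : ℂ} (hp : p = q ∨ p = q⁻¹) (hq : q ≠ 0) {a b c : A}
    (h : p • a - (p ^ 2 + 1) • b + p • c = 0) : a - (q + q⁻¹) • b + c = 0 := by
  have hp0 : p ≠ 0 := by
    rcases hp with rfl | rfl
    exacts [hq, inv_ne_zero hq]
  have hs : p⁻¹ * (p ^ 2 + 1) = q + q⁻¹ := by
    rcases hp with rfl | rfl
    · field_simp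
    · field_simp
      ring
  have h2 := congrArg (fun y => p⁻¹ • y) h
  simp only [smul_add, smul_sub, smul_smul, inv_mul_cancel₀ hp0, one_smul, smul_zero, hs] at h2
  exact h2

theorem zpow_units_mul {c : ℤ} (hc : c = 1 ∨ c = -1) (e : ℤˣ) :
    (q ^ ((e : ℤ) * c))⁻¹ = q ∨ (q ^ ((e : ℤ) * c))⁻¹ = q⁻¹ := by
  rcases hc with rfl | rfl <;> rcases units_cases e with rfl | rfl <;> simp

theorem corner_serre (hq : q ≠ 0) (hX : QuadSat q e X) {i : Node M N} {P : ℤ → A}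
    (hP : IsPsi q e X i P) {j l : Node M N} (m n k : ℤ)
    (hc : cart M j l = 1 ∨ cart M j l = -1) (hj : (j : ℕ) ≠ M) :
    (sbr (par M j) (par M j + par M l) q (twFam X i P j m)
        (sbr (par M j) (par M l) q⁻¹ (twFam X i P j n) (twFam X i P l k)) +
      sbr (par M j) (par M j + par M l) q (twFam X i P j n)
        (sbr (par M j) (par M l) q⁻¹ (twFam X i P j m) (twFam X i P l k))) 0 1 = 0 := by
  have hjl : j ≠ l := fun h => ne_of_cart hc (congrArg _ h)
  -- With this `p` the exchange scalar between `j` and `l` is `p⁻¹`, and that of `j` with itself is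
  -- `p²`, because `c_{j,j} = -2 c_{j,l}`.
  obtain ⟨p, hp⟩ : ∃ p, p = (q ^ ((e : ℤ) * cart M j l))⁻¹ := ⟨_, rfl⟩
  have hpq : p = q ∨ p = q⁻¹ := hp ▸ zpow_units_mul hc e
  have hp0 : p ≠ 0 := hp ▸ inv_ne_zero (zpow_ne_zero _ hq)
  have hpi : q ^ ((e : ℤ) * cart M j l) = p⁻¹ := by rw [hp, inv_inv]
  have hpi' : q ^ ((e : ℤ) * cart M l j) = p⁻¹ := by rw [cart_symm, hpi]
  have hp2 : q ^ ((e : ℤ) * cart M j j) = p ^ 2 := by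
    rw [cart_self_eq hj hc, hp, inv_pow, ← zpow_natCast, ← zpow_mul, ← zpow_neg]
    congr 1
    push_cast
    ring
  have hjj : QRel (p ^ 2) (X j) (X j) := hp2 ▸ hX.quad j j (cart_self_ne_zero hj)
  have hjlX : QRel p⁻¹ (X j) (X l) := hpi ▸ hX.quad j l (by rcases hc with h | h <;> simp [h])
  have hpar : par M j = 0 := if_neg hj
  obtain ⟨P₁, P₂, o₁, o₂, h₁, h₂, hP'⟩ := hP
  -- Since `j` is even and distinct from `l`, no signs occur. The corner can involve `P` only if `i`
  -- is `j` or `l`; `P` is then split into its one-sided parts.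
  rw [hpar]
  simp only [sbr_even_left]
  by_cases h1 : j = i
  · subst h1
    have g₁ := serre_corner_left hp0 o₁ (hp2 ▸ h₁ j) (hpi ▸ h₁ l) hjlX
    have g₂ := serre_corner_left hp0 o₂ (hp2 ▸ h₂ j) (hpi ▸ h₂ l) hjlX
    have g : ∀ k n l', (P k * X j n * X l l' + X j n * P k * X l l') -
        (q + q⁻¹) • (P k * X l l' * X j n + X j n * X l l' * P k) +
        (X l l' * X j n * P k + X l l' * P k * X j n) = 0 := fun k n l' => by
      refine unscale hpq hq ?_
      rw [hP']
      linear_combination (norm := (simp only [mul_add, add_mul, mul_assoc]; module))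
        g₁ k n l' + g₂ k n l'
    simp only [twFam_self, twFam_ne hjl.symm, tw_of_even_left hj, one_smul, up_mul, up_smul, up_sub,
      up_add, up_apply_corner, mul_zero, zero_mul, zero_add, add_zero]
    have e1 := g m n k
    have e2 := g n m k
    have hqq : q * q⁻¹ = 1 := mul_inv_cancel₀ hq
    simp only [mul_sub, sub_mul, mul_add, add_mul, smul_mul_assoc, mul_smul_comm, mul_assoc,
      smul_sub, smul_add, smul_smul, hqq, one_smul, add_smul] at e1 e2 ⊢
    linear_combination (norm := module) e1 + e2
  · by_cases h2 : l = i
    · subst h2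
      have g₁ := serre_corner_right hp0 o₁ hjj (hpi' ▸ h₁ j)
      have g₂ := serre_corner_right hp0 o₂ hjj (hpi' ▸ h₂ j)
      have g : (X j m * X j n * P k + X j n * X j m * P k) -
          (q + q⁻¹) • (X j m * P k * X j n + X j n * P k * X j m) +
          (P k * X j n * X j m + P k * X j m * X j n) = 0 := by
        refine unscale hpq hq ?_
        rw [hP']
        linear_combination (norm := (simp only [mul_add, add_mul, mul_assoc]; module))
          g₁ k m n + g₂ k m n
      simp only [twFam_self, twFam_ne h1, up_mul, up_smul, up_sub,
        up_add, up_apply_corner, mul_zero, zero_mul, zero_add, add_zero]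
      have hqq : q * q⁻¹ = 1 := mul_inv_cancel₀ hq
      simp only [mul_sub, sub_mul, mul_add, add_mul, smul_mul_assoc, mul_smul_comm, mul_assoc,
        smul_sub, smul_add, smul_smul, hqq, one_smul, add_smul] at g ⊢
      linear_combination (norm := module) g
    · simp [twFam_ne h1, twFam_ne h2, up_mul, up_smul, up_sub, up_add, up_apply_corner]

theorem osc_corner_left_sign (hq : q ≠ 0) {P b c : ℤ → A} (hP : OneSided P)
    (hPb : QRel (q ^ ((e : ℤ) * -1)) P b) (hPc : ∀ k l, P k * c l = c l * P k)
    (hbc : QRel (q ^ ((e : ℤ) * 1)) b c)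
    (hbb : ∀ m n, b m * b n + b n * b m = 0) (k n u l : ℤ) :
    tri q (P k) (b n) (c l) * b u + b u * tri q (P k) (b n) (c l) +
      (tri q (P k) (b u) (c l) * b n + b n * tri q (P k) (b u) (c l)) = 0 := by
  rcases units_cases e with rfl | rfl
  · exact osc_corner_left hq hP (by simpa using hPb) hPc (by simpa using hbc) hbb k n u l
  · have hPb' := QRel.reflect hq (by simpa using hPb : QRel q P b)
    have hbc' := QRel.reflect (inv_ne_zero hq) (by simpa using hbc : QRel q⁻¹ b c)
    rw [inv_inv] at hbc'
    simpa using osc_corner_left hq hP.reflect hPb' (fun k l => hPc _ _) hbc'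
      (fun m n => hbb _ _) (-k) (-n) (-u) (-l)

theorem osc_corner_right_sign (hq : q ≠ 0) {P a b : ℤ → A} (hP : OneSided P)
    (hPb : QRel (q ^ ((e : ℤ) * 1)) P b) (hPa : ∀ k m, P k * a m = a m * P k)
    (hab : QRel (q ^ ((e : ℤ) * -1)) a b)
    (hbb : ∀ m n, b m * b n + b n * b m = 0) (k n u m : ℤ) :
    tri q (a m) (b n) (P k) * b u + b u * tri q (a m) (b n) (P k) +
      (tri q (a m) (b u) (P k) * b n + b n * tri q (a m) (b u) (P k)) = 0 := by
  rcases units_cases e with rfl | rfl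
  · exact osc_corner_right hq hP (by simpa using hPb) hPa (by simpa using hab) hbb k n u m
  · have hab' := QRel.reflect hq (by simpa using hab : QRel q a b)
    have hPb' := QRel.reflect (inv_ne_zero hq) (by simpa using hPb : QRel q⁻¹ P b)
    rw [inv_inv] at hPb'
    simpa using osc_corner_right hq hP.reflect hPb' (fun k l => hPa _ _) hab'
      (fun m n => hbb _ _) (-k) (-n) (-u) (-m)

theorem osc_corner_mid_sign (hq : q ≠ 0) {P a b c : ℤ → A} (hP : OneSided P)
    (hPa : QRel (q ^ ((e : ℤ) * -1)) P a) (hPc : QRel (q ^ ((e : ℤ) * 1)) P c)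
    (hPb : ∀ k n, P k * b n = b n * P k) (hac : ∀ m l, a m * c l = c l * a m)
    (hab : QRel (q ^ ((e : ℤ) * -1)) a b) (hbc : QRel (q ^ ((e : ℤ) * 1)) b c) (k m l n : ℤ) :
    tri q (a m) (P k) (c l) * b n - b n * tri q (a m) (P k) (c l) +
      (P k * tri q (a m) (b n) (c l) - tri q (a m) (b n) (c l) * P k) = 0 := by
  rcases units_cases e with rfl | rfl
  · exact osc_corner_mid hq hP (by simpa using hPa) (by simpa using hPc) hPb hac
      (by simpa using hab) (by simpa using hbc) k m l n
  · have hPa' := QRel.reflect hq (by simpa using hPa : QRel q P a)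
    have hPc' := QRel.reflect (inv_ne_zero hq) (by simpa using hPc : QRel q⁻¹ P c)
    have hab' := QRel.reflect hq (by simpa using hab : QRel q a b)
    have hbc' := QRel.reflect (inv_ne_zero hq) (by simpa using hbc : QRel q⁻¹ b c)
    rw [inv_inv] at hPc' hbc'
    simpa using osc_corner_mid hq hP.reflect hPa' hPc' (fun k l => hPb _ _)
      (fun m l => hac _ _) hab' hbc' (-k) (-m) (-l) (-n)

/-- The current can sit in the slot of `X_{M-1}`, `X_M` or `X_{M+1}`, and each slot has its own
identity, applied to both one-sided parts. The factor `q⁻¹` undoes the normalization of `tri`. -/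
theorem corner_osc (hq : q ≠ 0) (hX : QuadSat q e X) {i : Node M N} {P : ℤ → A}
    (hP : IsPsi q e X i P) {a b c : Node M N} (m n k u : ℤ) (hM : 1 < M)
    (ha : (a : ℕ) = M - 1) (hb : (b : ℕ) = M) (hc : (c : ℕ) = M + 1) :
    (sbr (par M a + par M b + par M c) (par M b) 1
        (sbr (par M a + par M b) (par M c) q
          (sbr (par M a) (par M b) q⁻¹ (twFam X i P a m) (twFam X i P b n)) (twFam X i P c k))
        (twFam X i P b u) +
      sbr (par M a + par M b + par M c) (par M b) 1
        (sbr (par M a + par M b) (par M c) q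
          (sbr (par M a) (par M b) q⁻¹ (twFam X i P a m) (twFam X i P b u)) (twFam X i P c k))
        (twFam X i P b n)) 0 1 = 0 := by
  have hpa : par M a = 0 := if_neg (by omega)
  have hpb : par M b = 1 := if_pos hb
  have hpc : par M c = 0 := if_neg (by omega)
  have cab : cart M a b = -1 := by rw [ha, hb, cart_pred hM]
  have cba : cart M b a = -1 := by rw [cart_symm, cab]
  have cbc : cart M b c = 1 := by rw [hb, hc, cart_succ]
  have ccb : cart M c b = 1 := by rw [cart_symm, cbc]
  have cac : cart M a c = 0 := by rw [ha, hc, cart_pred_succ hM]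
  have cca : cart M c a = 0 := by rw [cart_symm, cac]
  have cbb : cart M b b = 0 := by rw [hb, cart_odd_self]
  have nab : a ≠ b := fun h => by rw [h] at ha; omega
  have nac : a ≠ c := fun h => by rw [h] at ha; omega
  have nbc : b ≠ c := fun h => by rw [h] at hb; omega
  have hbb : ∀ m n, X b m * X b n + X b n * X b m = 0 := fun m n => by
    have := hX.comm b b m n cbb
    rwa [hpb, sbr_odd, one_smul] at this
  have hac : ∀ m n, X a m * X c n = X c n * X a m := fun m n => by
    have := hX.comm a c m n cac
    rwa [hpa, sbr_even_left, one_smul, sub_eq_zero] at this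
  have hab : QRel (q ^ ((e : ℤ) * -1)) (X a) (X b) := cab ▸ hX.quad a b (by simp [cab])
  have hbc : QRel (q ^ ((e : ℤ) * 1)) (X b) (X c) := cbc ▸ hX.quad b c (by simp [cbc])
  have hcomm := fun j => hP.commute (j := j)
  obtain ⟨P₁, P₂, o₁, o₂, h₁, h₂, hP'⟩ := hP
  have comm_of : ∀ {Q : ℤ → A} {j : Node M N}, OneSided Q →
      QRel (q ^ ((e : ℤ) * cart M i j)) Q (X j) → cart M i j = 0 →
      ∀ k n, Q k * X j n = X j n * Q k := fun o h hz => by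
    rw [hz, mul_zero, zpow_zero] at h
    exact h.commute o
  rw [hpa, hpb, hpc, zero_add, add_zero]
  simp only [sbr_even_left, sbr_even_right, sbr_odd, one_smul]
  by_cases hia : a = i
  · subst hia
    have g₁ := osc_corner_left_sign hq o₁ (cab ▸ h₁ b) (comm_of o₁ (h₁ c) cac) hbc hbb m n u k
    have g₂ := osc_corner_left_sign hq o₂ (cab ▸ h₂ b) (comm_of o₂ (h₂ c) cac) hbc hbb m n u k
    simp only [twFam_self, twFam_ne nab.symm, twFam_ne nac.symm, up_mul, up_smul, up_sub,
      up_add, up_apply_corner, mul_zero, zero_mul, zero_add, add_zero, smul_zero, sub_zero, hP']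
    linear_combination (norm := (simp only [tri, mul_sub, sub_mul, mul_add, add_mul,
      smul_mul_assoc, mul_smul_comm, mul_assoc]; match_scalars <;> field_simp <;> ring))
      q⁻¹ • (g₁ + g₂)
  by_cases hib : b = i
  · subst hib
    have g₁ := osc_corner_mid_sign hq o₁ (cba ▸ h₁ a) (cbc ▸ h₁ c) (comm_of o₁ (h₁ b) cbb) hac
      hab hbc
    have g₂ := osc_corner_mid_sign hq o₂ (cba ▸ h₂ a) (cbc ▸ h₂ c) (comm_of o₂ (h₂ b) cbb) hac
      hab hbc
    have htw : tw M b b = -1 := by rw [hb, tw_odd]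
    simp only [twFam_self, twFam_ne nab, twFam_ne nbc.symm, htw, up_mul, up_smul, up_sub,
      up_add, up_apply_corner, mul_zero, zero_mul, zero_add, add_zero, smul_zero, sub_zero, hP']
    linear_combination (norm := (simp only [tri, mul_sub, sub_mul, mul_add, add_mul,
      smul_mul_assoc, mul_smul_comm, mul_assoc]; match_scalars <;> field_simp <;> ring))
      q⁻¹ • (g₁ n m k u + g₂ n m k u + g₁ u m k n + g₂ u m k n)
  by_cases hic : c = i
  · subst hic
    have g₁ := osc_corner_right_sign hq o₁ (ccb ▸ h₁ b) (comm_of o₁ (h₁ a) cca) hab hbb k n u m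
    have g₂ := osc_corner_right_sign hq o₂ (ccb ▸ h₂ b) (comm_of o₂ (h₂ a) cca) hab hbb k n u m
    simp only [twFam_self, twFam_ne nac, twFam_ne nbc, up_mul, up_smul, up_sub,
      up_add, up_apply_corner, mul_zero, zero_mul, zero_add, add_zero, smul_zero, sub_zero, hP']
    linear_combination (norm := (simp only [tri, mul_sub, sub_mul, mul_add, add_mul,
      smul_mul_assoc, mul_smul_comm, mul_assoc]; match_scalars <;> field_simp <;> ring))
      q⁻¹ • (g₁ + g₂)
  · simp [twFam_ne hia, twFam_ne hib, twFam_ne hic, up_mul, up_smul, up_sub, up_add,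
      up_apply_corner]

/-- The corners of all relations vanish. -/
theorem corner_eq (hq : q ≠ 0) (hX : QuadSat q e X) {i : Node M N} {P : ℤ → A}
    (hP : IsPsi q e X i P) {a b : Matrix (Fin 2) (Fin 2) A}
    (h : NilRel M N q e (twFam X i P) a b) : a 0 1 = b 0 1 := by
  cases h with
  | comm k l m n hc => exact corner_comm hP m n hc
  | quad k l m n hc => exact corner_quad hP m n hc
  | serre j l m n k hc hj => exact corner_serre hq hX hP m n k hc hj
  | osc a b c m n k u hM hN ha hb hc => exact corner_osc hq hX hP m n k u hM ha hb hc

/-- Rescaling odd generators by a sign rescales the relations. -/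
theorem ev_tw (i : ℕ) {ε : ZMod 2} {r : FreeAlgebra ℂ (Node M N × ℤ)}
    (hr : r ∈ freeGrade (fun g : Node M N × ℤ => par M g.1) ε) :
    ev (fun k n => tw M i k • X k n) r = (if par M i = 1 then sgn ε else 1) • ev X r := by
  by_cases hi : par M i = 1
  · rw [if_pos hi]
    have : ev (fun k n => tw M i k • X k n) =
        (ev X).comp (freeInv fun g : Node M N × ℤ => par M g.1) := by
      ext g
      simp only [Function.comp_apply, ev_ι, AlgHom.comp_apply, freeInv, FreeAlgebra.lift_ι_apply,
        map_smul]
      congr 1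
      simp [tw, sgn, hi]
    rw [this, AlgHom.comp_apply, freeInv_of_mem _ hr, map_smul]
  · rw [if_neg hi, one_smul]
    congr 1
    have : ∀ k : ℕ, tw M i k = 1 := fun k => if_neg fun h => hi h.1
    simp [this]

/-- The two sides of a relation have the same parity, so the sign twist multiplies both by one
common scalar. The twisted diagonal entry thus satisfies exactly the relations that the untwisted
one does. -/
theorem exists_ev_tw (i : ℕ) {a b : FreeAlgebra ℂ (Node M N × ℤ)} (h : PRel M N q e a b) :
    ∃ c : ℂ, c ≠ 0 ∧ ∀ X : Node M N → ℤ → A,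
      ev (fun k n => tw M i k • X k n) a = c • ev X a ∧
      ev (fun k n => tw M i k • X k n) b = c • ev X b := by
  obtain ⟨ε, ha, hb⟩ := nilRel_homogeneous (fun g : Node M N × ℤ => par M g.1)
    (fun i n => freeGrade_ι _ (i, n)) a b h
  refine ⟨if par M i = 1 then sgn ε else 1, ?_, fun X => ⟨ev_tw i ha, ev_tw i hb⟩⟩
  unfold sgn
  split_ifs <;> norm_num

theorem ev_twFam (i : Node M N) (P : ℤ → A) (r : FreeAlgebra ℂ (Node M N × ℤ)) :
    ev (twFam X i P) r =
      up (ev (fun k n => tw M i k • X k n) r) (ev (twFam X i P) r 0 1) (ev X r) :=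
  ev_up _ _ _ r

/-- The twisted derivation respects the relations. -/
theorem twFam_sat (hq : q ≠ 0) (hX : Sat q e X) {i : Node M N} {P : ℤ → A}
    (hP : IsPsi q e X i P) : Sat q e (twFam X i P) := by
  rw [sat_iff_ev]
  intro a b hab
  obtain ⟨c, -, hc⟩ := exists_ev_tw (A := A) i hab
  have h := sat_iff_ev.mp hX a b hab
  rw [ev_twFam, ev_twFam i P b, (hc X).1, (hc X).2, h,
    corner_eq hq hX.quadSat hP (PRel.nilRel_ev _ hab)]

/-- Elements that super-commute with the generators up to `P` super-commute with every relation
whose corner vanishes. -/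
theorem ev_mul_of_corner {i : Node M N} {P : ℤ → A} {y : A}
    (hy : ∀ (k : Node M N) (n : ℤ), (tw M i k • X k n) * y + (if k = i then P n else 0) = y * X k n)
    {a b : FreeAlgebra ℂ (Node M N × ℤ)} (hab : PRel M N q e a b)
    (hcor : ev (twFam X i P) a 0 1 = ev (twFam X i P) b 0 1) :
    ∃ c : ℂ, c ≠ 0 ∧ c • ((ev X a - ev X b) * y) = y * (ev X a - ev X b) := by
  -- A twisted Leibniz rule: moving `y` through a word produces the sign-twisted word and, as error
  -- term, the corner of the triangular evaluation.
  have key : ∀ r, ev (fun (k : Node M N) n => tw M i k • X k n) r * y + ev (twFam X i P) r 0 1 =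
      y * ev X r := by
    intro r
    induction r using FreeAlgebra.induction with
    | grade0 c => simp [algebraMap_eq_up, up_apply_corner, Algebra.commutes]
    | grade1 g => simpa [twFam, up_apply_corner] using hy g.1 g.2
    | mul a b ha hb =>
      rw [map_mul (ev (twFam X i P)), ev_twFam, ev_twFam i P b, up_mul, up_apply_corner, map_mul,
        map_mul, ← mul_assoc y, ← ha, add_mul, mul_assoc _ y, ← hb]
      noncomm_ring
    | add a b ha hb =>
      rw [map_add (ev (twFam X i P)), Matrix.add_apply, map_add, map_add, mul_add, ← ha, ← hb]
      noncomm_ring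
  obtain ⟨c, hc0, hc⟩ := exists_ev_tw (A := A) i hab
  refine ⟨c, hc0, ?_⟩
  have e1 := key a
  have e2 := key b
  rw [(hc X).1, smul_mul_assoc] at e1
  rw [(hc X).2, ← hcor, smul_mul_assoc] at e2
  rw [sub_mul, mul_sub, ← e1, ← e2, smul_sub]
  abel

end Corner

/-! ### Automorphisms and derivations of the nilpotent part -/

section Nilpotent

variable {M N : ℕ} {A B : Type} [Ring A] [Algebra ℂ A] [Ring B] [Algebra ℂ B] {q : ℂ} {e : ℤˣ}
  {X : Node M N → ℤ → A}

theorem Sat.map (hX : Sat q e X) (f : A →ₐ[ℂ] B) : Sat q e fun i n => f (X i n) := by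
  have : ev (fun i n => f (X i n)) = f.comp (ev X) := by
    ext g
    simp
  rw [sat_iff_ev] at hX ⊢
  intro a b hab
  rw [this, AlgHom.comp_apply, AlgHom.comp_apply, hX a b hab]

/-- The presented algebra `PNil`, with its ring structure as the only source of instances. -/
def Nil (M N : ℕ) (q : ℂ) (e : ℤˣ) : Type := PNil M N q e

instance : Ring (Nil M N q e) := inferInstanceAs (Ring (PNil M N q e))

instance : Algebra ℂ (Nil M N q e) := inferInstanceAs (Algebra ℂ (PNil M N q e))

/-- The identification of the two forms of the presented algebra. -/
def nilEquiv (M N : ℕ) (q : ℂ) (e : ℤˣ) : PNil M N q e ≃ₐ[ℂ] Nil M N q e := AlgEquiv.refl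

/-- The generator `X_{i,n}^e`. -/
def nX (M N : ℕ) (q : ℂ) (e : ℤˣ) (i : Node M N) (n : ℤ) : Nil M N q e :=
  nilEquiv M N q e (pX M N q e i n)

/-- The quotient map. -/
def nilMk (M N : ℕ) (q : ℂ) (e : ℤˣ) : FreeAlgebra ℂ (Node M N × ℤ) →ₐ[ℂ] Nil M N q e :=
  (nilEquiv M N q e).toAlgHom.comp (RingQuot.mkAlgHom ℂ (PRel M N q e))

theorem ev_nX (r : FreeAlgebra ℂ (Node M N × ℤ)) :
    ev (nX M N q e) r = nilMk M N q e r := by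
  have : ev (nX M N q e) = nilMk M N q e := by
    ext g
    simp [nX, pX, nilMk]
  rw [this]

theorem nX_sat : Sat q e (nX M N q e) := by
  rw [sat_iff_ev]
  intro a b hab
  rw [ev_nX, ev_nX]
  exact congrArg (nilEquiv M N q e) (RingQuot.mkAlgHom_rel ℂ hab)

/-- The homomorphism from the presented algebra defined by a family satisfying the relations. -/
def nLift (hX : Sat q e X) : Nil M N q e →ₐ[ℂ] A :=
  (RingQuot.liftAlgHom ℂ ⟨ev X, fun a b h => sat_iff_ev.mp hX a b h⟩ :
    PNil M N q e →ₐ[ℂ] A).comp (nilEquiv M N q e).symm.toAlgHom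

theorem nLift_ev (hX : Sat q e X) (r : FreeAlgebra ℂ (Node M N × ℤ)) :
    nLift hX (ev (nX M N q e) r) = ev X r := by
  rw [ev_nX]
  exact RingQuot.liftAlgHom_mkAlgHom_apply _ _ _ _

@[simp]
theorem nLift_nX (hX : Sat q e X) (i : Node M N) (n : ℤ) :
    nLift hX (nX M N q e i n) = X i n := by
  have := nLift_ev hX (FreeAlgebra.ι ℂ (i, n))
  simpa using this

theorem ev_nX_surjective : Function.Surjective (ev (nX M N q e)) := by
  intro x
  obtain ⟨r, rfl⟩ := RingQuot.mkAlgHom_surjective ℂ (PRel M N q e) x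
  exact ⟨r, ev_nX r⟩

/-- A subspace that contains `1` and is stable under left multiplication by generators is
everything. -/
theorem mem_of_left_stable {G : Type} {f : G → A}
    (hG : Algebra.adjoin ℂ (Set.range f) = ⊤) (p : Submodule ℂ A) (h1 : 1 ∈ p)
    (hX : ∀ g, ∀ y ∈ p, f g * y ∈ p) (x : A) : x ∈ p := by
  have hx : x ∈ Algebra.adjoin ℂ (Set.range f) := hG ▸ trivial
  suffices ∀ y ∈ p, x * y ∈ p by simpa using this 1 h1
  induction hx using Algebra.adjoin_induction with
  | mem x hx =>
    obtain ⟨g, rfl⟩ := hx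
    exact hX g
  | algebraMap r =>
    intro y hy
    rw [← Algebra.smul_def]
    exact p.smul_mem r hy
  | add a b _ _ ha hb => intro y hy; rw [add_mul]; exact p.add_mem (ha y hy) (hb y hy)
  | mul a b _ _ ha hb => intro y hy; rw [mul_assoc]; exact ha _ (hb y hy)

theorem adjoin_nX :
    Algebra.adjoin ℂ (Set.range fun g : Node M N × ℤ => nX M N q e g.1 g.2) = ⊤ := by
  have : (fun g : Node M N × ℤ => nX M N q e g.1 g.2) =
      ev (nX M N q e) ∘ FreeAlgebra.ι ℂ := by
    funext g
    simp
  rw [this, Set.range_comp, ← AlgHom.map_adjoin, FreeAlgebra.adjoin_range_ι, Algebra.map_top,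
    AlgHom.range_eq_top]
  exact ev_nX_surjective

theorem nil_mem (p : Submodule ℂ (Nil M N q e)) (h1 : 1 ∈ p)
    (hX : ∀ i n, ∀ y ∈ p, nX M N q e i n * y ∈ p) (x : Nil M N q e) : x ∈ p :=
  mem_of_left_stable adjoin_nX p h1 (fun g => hX g.1 g.2) x

theorem nil_hom_ext {f g : Nil M N q e →ₐ[ℂ] A}
    (h : ∀ i n, f (nX M N q e i n) = g (nX M N q e i n)) : f = g := by
  refine AlgHom.ext fun x => ?_
  refine nil_mem (LinearMap.eqLocus f.toLinearMap g.toLinearMap) (by simp) ?_ x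
  intro i n y hy
  rw [LinearMap.mem_eqLocus] at hy ⊢
  simp only [AlgHom.toLinearMap_apply, map_mul] at hy ⊢
  rw [h, hy]

/-! ### Scaling automorphisms and shift derivations -/

theorem sbr_smul (pa pb : ZMod 2) (u c d : ℂ) (a b : A) :
    sbr pa pb u (c • a) (d • b) = (c * d) • sbr pa pb u a b := by
  simp only [sbr, smul_mul_assoc, mul_smul_comm]
  module

theorem Sat.scale (hX : Sat q e X) (c : Node M N → ℂ) : Sat q e fun i n => c i • X i n := by
  intro a b h
  cases h with
  | comm i j m n hc => rw [sbr_smul, hX _ _ (.comm i j m n hc), smul_zero]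
  | quad i j m n hc =>
    simp only [smul_mul_assoc, mul_smul_comm]
    linear_combination (norm := module) (c i * c j) • hX _ _ (.quad i j m n hc)
  | serre i j m n k hc hi =>
    simp only [sbr_smul]
    rw [← smul_add, hX _ _ (.serre i j m n k hc hi), smul_zero]
  | osc a b d m n k u hM hN ha hb hd =>
    simp only [sbr_smul]
    rw [← smul_add, hX _ _ (.osc a b d m n k u hM hN ha hb hd), smul_zero]

/-- The family defining the derivation with `X_{i,n} ↦ c_i X_{i,n+s}`. -/
def derFam (X : Node M N → ℤ → A) (c : Node M N → ℂ) (s : ℤ) (i : Node M N) (n : ℤ) :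
    Matrix (Fin 2) (Fin 2) A :=
  up (X i n) (c i • X i (n + s)) (X i n)

-- The corner of a relation is a linear combination of the same relation with one mode shifted by
-- `s`, and each family of relations is closed under such shifts.
set_option linter.unusedSimpArgs false in
theorem derFam_corner (hX : Sat q e X) (c : Node M N → ℂ) (s : ℤ)
    {a b : Matrix (Fin 2) (Fin 2) A} (h : NilRel M N q e (derFam X c s) a b) : a 0 1 = b 0 1 := by
  cases h with
  | comm i j m n hc =>
    have h1 := hX _ _ (.comm i j (m + s) n hc)
    have h2 := hX _ _ (.comm i j m (n + s) hc)
    simp only [sbr, derFam, up_mul, up_smul, up_sub, up_add, up_apply_corner, Matrix.zero_apply]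
      at h1 h2 ⊢
    linear_combination (norm := (simp only [mul_sub, sub_mul, mul_add, add_mul, smul_mul_assoc,
      mul_smul_comm, mul_assoc]; module)) c i • h1 + c j • h2
  | quad i j m n hc =>
    have h1 := hX _ _ (.quad i j (m + s) n hc)
    have h2 := hX _ _ (.quad i j m (n + s) hc)
    rw [add_right_comm m] at h1
    rw [add_right_comm n] at h2
    simp only [derFam, up_mul, up_smul, up_sub, up_add, up_apply_corner]
    linear_combination (norm := (simp only [mul_sub, sub_mul, mul_add, add_mul, smul_mul_assoc,
      mul_smul_comm, mul_assoc]; module)) c i • h1 + c j • h2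
  | serre i j m n k hc hi =>
    have h1 := hX _ _ (.serre i j (m + s) n k hc hi)
    have h2 := hX _ _ (.serre i j m (n + s) k hc hi)
    have h3 := hX _ _ (.serre i j m n (k + s) hc hi)
    simp only [sbr, derFam, up_mul, up_smul, up_sub, up_add, up_apply_corner, Matrix.zero_apply]
      at h1 h2 h3 ⊢
    linear_combination (norm := (simp only [mul_sub, sub_mul, mul_add, add_mul, smul_mul_assoc,
      mul_smul_comm, mul_assoc]; module)) c i • h1 + c i • h2 + c j • h3
  | osc a b d m n k u hM hN ha hb hd =>
    have h1 := hX _ _ (.osc a b d (m + s) n k u hM hN ha hb hd)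
    have h2 := hX _ _ (.osc a b d m (n + s) k u hM hN ha hb hd)
    have h3 := hX _ _ (.osc a b d m n (k + s) u hM hN ha hb hd)
    have h4 := hX _ _ (.osc a b d m n k (u + s) hM hN ha hb hd)
    simp only [sbr, derFam, up_mul, up_smul, up_sub, up_add, up_apply_corner, Matrix.zero_apply]
      at h1 h2 h3 h4 ⊢
    linear_combination (norm := (simp only [mul_sub, sub_mul, mul_add, add_mul, smul_mul_assoc,
      mul_smul_comm, mul_assoc]; module)) c a • h1 + c b • h2 + c d • h3 + c b • h4

theorem derFam_sat (hX : Sat q e X) (c : Node M N → ℂ) (s : ℤ) : Sat q e (derFam X c s) := by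
  rw [sat_iff_ev]
  intro a b hab
  have h := sat_iff_ev.mp hX a b hab
  have hc := derFam_corner hX c s (PRel.nilRel_ev _ hab)
  unfold derFam at hc ⊢
  rw [ev_up, ev_up _ _ _ b, h, hc]

/-- The automorphism of the nilpotent part with `X_{j,n} ↦ c_j X_{j,n}`. -/
def nScale (M N : ℕ) (q : ℂ) (e : ℤˣ) (c : Node M N → ℂ) : Nil M N q e →ₐ[ℂ] Nil M N q e :=
  nLift (nX_sat.scale c)

@[simp]
theorem nScale_nX (c : Node M N → ℂ) (i : Node M N) (n : ℤ) :
    nScale M N q e c (nX M N q e i n) = c i • nX M N q e i n := nLift_nX _ _ _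

theorem nScale_comp (c d : Node M N → ℂ) (x : Nil M N q e) :
    nScale M N q e c (nScale M N q e d x) = nScale M N q e (fun i => c i * d i) x := by
  have : (nScale M N q e c).comp (nScale M N q e d) = nScale M N q e (fun i => c i * d i) := by
    refine nil_hom_ext fun i n => ?_
    simp [smul_smul, mul_comm]
  exact DFunLike.congr_fun this x

theorem nScale_one (x : Nil M N q e) : nScale M N q e (fun _ => 1) x = x := by
  have : nScale M N q e (fun _ => 1) = AlgHom.id ℂ _ := by
    refine nil_hom_ext fun i n => ?_
    simp
  exact DFunLike.congr_fun this x

/-- The derivation of the nilpotent part with `X_{j,n} ↦ c_j X_{j,n+s}`. -/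
def nDer (M N : ℕ) (q : ℂ) (e : ℤˣ) (c : Node M N → ℂ) (s : ℤ) :
    Nil M N q e →ₗ[ℂ] Nil M N q e :=
  (Matrix.entryLinearMap ℂ (Nil M N q e) 0 1).comp (nLift (derFam_sat nX_sat c s)).toLinearMap

theorem nDer_apply (c : Node M N → ℂ) (s : ℤ) (x : Nil M N q e) :
    nDer M N q e c s x = nLift (derFam_sat nX_sat c s) x 0 1 := rfl

@[simp]
theorem nDer_one (c : Node M N → ℂ) (s : ℤ) : nDer M N q e c s 1 = 0 := by
  rw [nDer_apply, map_one]
  rfl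

theorem nDer_mul (c : Node M N → ℂ) (s : ℤ) (x y : Nil M N q e) :
    nDer M N q e c s (x * y) = x * nDer M N q e c s y + nDer M N q e c s x * y := by
  have h : ∀ x, nLift (derFam_sat (nX_sat (M := M) (N := N) (q := q) (e := e)) c s) x =
      up x (nDer M N q e c s x) x := by
    intro x
    obtain ⟨r, rfl⟩ := ev_nX_surjective x
    rw [nDer_apply, nLift_ev]
    exact ev_up _ _ _ r
  rw [nDer_apply, map_mul, h, h, up_mul, up_apply_corner]

@[simp]
theorem nDer_nX (c : Node M N → ℂ) (s : ℤ) (i : Node M N) (n : ℤ) :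
    nDer M N q e c s (nX M N q e i n) = c i • nX M N q e i (n + s) := by
  rw [nDer_apply, nLift_nX, derFam, up_apply_corner]

theorem nDer_comm (c d : Node M N → ℂ) (s t : ℤ) (x : Nil M N q e) :
    nDer M N q e c s (nDer M N q e d t x) = nDer M N q e d t (nDer M N q e c s x) := by
  refine nil_mem (LinearMap.eqLocus (nDer M N q e c s ∘ₗ nDer M N q e d t)
    (nDer M N q e d t ∘ₗ nDer M N q e c s)) (by simp [LinearMap.mem_eqLocus]) ?_ x
  intro i n y hy
  rw [LinearMap.mem_eqLocus, LinearMap.comp_apply, LinearMap.comp_apply] at hy ⊢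
  simp only [nDer_mul, map_add, nDer_nX, map_smul, hy, smul_mul_assoc, add_right_comm n s t]
  module

theorem nScale_nDer (c d : Node M N → ℂ) (s : ℤ) (x : Nil M N q e) :
    nScale M N q e c (nDer M N q e d s x) = nDer M N q e d s (nScale M N q e c x) := by
  refine nil_mem (LinearMap.eqLocus ((nScale M N q e c).toLinearMap ∘ₗ nDer M N q e d s)
    (nDer M N q e d s ∘ₗ (nScale M N q e c).toLinearMap)) (by simp [LinearMap.mem_eqLocus]) ?_ x
  intro i n y hy
  rw [LinearMap.mem_eqLocus, LinearMap.comp_apply, LinearMap.comp_apply] at hy ⊢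
  simp only [AlgHom.toLinearMap_apply] at hy ⊢
  simp only [nDer_mul, map_add, map_mul, nDer_nX, map_smul, hy, smul_mul_assoc, nScale_nX]
  module

/-- The augmentation of the nilpotent part. -/
def nAug (M N : ℕ) (q : ℂ) (e : ℤˣ) : Nil M N q e →ₐ[ℂ] ℂ :=
  nLift (X := fun _ _ => (0 : ℂ)) fun a b h => by cases h <;> simp [sbr]

end Nilpotent

/-! ### Induced modules -/

section Induced

variable {M N : ℕ} (q : ℂ) (e : ℤˣ) {W : Type} [AddCommGroup W] [Module ℂ W]
  (K : ℤˣ → Node M N → Module.End ℂ W) (h : Node M N → {s : ℤ // s ≠ 0} → Module.End ℂ W)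

/-- The scalar by which `K_i^{e'}` acts on `X_j^e`. -/
def kCoef (M : ℕ) (q : ℂ) (e e' : ℤˣ) (i j : ℕ) : ℂ := q ^ ((e' : ℤ) * ((e : ℤ) * cart M i j))

/-- The scalar in the commutator of `h_{i,s}` and `X_j^e`. -/
def hCoef (M : ℕ) (q : ℂ) (e : ℤˣ) (i : ℕ) (s : ℤ) (j : ℕ) : ℂ :=
  (e : ℤ) * (qInt (qi M q i) (s * lsgn M i * cart M i j) / s)

/-- The underlying space of the induced module. -/
def Ind (M N : ℕ) (q : ℂ) (e : ℤˣ) (W : Type) [AddCommGroup W] [Module ℂ W] : Type :=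
  Nil M N q e ⊗[ℂ] W

instance : AddCommGroup (Ind M N q e W) := inferInstanceAs (AddCommGroup (Nil M N q e ⊗[ℂ] W))

instance : Module ℂ (Ind M N q e W) := inferInstanceAs (Module ℂ (Nil M N q e ⊗[ℂ] W))

/-- The identification of the induced module with a tensor product. -/
def indEquiv (M N : ℕ) (q : ℂ) (e : ℤˣ) (W : Type) [AddCommGroup W] [Module ℂ W] :
    (Nil M N q e ⊗[ℂ] W) ≃ₗ[ℂ] Ind M N q e W := LinearEquiv.refl ℂ _

/-- Pure tensors in the induced module. -/
def itm (M N : ℕ) (q : ℂ) (e : ℤˣ) (W : Type) [AddCommGroup W] [Module ℂ W] :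
    Nil M N q e →ₗ[ℂ] W →ₗ[ℂ] Ind M N q e W :=
  (TensorProduct.mk ℂ (Nil M N q e) W).compr₂ (indEquiv M N q e W).toLinearMap

/-- Linear maps from the induced module. -/
def indLift {V : Type} [AddCommGroup V] [Module ℂ V] (f : Nil M N q e →ₗ[ℂ] W →ₗ[ℂ] V) :
    Ind M N q e W →ₗ[ℂ] V :=
  TensorProduct.lift f ∘ₗ (indEquiv M N q e W).symm.toLinearMap

@[simp]
theorem indLift_itm {V : Type} [AddCommGroup V] [Module ℂ V] (f : Nil M N q e →ₗ[ℂ] W →ₗ[ℂ] V)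
    (x : Nil M N q e) (w : W) : indLift q e f (itm M N q e W x w) = f x w := rfl

theorem ind_induction {p : Ind M N q e W → Prop} (h0 : p 0) (ht : ∀ x w, p (itm M N q e W x w))
    (ha : ∀ x y, p x → p y → p (x + y)) (v : Ind M N q e W) : p v :=
  TensorProduct.induction_on (motive := fun v => p (indEquiv M N q e W v))
    ((indEquiv M N q e W).symm v) h0 ht ha

theorem ind_ext {V : Type} [AddCommGroup V] [Module ℂ V] {f g : Ind M N q e W →ₗ[ℂ] V}
    (hfg : ∀ x w, f (itm M N q e W x w) = g (itm M N q e W x w)) : f = g := by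
  refine LinearMap.ext fun v => ?_
  induction v using ind_induction with
  | h0 => rw [map_zero, map_zero]
  | ht x w => exact hfg x w
  | ha x y hx hy => rw [map_add, map_add, hx, hy]

/-- The action of the nilpotent part on the induced module. -/
def indMul (M N : ℕ) (q : ℂ) (e : ℤˣ) (W : Type) [AddCommGroup W] [Module ℂ W] :
    Nil M N q e →ₐ[ℂ] Module.End ℂ (Ind M N q e W) :=
  AlgHom.ofLinearMap
    { toFun := fun y => indLift q e ((itm M N q e W).comp (LinearMap.mulLeft ℂ y))
      map_add' := fun y z => ind_ext q e fun x w => by simp [add_mul]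
      map_smul' := fun c y => ind_ext q e fun x w => by simp }
    (ind_ext q e fun x w => by simp) fun y z => ind_ext q e fun x w => by simp

/-- `X_{j,n}^e` acting on the induced module. -/
def indX (W : Type) [AddCommGroup W] [Module ℂ W] (j : Node M N) (n : ℤ) :
    Module.End ℂ (Ind M N q e W) := indMul M N q e W (nX M N q e j n)

/-- `K_i^d` acting on the induced module. -/
def indK (d : ℤˣ) (i : Node M N) : Module.End ℂ (Ind M N q e W) :=
  indLift q e ((itm M N q e W).compl₁₂
    (nScale M N q e fun j => kCoef M q e d i j).toLinearMap (K d i))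

/-- `h_{i,s}` acting on the induced module. -/
def indh (i : Node M N) (s : {s : ℤ // s ≠ 0}) : Module.End ℂ (Ind M N q e W) :=
  indLift q e ((itm M N q e W).comp (nDer M N q e (fun j => hCoef M q e i s j) s) +
    (itm M N q e W).compl₂ (h i s))

@[simp]
theorem indMul_tmul (y x : Nil M N q e) (w : W) :
    indMul M N q e W y (itm M N q e W x w) = itm M N q e W (y * x) w := rfl

@[simp]
theorem indX_tmul (j : Node M N) (n : ℤ) (x : Nil M N q e) (w : W) :
    indX q e W j n (itm M N q e W x w) = itm M N q e W (nX M N q e j n * x) w := rfl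

@[simp]
theorem indK_tmul (e' : ℤˣ) (i : Node M N) (x : Nil M N q e) (w : W) :
    indK q e K e' i (itm M N q e W x w) =
      itm M N q e W (nScale M N q e (fun j => kCoef M q e e' i j) x) (K e' i w) := rfl

@[simp]
theorem indh_tmul (i : Node M N) (s : {s : ℤ // s ≠ 0}) (x : Nil M N q e) (w : W) :
    indh q e h i s (itm M N q e W x w) =
      itm M N q e W (nDer M N q e (fun j => hCoef M q e i s j) s x) w +
        itm M N q e W x (h i s w) := rfl

theorem indX_sat : Sat q e (indX (M := M) (N := N) q e W) :=
  nX_sat.map (indMul M N q e W)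

variable {q e K h}

/-- Scalings commute with one another and with the shift derivations, and those commute among
themselves; on the other tensor factor the relations hold by assumption. -/
theorem ind_isCartan (hq : q ≠ 0) (C : IsCartan K h) : IsCartan (indK q e K) (indh q e h) where
  K_inv e' i := by
    refine ind_ext q e fun x w => ?_
    have hK : K e' i (K (-e') i w) = w := LinearMap.congr_fun (C.K_inv e' i) w
    have hs : (fun j : Node M N => kCoef M q e e' i j * kCoef M q e (-e') i j) = fun _ => 1 := by
      funext j
      rw [kCoef, kCoef, Units.val_neg, neg_mul, zpow_neg, mul_inv_cancel₀ (zpow_ne_zero _ hq)]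
    simp only [Module.End.mul_apply, indK_tmul, hK, nScale_comp, hs, nScale_one,
      Module.End.one_apply]
  K_K i j := by
    refine ind_ext q e fun x w => ?_
    have hK : K 1 i (K 1 j w) = K 1 j (K 1 i w) := LinearMap.congr_fun (C.K_K i j) w
    simp only [Module.End.mul_apply, indK_tmul, hK, nScale_comp, mul_comm]
  K_h i j s := by
    refine ind_ext q e fun x w => ?_
    have hK : K 1 i (h j s w) = h j s (K 1 i w) := LinearMap.congr_fun (C.K_h i j s) w
    simp only [Module.End.mul_apply, indK_tmul, indh_tmul, map_add, hK, nScale_nDer]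
  h_h i j s t := by
    refine ind_ext q e fun x w => ?_
    have hK : h i s (h j t w) = h j t (h i s w) := LinearMap.congr_fun (C.h_h i j s t) w
    simp only [Module.End.mul_apply, indh_tmul, map_add, hK]
    rw [nDer_comm]
    abel

theorem ind_isWeight (hq : q ≠ 0) (C : IsCartan K h) :
    IsWeight q e (indK q e K) (indh q e h) (indX q e W) where
  K_X i j n := by
    refine ind_ext q e fun x w => ?_
    have h1 := LinearMap.congr_fun ((ind_isCartan (e := e) hq C).K_inv 1 i) (itm M N q e W x w)
    simp only [Module.End.mul_apply, indK_tmul, indX_tmul, map_mul, nScale_nX, smul_mul_assoc,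
      LinearMap.smul_apply, Module.End.one_apply, kCoef, Units.val_one, one_mul] at h1 ⊢
    rw [map_smul, LinearMap.smul_apply, ← indX_tmul, h1, indX_tmul]
  h_X i j s n := by
    refine ind_ext q e fun x w => ?_
    simp only [LinearMap.sub_apply, Module.End.mul_apply, indh_tmul, indX_tmul, map_add, nDer_mul,
      nDer_nX, smul_mul_assoc, LinearMap.smul_apply, LinearMap.add_apply, map_smul]
    rw [hCoef]
    abel

/-- A subspace of the induced module that contains `1 ⊗ W` and is stable under the generators is
everything. -/
theorem ind_mem (p : Submodule ℂ (Ind M N q e W)) (h1 : ∀ w, itm M N q e W 1 w ∈ p)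
    (hX : ∀ i n, ∀ y ∈ p, indX q e W i n y ∈ p) (v : Ind M N q e W) : v ∈ p := by
  induction v using ind_induction with
  | h0 => exact p.zero_mem
  | ha x y hx hy => exact p.add_mem hx hy
  | ht x w =>
    exact nil_mem (p.comap ((itm M N q e W).flip w)) (h1 w) (fun i n y hy => hX i n _ hy) x

end Induced

/-! ### The elements `[X_{i,m}^+, X_{i,n}^-]` -/

section Psi

variable {M N : ℕ} {A B : Type} [Ring A] [Algebra ℂ A] [Ring B] [Algebra ℂ B]
  {K : ℤˣ → Node M N → A} {h : Node M N → {s : ℤ // s ≠ 0} → A} {X : Node M N → ℤ → A}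
  {q : ℂ} {e : ℤˣ}

/-- `(φ_{i,n}^+ - φ_{i,n}^-) / (q_i - q_i⁻¹)` in any algebra. -/
def psiOf (q : ℂ) (K : ℤˣ → Node M N → A) (h : Node M N → {s : ℤ // s ≠ 0} → A) (i : Node M N)
    (n : ℤ) : A :=
  (qi M q i - (qi M q i)⁻¹)⁻¹ •
    (phiOf M q 1 i (K 1 i) (h i) n - phiOf M q (-1) i (K (-1) i) (h i) n)

theorem map_psiOf (f : A →ₐ[ℂ] B) (q : ℂ) (i : Node M N) (n : ℤ) :
    f (psiOf q K h i n) = psiOf q (fun e i => f (K e i)) (fun i s => f (h i s)) i n := by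
  simp only [psiOf, map_smul, map_sub, map_phiOf]

theorem IsCartan.lift_psiOf (C : IsCartan K h) (q : ℂ) (i : Node M N) (n : ℤ) :
    C.lift (psiOf q (lK M N) (lh M N) i n) = psiOf q K h i n := by
  rw [map_psiOf]
  simp only [C.lift_lK, C.lift_lh]

/-- `ψ` is the image of an element of the commutative Laurent algebra, where the commutation is
automatic. -/
theorem IsCartan.K_psi (C : IsCartan K h) (e : ℤˣ) (i j : Node M N) (n : ℤ) :
    K e i * psiOf q K h j n = psiOf q K h j n * K e i := by
  rw [← C.lift_psiOf, ← C.lift_lK, ← map_mul, mul_comm, map_mul]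

theorem IsCartan.h_psi (C : IsCartan K h) (i j : Node M N) (s : {s : ℤ // s ≠ 0}) (n : ℤ) :
    h i s * psiOf q K h j n = psiOf q K h j n * h i s := by
  rw [← C.lift_psiOf, ← C.lift_lh, ← map_mul, mul_comm, map_mul]

/-- The scalar `c` and the shift `p` are free because the lemma serves both directions: commutators
of `X^+` with words in `X^-` and, with a sign, of `X^-` with words in `X^+`. -/
theorem IsWeight.isPsi (hq : q ≠ 0) (hq' : ∀ n : ℕ, 0 < n → q ^ n ≠ 1) (C : IsCartan K h)
    (hW : IsWeight q e K h X) (i : Node M N) (c : ℂ) (p : ℤ) :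
    IsPsi q e X i fun n => c • psiOf q K h i (n + p) := by
  set d := (qi M q i - (qi M q i)⁻¹)⁻¹ with hd
  refine ⟨fun n => (c * d) • phiOf M q 1 i (K 1 i) (h i) (n + p),
    fun n => (-(c * d)) • phiOf M q (-1) i (K (-1) i) (h i) (n + p),
    ((phiOf_oneSided _ _ _ _ _).shift p).of_imp fun k hk => by rw [hk, smul_zero],
    ((phiOf_oneSided _ _ _ _ _).shift p).of_imp fun k hk => by rw [hk, smul_zero],
    fun j => ((hW.phi_exchange C hq hq' 1 i j).shift p).smul _,
    fun j => ((hW.phi_exchange C hq hq' (-1) i j).shift p).smul _, fun n => ?_⟩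
  simp only [psiOf, ← hd]
  module

end Psi

/-! ### The action of the other half on an induced module -/

section Extension

variable {M N : ℕ} {q : ℂ} {W : Type} [AddCommGroup W] [Module ℂ W]
  {K : ℤˣ → Node M N → Module.End ℂ W} {h : Node M N → {s : ℤ // s ≠ 0} → Module.End ℂ W}

/-- The elements `ψ_{i,n}` acting on the induced module. -/
def indPsi (q : ℂ) (K : ℤˣ → Node M N → Module.End ℂ W)
    (h : Node M N → {s : ℤ // s ≠ 0} → Module.End ℂ W) (i : Node M N) (n : ℤ) :
    Module.End ℂ (Ind M N q (-1) W) :=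
  psiOf q (indK q (-1) K) (indh q (-1) h) i n

theorem indFam_sat (hq : q ≠ 0) (hq' : ∀ n : ℕ, 0 < n → q ^ n ≠ 1) (C : IsCartan K h)
    (i : Node M N) (m : ℤ) :
    Sat q (-1) (twFam (indX q (-1) W) i fun n => (1 : ℂ) • indPsi q K h i (n + m)) :=
  twFam_sat hq (indX_sat q (-1)) ((ind_isWeight hq C).isPsi hq hq' (ind_isCartan hq C) i 1 m)

/-- The twisted derivation `[X_{i,m}^+, ·]`, with values in operators on the induced module. -/
def indRho (hq : q ≠ 0) (hq' : ∀ n : ℕ, 0 < n → q ^ n ≠ 1) (C : IsCartan K h) (i : Node M N)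
    (m : ℤ) : Nil M N q (-1) →ₐ[ℂ] Matrix (Fin 2) (Fin 2) (Module.End ℂ (Ind M N q (-1) W)) :=
  nLift (indFam_sat hq hq' C i m)

theorem ev_indX {e : ℤˣ} (r : FreeAlgebra ℂ (Node M N × ℤ)) (w : W) :
    ev (indX q e W) r (itm M N q e W 1 w) = itm M N q e W (ev (nX M N q e) r) w := by
  have : ∀ y : Nil M N q e, ev (indX q e W) r (itm M N q e W y w) =
      itm M N q e W (ev (nX M N q e) r * y) w := by
    induction r using FreeAlgebra.induction with
    | grade0 c =>
      intro y
      simp [← Algebra.smul_def]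
    | grade1 g => intro y; simp
    | mul a b ha hb =>
      intro y
      rw [map_mul, Module.End.mul_apply, hb, ha, map_mul (ev (nX M N q e)), mul_assoc]
    | add a b ha hb =>
      intro y; rw [map_add, LinearMap.add_apply, hb, ha, map_add, add_mul, map_add,
        LinearMap.add_apply]
  simpa using this 1

variable (hq : q ≠ 0) (hq' : ∀ n : ℕ, 0 < n → q ^ n ≠ 1) (C : IsCartan K h)

/-- The lower row records that the other diagonal entry is plain multiplication by `x`, so products
in the matrix algebra encode the Leibniz rule for `X_{i,m}^+`. -/
theorem indRho_lower (i : Node M N) (m : ℤ) (x : Nil M N q (-1)) :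
    indRho hq hq' C i m x 1 0 = 0 ∧
      ∀ w, indRho hq hq' C i m x 1 1 (itm M N q (-1) W 1 w) = itm M N q (-1) W x w := by
  obtain ⟨r, rfl⟩ := ev_nX_surjective x
  rw [indRho, nLift_ev, ev_twFam]
  exact ⟨rfl, fun w => ev_indX r w⟩

/-- `X_{i,m}^+` acting on the module induced from a module `W` on which it acts by `Z i m`. -/
def indE (Z : Node M N → ℤ → Module.End ℂ W) (i : Node M N) (m : ℤ) :
    Module.End ℂ (Ind M N q (-1) W) :=
  indLift q (-1) <| LinearMap.mk₂ ℂ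
    -- The first term is `±x ⊗ X_{i,m}^+ w`, the second the supercommutator of `X_{i,m}^+` and `x`
    -- applied to `1 ⊗ w`. The commutator is an operator on the whole module because `ψ` acts there
    -- through the Cartan part.
    (fun x w => indRho hq hq' C i m x 0 0 (itm M N q (-1) W 1 (Z i m w)) +
      indRho hq hq' C i m x 0 1 (itm M N q (-1) W 1 w))
    (fun x y w => by
      simp only [map_add, Matrix.add_apply, LinearMap.add_apply]
      abel)
    (fun c x w => by simp only [map_smul, Matrix.smul_apply, LinearMap.smul_apply, smul_add])
    (fun x v w => by
      simp only [map_add]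
      abel)
    (fun c x w => by simp only [map_smul, smul_add])

variable {Z : Node M N → ℤ → Module.End ℂ W}

theorem indE_tmul (i : Node M N) (m : ℤ) (x : Nil M N q (-1)) (w : W) :
    indE hq hq' C Z i m (itm M N q (-1) W x w) =
      indRho hq hq' C i m x 0 0 (itm M N q (-1) W 1 (Z i m w)) +
        indRho hq hq' C i m x 0 1 (itm M N q (-1) W 1 w) := rfl

@[simp]
theorem indE_one_tmul (i : Node M N) (m : ℤ) (w : W) :
    indE hq hq' C Z i m (itm M N q (-1) W 1 w) = itm M N q (-1) W 1 (Z i m w) := by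
  rw [indE_tmul, map_one]
  simp

/-- The cross relation between `X^+` and `X^-`: it is the first row of the matrix product
`ρ(X_{j,n}) ρ(x)`. -/
theorem indE_mul_indX (i j : Node M N) (m n : ℤ) :
    indE hq hq' C Z i m * indX q (-1) W j n =
      tw M i j • (indX q (-1) W j n * indE hq hq' C Z i m) +
        if j = i then indPsi q K h i (n + m) else 0 := by
  refine ind_ext q _ fun x w => ?_
  obtain ⟨h0, h1⟩ := indRho_lower hq hq' C i m x
  rw [Module.End.mul_apply, indX_tmul, indE_tmul, map_mul, Matrix.mul_apply, Matrix.mul_apply,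
    Fin.sum_univ_two, Fin.sum_univ_two, h0, mul_zero, add_zero, LinearMap.add_apply,
    Module.End.mul_apply, Module.End.mul_apply, Module.End.mul_apply, h1]
  have hg : indRho hq hq' C i m (nX M N q (-1) j n) =
      twFam (indX q (-1) W) i (fun n => (1 : ℂ) • indPsi q K h i (n + m)) j n := nLift_nX _ _ _
  have h00 : indRho hq hq' C i m (nX M N q (-1) j n) 0 0 = tw M i j • indX q (-1) W j n := by
    rw [hg]; rfl
  have h01 : indRho hq hq' C i m (nX M N q (-1) j n) 0 1 =
      if j = i then indPsi q K h i (n + m) else 0 := by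
    rw [hg]
    simp [twFam, up]
  rw [h00, h01, LinearMap.add_apply, LinearMap.smul_apply, LinearMap.smul_apply,
    LinearMap.smul_apply, Module.End.mul_apply, indE_tmul, map_add, smul_add, add_assoc]

/-- An operator that commutes up to scalars with the generators is determined by its values on
`1 ⊗ W`. -/
theorem ind_op_eq_zero {e : ℤˣ} {T : Module.End ℂ (Ind M N q e W)}
    (h1 : ∀ w, T (itm M N q e W 1 w) = 0)
    (hX : ∀ i n, ∃ c : ℂ, T * indX q e W i n = c • (indX q e W i n * T)) : T = 0 := by
  refine LinearMap.ext fun v => ?_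
  refine ind_mem (LinearMap.ker T) h1 ?_ v
  intro i n y hy
  obtain ⟨c, hc⟩ := hX i n
  have := LinearMap.congr_fun hc y
  rw [LinearMap.mem_ker] at hy ⊢
  rw [Module.End.mul_apply, LinearMap.smul_apply, Module.End.mul_apply, hy, map_zero,
    smul_zero] at this
  exact this

theorem qInt_cast_neg (i j : ℕ) (s : ℤ) : hCoef M q (-1) i s j = -hCoef M q 1 i s j := by
  simp [hCoef]

/-- The defect of each relation vanishes on `1 ⊗ W` by hypothesis and passes through every
`X_{k,l}^-` up to a scalar, since the contributions of `ψ` cancel. Hence it is zero. -/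
theorem indE_isWeight (hZ : IsWeight q 1 K h Z) :
    IsWeight q 1 (indK q (-1) K) (indh q (-1) h) (indE hq hq' C Z) where
  K_X i j n := by
    have C' := ind_isCartan (e := -1) hq C
    have hW := ind_isWeight (e := -1) hq C
    have hK : indK q (-1) K 1 i * indE hq hq' C Z j n -
        q ^ (((1 : ℤˣ) : ℤ) * cart M i j) • (indE hq hq' C Z j n * indK q (-1) K 1 i) = 0 := by
      refine ind_op_eq_zero (fun w => ?_) fun k l =>
        ⟨kCoef M q (-1) 1 i k * tw M j k, ?_⟩
      · have := LinearMap.congr_fun (hZ.K_mul C hq 1 i j n) w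
        simp only [Module.End.mul_apply, LinearMap.smul_apply, Units.val_one, one_mul] at this
        simp only [LinearMap.sub_apply, LinearMap.smul_apply, Module.End.mul_apply, indK_tmul,
          indE_one_tmul, map_one, this, map_smul, Units.val_one, one_mul, sub_self]
      · have e1 := indE_mul_indX hq hq' C (Z := Z) j k n l
        have e2 := hW.K_mul C' hq 1 i k l
        rw [← kCoef] at e2
        have hψ := C'.K_psi (q := q) 1 i j (l + n)
        change _ * indPsi q K h j (l + n) = indPsi q K h j (l + n) * _ at hψ
        rw [sub_mul, mul_assoc, e1, smul_mul_assoc, mul_assoc, e2, mul_smul_comm, ← mul_assoc, e1,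
          mul_add, mul_smul_comm, ← mul_assoc, e2, add_mul, mul_sub]
        simp only [smul_mul_assoc, mul_smul_comm, mul_assoc]
        by_cases hkj : k = j
        · subst hkj
          -- The weights of `X_k^+` and `X_k^-` are inverse, which agrees with `K_i` commuting with
          -- `ψ_k`.
          have hcan : q ^ (((1 : ℤˣ) : ℤ) * cart M i k) * kCoef M q (-1) 1 i k = 1 := by
            rw [kCoef, ← zpow_add₀ hq]
            simp
          rw [if_pos rfl, hψ]
          have hz : indPsi q K h k (l + n) * indK q (-1) K 1 i =
              (q ^ (((1 : ℤˣ) : ℤ) * cart M i k) * kCoef M q (-1) 1 i k) •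
                (indPsi q K h k (l + n) * indK q (-1) K 1 i) := by rw [hcan, one_smul]
          linear_combination (norm := module) hz
        · rw [if_neg hkj, mul_zero, zero_mul]
          module
    rw [sub_eq_zero] at hK
    rw [hK, smul_mul_assoc, mul_assoc, C'.K_inv, mul_one]
  h_X i j s n := by
    have C' := ind_isCartan (e := -1) hq C
    have hW := ind_isWeight (e := -1) hq C
    change _ = hCoef M q 1 i s j • _
    rw [← sub_eq_zero]
    refine ind_op_eq_zero (fun w => ?_) fun k l => ⟨tw M j k, ?_⟩
    · have := LinearMap.congr_fun (hZ.h_X i j s n) w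
      change _ = (hCoef M q 1 i s j • Z j (n + s)) w at this
      simp only [LinearMap.sub_apply, LinearMap.smul_apply, Module.End.mul_apply] at this
      simp only [LinearMap.sub_apply, LinearMap.smul_apply, Module.End.mul_apply, indh_tmul,
        indE_one_tmul, nDer_one, map_zero, LinearMap.zero_apply, zero_add, ← map_sub, this,
        map_smul, sub_self]
    · have e1 := indE_mul_indX hq hq' C (Z := Z) j k n l
      have e1' := indE_mul_indX hq hq' C (Z := Z) j k n (l + s)
      have e1'' := indE_mul_indX hq hq' C (Z := Z) j k (n + s) l
      have e2 := hW.h_X i k s l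
      change _ = hCoef M q (-1) i s k • _ at e2
      -- The commutators of `h_{i,s}` with `X_k^+` and `X_k^-` have opposite coefficients, and both
      -- produce the same mode of `ψ_k`; they cancel.
      rw [qInt_cast_neg, sub_eq_iff_eq_add] at e2
      have hψ := C'.h_psi (q := q) i j s (l + n)
      change _ * indPsi q K h j (l + n) = indPsi q K h j (l + n) * _ at hψ
      rw [show l + s + n = l + (n + s) by ring] at e1'
      rw [sub_mul, sub_mul, mul_assoc, e1, mul_assoc, e2, smul_mul_assoc, e1'', mul_add, mul_add,
        mul_smul_comm, mul_smul_comm, e1', ← mul_assoc _ (indX q (-1) W k l), e2,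
        ← mul_assoc _ (indX q (-1) W k l), e1]
      by_cases hkj : k = j
      · subst hkj
        simp only [if_true]
        simp only [mul_sub, add_mul, smul_mul_assoc, mul_smul_comm, mul_assoc]
        linear_combination (norm := module) hψ
      · simp only [if_neg hkj, mul_zero, add_zero]
        simp only [mul_sub, add_mul, smul_mul_assoc, mul_smul_comm, mul_assoc]
        module

/-! ### Relations of the positive half on the induced module -/

theorem ev_indE (r : FreeAlgebra ℂ (Node M N × ℤ)) (w : W) :
    ev (indE hq hq' C Z) r (itm M N q (-1) W 1 w) = itm M N q (-1) W 1 (ev Z r w) := by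
  induction r using FreeAlgebra.induction generalizing w with
  | grade0 c => simp
  | grade1 g => simp
  | mul a b ha hb => rw [map_mul, Module.End.mul_apply, hb, ha, map_mul, Module.End.mul_apply]
  | add a b ha hb =>
    rw [map_add, LinearMap.add_apply, hb, ha, map_add, LinearMap.add_apply, map_add]

theorem tw_symm (i j : ℕ) : tw M i j = tw M j i := by
  unfold tw
  simp only [and_comm]

theorem tw_mul_self (i j : ℕ) : tw M i j * tw M i j = 1 := by
  unfold tw
  split_ifs <;> norm_num

/-- A relation holds on the induced module if its corners vanish. -/
theorem ev_indE_eq (hZs : Sat q 1 Z) {a b : FreeAlgebra ℂ (Node M N × ℤ)}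
    (hab : PRel M N q 1 a b)
    (hcor : ∀ (i : Node M N) (c : ℂ) (p : ℤ),
      ev (twFam (indE hq hq' C Z) i fun n => c • indPsi q K h i (n + p)) a 0 1 =
        ev (twFam (indE hq hq' C Z) i fun n => c • indPsi q K h i (n + p)) b 0 1) :
    ev (indE hq hq' C Z) a = ev (indE hq hq' C Z) b := by
  rw [← sub_eq_zero]
  refine ind_op_eq_zero (fun w => ?_) fun i n => ?_
  · rw [LinearMap.sub_apply, ev_indE, ev_indE, sat_iff_ev.mp hZs a b hab, sub_self]
  -- The cross relation read backwards: `X_{i,n}^-` acts on words in the `X^+` by a twisted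
  -- derivation, with `-tw M i i • ψ` in the role of the current.
  · have hy : ∀ (k : Node M N) (l : ℤ), tw M i k • indE hq hq' C Z k l * indX q (-1) W i n +
        (if k = i then (-tw M i i) • indPsi q K h i (l + n) else 0) =
          indX q (-1) W i n * indE hq hq' C Z k l := by
      intro k l
      have e1 := indE_mul_indX hq hq' C (Z := Z) k i l n
      rw [smul_mul_assoc, e1, smul_add, smul_smul, tw_symm, tw_mul_self, one_smul, add_assoc]
      by_cases hki : k = i
      · subst hki
        rw [if_pos rfl, if_pos rfl, add_comm n l]
        module
      · rw [if_neg hki, if_neg (Ne.symm hki), smul_zero, add_zero, add_zero]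
    obtain ⟨c, hc0, hc⟩ := ev_mul_of_corner hy hab (hcor i _ n)
    refine ⟨c⁻¹, ?_⟩
    rw [← hc, smul_smul, inv_mul_cancel₀ hc0, one_smul]

theorem indE_sat (hZ : IsWeight q 1 K h Z) (hZs : Sat q 1 Z) : Sat q 1 (indE hq hq' C Z) := by
  have C' := ind_isCartan (e := -1) hq C
  have hpsi : ∀ (i : Node M N) (c : ℂ) (p : ℤ),
      IsPsi q 1 (indE hq hq' C Z) i fun n => c • indPsi q K h i (n + p) :=
    fun i c p => (indE_isWeight hq hq' C hZ).isPsi hq hq' C' i c p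
  -- The relations of degree 2 come before the others: their corners need only the exchange
  -- relations of `ψ`, while the Serre and oscillation corners use that the `X^+` already satisfy
  -- the relations of degree 2.
  have hquad : QuadSat q 1 (indE hq hq' C Z) :=
    { comm := fun i j m n hc => by
        have h1 := ev_indE_eq hq hq' C hZs (.comm i j m n hc) fun k c p => by
          have := corner_comm (hpsi k c p) m n hc
          simpa [map_sbr] using this
        simpa [map_sbr] using h1
      quad := fun i j hc m n => by
        have h1 := ev_indE_eq hq hq' C hZs (.quad i j m n hc) fun k c p => by
          have := corner_quad (hpsi k c p) m n hc
          simpa only [map_sub, map_smul, map_mul, ev_ι] using this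
        simpa only [map_sub, map_smul, map_mul, ev_ι] using h1 }
  rw [sat_iff_ev]
  intro a b hab
  exact ev_indE_eq hq hq' C hZs hab fun k c p =>
    corner_eq hq hquad (hpsi k c p) (PRel.nilRel_ev _ hab)

end Extension

/-! ### Algebras with Drinfeld generators -/

section Drinfeld

variable {M N : ℕ} {A : Type} [Ring A] [Algebra ℂ A] {q : ℂ}
  {K : ℤˣ → Node M N → A} {h : Node M N → {s : ℤ // s ≠ 0} → A} {X : ℤˣ → Node M N → ℤ → A}

/-- The defining relations of `U_q(Lsl(M,N))` in any algebra. -/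
structure IsDrinfeld (q : ℂ) (K : ℤˣ → Node M N → A) (h : Node M N → {s : ℤ // s ≠ 0} → A)
    (X : ℤˣ → Node M N → ℤ → A) : Prop where
  cartan : IsCartan K h
  weight : ∀ e, IsWeight q e K h (X e)
  sat : ∀ e, Sat q e (X e)
  X_X : ∀ (i j : Node M N) (m n : ℤ), sbr (par M i) (par M j) 1 (X 1 i m) (X (-1) j n) =
    if i = j then psiOf q K h i (m + n) else 0

/-- The homomorphism from the free algebra given by the values of the generators. -/
def genLift (K : ℤˣ → Node M N → A) (h : Node M N → {s : ℤ // s ≠ 0} → A)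
    (X : ℤˣ → Node M N → ℤ → A) : FreeAlgebra ℂ (Gen M N) →ₐ[ℂ] A :=
  FreeAlgebra.lift ℂ fun
    | .X e i n => X e i n
    | .h i s => h i s
    | .K e i => K e i

@[simp]
theorem genLift_fX (e : ℤˣ) (i : Node M N) (n : ℤ) : genLift K h X (fX e i n) = X e i n :=
  FreeAlgebra.lift_ι_apply _ _

@[simp]
theorem genLift_fh (i : Node M N) (s : {s : ℤ // s ≠ 0}) : genLift K h X (fh i s) = h i s :=
  FreeAlgebra.lift_ι_apply _ _

@[simp]
theorem genLift_fK (e : ℤˣ) (i : Node M N) : genLift K h X (fK e i) = K e i :=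
  FreeAlgebra.lift_ι_apply _ _

theorem genLift_psi (i : Node M N) (n : ℤ) :
    genLift K h X ((qi M q i - (qi M q i)⁻¹)⁻¹ • (phi q 1 i n - phi q (-1) i n)) =
      psiOf q K h i n := by
  change genLift K h X (psiOf q fK fh i n) = _
  rw [map_psiOf]
  simp only [genLift_fK, genLift_fh]

theorem IsDrinfeld.genLift_rel (D : IsDrinfeld q K h X) {a b : FreeAlgebra ℂ (Gen M N)}
    (hab : Rel M N q a b) : genLift K h X a = genLift K h X b := by
  cases hab with
  | K_inv e i => simpa using D.cartan.K_inv e i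
  | K_K i j => simpa using D.cartan.K_K i j
  | K_h i j s => simpa using D.cartan.K_h i j s
  | h_h i j s t => simpa using D.cartan.h_h i j s t
  | K_X e i j n => simpa using (D.weight e).K_X i j n
  | h_X e i j s n =>
    rw [map_sub, map_mul, map_mul, map_smul, genLift_fh, genLift_fX, genLift_fX]
    exact (D.weight e).h_X i j s n
  | X_X i j m n =>
    rw [map_sbr, genLift_fX, genLift_fX, D.X_X]
    split_ifs
    · rw [genLift_psi]
    · rw [map_zero]
  | nil e a b hab =>
    have := NilRel.map (genLift K h X) hab
    simp only [genLift_fX] at this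
    exact D.sat e _ _ this

/-- The universal property of `U_q(Lsl(M,N))`. -/
def IsDrinfeld.lift (D : IsDrinfeld q K h X) : U M N q →ₐ[ℂ] A :=
  RingQuot.liftAlgHom ℂ ⟨genLift K h X, fun _ _ => D.genLift_rel⟩

theorem IsDrinfeld.lift_uX (D : IsDrinfeld q K h X) (e : ℤˣ) (i : Node M N) (n : ℤ) :
    D.lift (uX M N q e i n) = X e i n := by
  rw [lift, uX, RingQuot.liftAlgHom_mkAlgHom_apply, genLift_fX]

theorem IsDrinfeld.lift_uh (D : IsDrinfeld q K h X) (i : Node M N) (s : {s : ℤ // s ≠ 0}) :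
    D.lift (uh M N q i s) = h i s := by
  rw [lift, uh, RingQuot.liftAlgHom_mkAlgHom_apply, genLift_fh]

theorem IsDrinfeld.lift_uK (D : IsDrinfeld q K h X) (e : ℤˣ) (i : Node M N) :
    D.lift (uK M N q e i) = K e i := by
  rw [lift, uK, RingQuot.liftAlgHom_mkAlgHom_apply, genLift_fK]

theorem u_isDrinfeld : IsDrinfeld q (uK M N q) (uh M N q) (uX M N q) := by
  set f := RingQuot.mkAlgHom ℂ (Rel M N q) with hf
  have hr : ∀ {a b}, Rel M N q a b → f a = f b := fun hab => RingQuot.mkAlgHom_rel ℂ hab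
  exact
  { cartan :=
    { K_inv := fun e i => (by simpa only [map_mul, map_one] using hr (.K_inv e i) :)
      K_K := fun i j => (by simpa only [map_mul, map_one] using hr (.K_K i j) :)
      K_h := fun i j s => (by simpa only [map_mul, map_one] using hr (.K_h i j s) :)
      h_h := fun i j s t => (by simpa only [map_mul, map_one] using hr (.h_h i j s t) :) }
    weight := fun e =>
    { K_X := fun i j n => (by simpa only [map_mul, map_smul] using hr (.K_X e i j n) :)
      h_X := fun i j s n => by
        have := hr (.h_X e i j s n)
        rw [map_sub, map_mul, map_mul, map_smul] at this
        exact this }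
    sat := fun e a b hab => by
      obtain ⟨a', b', hab', rfl, rfl⟩ := hab.exists_pRel
      have := hr (.nil e _ _ (PRel.nilRel_ev (fX e) hab'))
      have hev : ev (uX M N q e) = f.comp (ev (fX e)) := by
        ext g
        simp [uX, f]
      rw [hev]
      exact this
    X_X := fun i j m n => by
      have := hr (.X_X i j m n)
      rw [map_sbr] at this
      refine this.trans ?_
      split_ifs
      · exact map_psiOf f q i (m + n)
      · exact map_zero f }

/-- Commutation rules extend from generators to the subalgebra they generate. -/
theorem adjoin_mul_le {S : Set A} {V : Submodule ℂ A}
    (hS : ∀ s ∈ S, ∀ v ∈ V, s * v ∈ V * Subalgebra.toSubmodule (Algebra.adjoin ℂ S)) :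
    Subalgebra.toSubmodule (Algebra.adjoin ℂ S) * V ≤
      V * Subalgebra.toSubmodule (Algebra.adjoin ℂ S) := by
  set Z := Subalgebra.toSubmodule (Algebra.adjoin ℂ S) with hZ
  have hZZ : Z * Z = Z := (Algebra.adjoin ℂ _).isIdempotentElem_toSubmodule
  rw [Submodule.mul_le]
  intro z hz
  have hz' : z ∈ Algebra.adjoin ℂ S := hz
  induction hz' using Algebra.adjoin_induction with
  | mem s hs => exact hS s hs
  | algebraMap r =>
    intro v hv
    rw [Algebra.commutes]
    exact Submodule.mul_mem_mul hv (Subalgebra.algebraMap_mem _ r)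
  | add a b ha hb iha ihb =>
    intro v hv
    rw [add_mul]
    exact Submodule.add_mem _ (iha ha v hv) (ihb hb v hv)
  | mul a b ha hb iha ihb =>
    intro v hv
    rw [mul_assoc]
    have hle : V * Z ≤ (V * Z).comap (LinearMap.mulLeft ℂ a) := by
      rw [Submodule.mul_le]
      intro w hw z hz
      rw [Submodule.mem_comap, LinearMap.mulLeft_apply, ← mul_assoc, ← hZZ, ← mul_assoc]
      exact Submodule.mul_mem_mul (iha ha w hw) hz
    exact hle (ihb hb v hv)

theorem mul_adjoin_le {S : Set A} {V : Submodule ℂ A}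
    (hS : ∀ s ∈ S, ∀ v ∈ V, v * s ∈ Subalgebra.toSubmodule (Algebra.adjoin ℂ S) * V) :
    V * Subalgebra.toSubmodule (Algebra.adjoin ℂ S) ≤
      Subalgebra.toSubmodule (Algebra.adjoin ℂ S) * V := by
  set Z := Subalgebra.toSubmodule (Algebra.adjoin ℂ S) with hZ
  have hZZ : Z * Z = Z := (Algebra.adjoin ℂ _).isIdempotentElem_toSubmodule
  rw [Submodule.mul_le]
  intro v hv z hz
  have hz' : z ∈ Algebra.adjoin ℂ S := hz
  induction hz' using Algebra.adjoin_induction generalizing v with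
  | mem s hs => exact hS s hs v hv
  | algebraMap r =>
    rw [← Algebra.commutes]
    exact Submodule.mul_mem_mul (Subalgebra.algebraMap_mem _ r) hv
  | add a b ha hb iha ihb =>
    rw [mul_add]
    exact Submodule.add_mem _ (iha v hv ha) (ihb v hv hb)
  | mul a b ha hb iha ihb =>
    rw [← mul_assoc]
    have hle : Z * V ≤ (Z * V).comap (LinearMap.mulRight ℂ b) := by
      rw [Submodule.mul_le]
      intro z hz w hw
      rw [Submodule.mem_comap, LinearMap.mulRight_apply, mul_assoc, ← hZZ, mul_assoc]
      exact Submodule.mul_mem_mul hz (ihb w hw hb)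
    exact hle (iha v hv ha)

theorem psiOf_mem (C : IsCartan K h) (B : Subalgebra ℂ A) (hK : ∀ e i, K e i ∈ B)
    (hh : ∀ i s, h i s ∈ B) (i : Node M N) (n : ℤ) : psiOf q K h i n ∈ B := by
  rw [← C.lift_psiOf]
  exact laurent_mem (B.comap C.lift) (fun e i => by simpa using hK e i)
    (fun i s => by simpa using hh i s) _

theorem span_mul_mem {S : Set A} {V : Submodule ℂ A} {x : A} (hS : ∀ s ∈ S, s * x ∈ V) (v : A)
    (hv : v ∈ Submodule.span ℂ S) : v * x ∈ V :=
  (Submodule.span_le (p := V.comap (LinearMap.mulRight ℂ x))).mpr hS hv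

theorem mul_span_mem {S : Set A} {V : Submodule ℂ A} {x : A} (hS : ∀ s ∈ S, x * s ∈ V) (v : A)
    (hv : v ∈ Submodule.span ℂ S) : x * v ∈ V :=
  (Submodule.span_le (p := V.comap (LinearMap.mulLeft ℂ x))).mpr hS hv

/-- The triangular decomposition, without uniqueness. -/
theorem IsDrinfeld.top_le (D : IsDrinfeld q K h X) (hq : q ≠ 0)
    (hgen : Algebra.adjoin ℂ (Set.range (fun g : Gen M N => genLift K h X (FreeAlgebra.ι ℂ g))) = ⊤)
    (x : A) :
    x ∈ Subalgebra.toSubmodule (Algebra.adjoin ℂ {x | ∃ i n, x = X (-1) i n}) *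
      Subalgebra.toSubmodule
        (Algebra.adjoin ℂ ({x | ∃ e i, x = K e i} ∪ {x | ∃ i s, x = h i s})) *
      Subalgebra.toSubmodule (Algebra.adjoin ℂ {x | ∃ i n, x = X 1 i n}) := by
  set SN : Set A := {x | ∃ i n, x = X (-1) i n}
  set SP : Set A := {x | ∃ i n, x = X 1 i n}
  set SZ : Set A := {x | ∃ e i, x = K e i} ∪ {x | ∃ i s, x = h i s}
  have hKZ : ∀ e i, K e i ∈ Algebra.adjoin ℂ SZ := fun e i =>
    Algebra.subset_adjoin (Or.inl ⟨e, i, rfl⟩)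
  have hhZ : ∀ i s, h i s ∈ Algebra.adjoin ℂ SZ := fun i s =>
    Algebra.subset_adjoin (Or.inr ⟨i, s, rfl⟩)
  have hψ : ∀ i n, psiOf q K h i n ∈ Algebra.adjoin ℂ SZ := psiOf_mem D.cartan _ hKZ hhZ
  set N' := Subalgebra.toSubmodule (Algebra.adjoin ℂ SN) with hN'
  set P := Subalgebra.toSubmodule (Algebra.adjoin ℂ SP) with hP
  set Z := Subalgebra.toSubmodule (Algebra.adjoin ℂ SZ) with hZ
  set V := Submodule.span ℂ SP with hV
  set V' := Submodule.span ℂ SN with hV'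
  have hNN : N' * N' = N' := (Algebra.adjoin ℂ _).isIdempotentElem_toSubmodule
  have hPP : P * P = P := (Algebra.adjoin ℂ _).isIdempotentElem_toSubmodule
  have hZZ : Z * Z = Z := (Algebra.adjoin ℂ _).isIdempotentElem_toSubmodule
  have hVP : V ≤ P := Submodule.span_le.mpr Algebra.subset_adjoin
  have hVN : V' ≤ N' := Submodule.span_le.mpr Algebra.subset_adjoin
  have h1N : (1 : A) ∈ N' := Subalgebra.one_mem _
  have h1Z : (1 : A) ∈ Z := Subalgebra.one_mem _
  have h1P : (1 : A) ∈ P := Subalgebra.one_mem _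
  -- `V'` is the span of all modes of all generators, so it absorbs the mode shifts produced by the
  -- `h_{i,s}`.
  have hZV' : Z * V' ≤ V' * Z := by
    refine adjoin_mul_le fun s hs => mul_span_mem ?_
    rintro _ ⟨j, n, rfl⟩
    have hX : ∀ n, X (-1) j n ∈ V' := fun n => Submodule.subset_span ⟨j, n, rfl⟩
    rcases hs with ⟨e, i, rfl⟩ | ⟨i, s, rfl⟩
    · rw [(D.weight (-1)).K_mul D.cartan hq]
      exact Submodule.smul_mem _ _ (Submodule.mul_mem_mul (hX n) (hKZ e i))
    · rw [sub_eq_iff_eq_add.mp ((D.weight (-1)).h_X i j s n)]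
      refine Submodule.add_mem _ (Submodule.smul_mem _ _ ?_)
        (Submodule.mul_mem_mul (hX n) (hhZ i s))
      simpa using Submodule.mul_mem_mul (hX (n + s)) h1Z
  have hZN : Z * N' ≤ N' * Z := by
    refine mul_adjoin_le fun s hs v hv => ?_
    exact mul_le_mul' hVN le_rfl
      (hZV' (Submodule.mul_mem_mul hv (Submodule.subset_span hs)))
  have hVZ : V * Z ≤ Z * V := by
    refine mul_adjoin_le fun s hs => span_mul_mem ?_
    rintro _ ⟨j, n, rfl⟩
    have hX : ∀ n, X 1 j n ∈ V := fun n => Submodule.subset_span ⟨j, n, rfl⟩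
    rcases hs with ⟨e, i, rfl⟩ | ⟨i, s, rfl⟩
    · have := (D.weight 1).K_mul D.cartan hq e i j n
      rw [← inv_smul_eq_iff₀ (zpow_ne_zero _ hq)] at this
      rw [← this]
      exact Submodule.smul_mem _ _ (Submodule.mul_mem_mul (hKZ e i) (hX n))
    · have := (D.weight 1).h_X i j s n
      rw [sub_eq_iff_eq_add, ← sub_eq_iff_eq_add'] at this
      rw [← this]
      refine Submodule.sub_mem _ (Submodule.mul_mem_mul (hhZ i s) (hX n))
        (Submodule.smul_mem _ _ ?_)
      simpa using Submodule.mul_mem_mul h1Z (hX (n + s))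
  -- A single positive generator moving through `N'` either survives on the right or is consumed
  -- into some `ψ`, after which the Cartan factor is moved to the right by `hZN`. One generator at a
  -- time suffices, as only stability under left multiplication by generators is needed.
  have hVN' : V * N' ≤ N' * Z ⊔ N' * V := by
    have hadj : ∀ n ∈ Algebra.adjoin ℂ SN, ∀ v ∈ V, v * n ∈ N' * Z ⊔ N' * V := by
      intro n hn
      induction hn using Algebra.adjoin_induction with
      | mem s hs =>
        obtain ⟨j, n, rfl⟩ := hs
        refine span_mul_mem ?_
        rintro _ ⟨i, m, rfl⟩
        have hXj : X (-1) j n ∈ N' := Algebra.subset_adjoin ⟨j, n, rfl⟩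
        have := D.X_X i j m n
        rw [sbr_eq, sub_eq_iff_eq_add] at this
        rw [this]
        refine Submodule.add_mem _ (Submodule.mem_sup_left ?_) (Submodule.mem_sup_right
          (Submodule.smul_mem _ _ (Submodule.mul_mem_mul hXj (Submodule.subset_span ⟨i, m, rfl⟩))))
        split_ifs
        · simpa using Submodule.mul_mem_mul h1N (hψ i (m + n))
        · exact Submodule.zero_mem _
      | algebraMap r =>
        intro v hv
        rw [← Algebra.commutes]
        exact Submodule.mem_sup_right (Submodule.mul_mem_mul (Subalgebra.algebraMap_mem _ r) hv)
      | add a b _ _ iha ihb =>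
        intro v hv
        rw [mul_add]
        exact Submodule.add_mem _ (iha v hv) (ihb v hv)
      | mul a b ha hb iha ihb =>
        intro v hv
        rw [← mul_assoc]
        have hle : N' * Z ⊔ N' * V ≤ (N' * Z ⊔ N' * V).comap (LinearMap.mulRight ℂ b) := by
          have hNle : N' * (N' * Z ⊔ N' * V) ≤ N' * Z ⊔ N' * V := by
            rw [Submodule.mul_sup, ← mul_assoc, ← mul_assoc, hNN]
          refine sup_le ?_ ?_ <;> rw [Submodule.mul_le] <;> intro x hx y hy <;>
            rw [Submodule.mem_comap, LinearMap.mulRight_apply, mul_assoc] <;>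
            refine hNle (Submodule.mul_mem_mul hx ?_)
          · exact Submodule.mem_sup_left (hZN (Submodule.mul_mem_mul hy hb))
          · exact ihb y hy
        exact hle (iha v hv)
    rw [Submodule.mul_le]
    exact fun v hv n hn => hadj n hn v hv
  have hst : ∀ Y : Submodule ℂ A, Y * (N' * Z * P) ≤ N' * Z * P →
      ∀ g ∈ Y, ∀ y ∈ N' * Z * P, g * y ∈ N' * Z * P :=
    fun Y hY g hg y hy => hY (Submodule.mul_mem_mul hg hy)
  have hNst : N' * (N' * Z * P) ≤ N' * Z * P := by
    rw [← mul_assoc, ← mul_assoc, hNN]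
  have hZst : Z * (N' * Z * P) ≤ N' * Z * P := by
    rw [← mul_assoc, ← mul_assoc]
    refine (mul_le_mul' (mul_le_mul' hZN le_rfl) le_rfl).trans ?_
    rw [mul_assoc N' Z Z, hZZ]
  have hVst : V * (N' * Z * P) ≤ N' * Z * P := by
    rw [← mul_assoc, ← mul_assoc]
    refine (mul_le_mul' (mul_le_mul' hVN' le_rfl) le_rfl).trans ?_
    rw [Submodule.sup_mul, Submodule.sup_mul, mul_assoc N' Z Z, hZZ]
    refine sup_le le_rfl ?_
    rw [mul_assoc N' V Z]
    refine (mul_le_mul' (mul_le_mul' le_rfl hVZ) le_rfl).trans ?_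
    rw [← mul_assoc N' Z V, mul_assoc _ V P]
    refine mul_le_mul' le_rfl ((mul_le_mul' hVP le_rfl).trans ?_)
    rw [hPP]
  refine mem_of_left_stable hgen (N' * Z * P) ?_ ?_ x
  · simpa using Submodule.mul_mem_mul (Submodule.mul_mem_mul h1N h1Z) h1P
  · rintro (⟨e, i, n⟩ | ⟨i, s⟩ | ⟨e, i⟩)
    · change ∀ y ∈ _, genLift K h X (fX e i n) * y ∈ _
      rw [genLift_fX]
      rcases units_cases e with rfl | rfl
      · exact hst V hVst _ (Submodule.subset_span ⟨i, n, rfl⟩)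
      · exact hst N' hNst _ (Algebra.subset_adjoin ⟨i, n, rfl⟩)
    · change ∀ y ∈ _, genLift K h X (fh i s) * y ∈ _
      rw [genLift_fh]
      exact hst Z hZst _ (hhZ i s)
    · change ∀ y ∈ _, genLift K h X (fK e i) * y ∈ _
      rw [genLift_fK]
      exact hst Z hZst _ (hKZ e i)

end Drinfeld

/-! ### Multiplication is surjective -/

section Surjective

variable {M N : ℕ} {q : ℂ}

theorem genLift_u : genLift (uK M N q) (uh M N q) (uX M N q) = RingQuot.mkAlgHom ℂ (Rel M N q) := by
  refine FreeAlgebra.hom_ext (funext fun g => ?_)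
  cases g with
  | X e i n => exact genLift_fX e i n
  | h i s => exact genLift_fh i s
  | K e i => exact genLift_fK e i

theorem adjoin_u : Algebra.adjoin ℂ (Set.range (fun g : Gen M N =>
    genLift (uK M N q) (uh M N q) (uX M N q) (FreeAlgebra.ι ℂ g))) = ⊤ := by
  have : (fun g : Gen M N => genLift (uK M N q) (uh M N q) (uX M N q) (FreeAlgebra.ι ℂ g)) =
      genLift (uK M N q) (uh M N q) (uX M N q) ∘ FreeAlgebra.ι ℂ := rfl
  rw [this, Set.range_comp, ← AlgHom.map_adjoin, FreeAlgebra.adjoin_range_ι, Algebra.map_top,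
    AlgHom.range_eq_top, genLift_u]
  exact RingQuot.mkAlgHom_surjective ℂ _

theorem triMul_surjective (hq : q ≠ 0) : Function.Surjective (triMul M N q) := by
  intro x
  have hx := u_isDrinfeld.top_le hq adjoin_u x
  refine Submodule.mul_induction_on hx (fun y hy c hc => ?_) ?_
  · refine Submodule.mul_induction_on hy (fun a ha b hb => ?_) ?_
    · exact ⟨((⟨a, ha⟩ : Unil M N q (-1)) ⊗ₜ (⟨b, hb⟩ : Uzero M N q)) ⊗ₜ
        (⟨c, hc⟩ : Unil M N q 1), rfl⟩
    · rintro y z ⟨u, hu⟩ ⟨v, hv⟩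
      exact ⟨u + v, by rw [map_add, hu, hv, add_mul]⟩
  · rintro y z ⟨u, hu⟩ ⟨v, hv⟩
    exact ⟨u + v, by rw [map_add, hu, hv]⟩

end Surjective

/-! ### Reordering the two factors of `U^+ ⊗ U^0` -/

section Straighten

variable {M N : ℕ} {q : ℂ}

/-- Scalings fix `1` and derivations kill it, so the Cartan part acts on `1 ⊗ w` through `w` alone.
-/
theorem ind_lift_one {e : ℤˣ} {W : Type} [AddCommGroup W] [Module ℂ W]
    {K : ℤˣ → Node M N → Module.End ℂ W} {h : Node M N → {s : ℤ // s ≠ 0} → Module.End ℂ W}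
    (hq : q ≠ 0) (C : IsCartan K h) (b : Laurent M N) (w : W) :
    (ind_isCartan (e := e) hq C).lift b (itm M N q e W 1 w) = itm M N q e W 1 (C.lift b w) := by
  let S : Subalgebra ℂ (Laurent M N) :=
    { carrier := {b | ∀ w, (ind_isCartan (e := e) hq C).lift b (itm M N q e W 1 w) =
        itm M N q e W 1 (C.lift b w)}
      mul_mem' := fun {a b} ha hb w => by
        rw [map_mul, Module.End.mul_apply, hb, ha, map_mul, Module.End.mul_apply]
      add_mem' := fun {a b} ha hb w => by
        rw [map_add, LinearMap.add_apply, hb, ha, map_add, LinearMap.add_apply, map_add]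
      algebraMap_mem' := fun c w => by
        rw [AlgHom.commutes, AlgHom.commutes, Module.algebraMap_end_apply,
          Module.algebraMap_end_apply, map_smul] }
  refine laurent_mem S (fun e' i w => ?_) (fun i s w => ?_) b w
  · simp
  · simp

variable (M N) in
/-- `K_i^e` acting on the Laurent polynomials. -/
def lmK (e : ℤˣ) (i : Node M N) : Module.End ℂ (Laurent M N) := Algebra.lmul ℂ _ (lK M N e i)

variable (M N) in
/-- `h_{i,s}` acting on the Laurent polynomials. -/
def lmh (i : Node M N) (s : {s : ℤ // s ≠ 0}) : Module.End ℂ (Laurent M N) :=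
  Algebra.lmul ℂ _ (lh M N i s)

theorem lmK_apply (e : ℤˣ) (i : Node M N) (b : Laurent M N) : lmK M N e i b = lK M N e i * b :=
  rfl

theorem lmh_apply (i : Node M N) (s : {s : ℤ // s ≠ 0}) (b : Laurent M N) :
    lmh M N i s b = lh M N i s * b := rfl

theorem lm_isCartan : IsCartan (lmK M N) (lmh M N) where
  K_inv e i := LinearMap.ext fun b => by
    rw [Module.End.mul_apply, lmK_apply, lmK_apply, ← mul_assoc, laurent_isCartan.K_inv, one_mul,
      Module.End.one_apply]
  K_K i j := LinearMap.ext fun b => mul_left_comm _ _ b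
  K_h i j s := LinearMap.ext fun b => mul_left_comm _ _ b
  h_h i j s t := LinearMap.ext fun b => mul_left_comm _ _ b

/-- The tensor product of operators on the two factors. -/
def indMap (f : Module.End ℂ (Nil M N q 1)) (g : Module.End ℂ (Laurent M N)) :
    Module.End ℂ (Ind M N q 1 (Laurent M N)) :=
  indLift q 1 ((itm M N q 1 (Laurent M N)).compl₁₂ f g)

@[simp]
theorem indMap_itm (f : Module.End ℂ (Nil M N q 1)) (g : Module.End ℂ (Laurent M N))
    (x : Nil M N q 1) (b : Laurent M N) :
    indMap f g (itm M N q 1 _ x b) = itm M N q 1 _ (f x) (g b) := rfl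

/-- The operators `σ_i^{-e} ⊗ K_i^e`. -/
def strK (q : ℂ) (e : ℤˣ) (i : Node M N) : Module.End ℂ (Ind M N q 1 (Laurent M N)) :=
  indMap (nScale M N q 1 fun j => kCoef M q 1 (-e) i j).toLinearMap (lmK M N e i)

/-- The operators `1 ⊗ h_{i,s} - D_{i,s} ⊗ 1`. -/
def strh (q : ℂ) (i : Node M N) (s : {s : ℤ // s ≠ 0}) :
    Module.End ℂ (Ind M N q 1 (Laurent M N)) :=
  indMap 1 (lmh M N i s) - indMap (nDer M N q 1 (fun j => hCoef M q 1 i s j) s) 1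

theorem kCoef_mul_neg (hq : q ≠ 0) (e e' : ℤˣ) (i j : ℕ) :
    kCoef M q e e' i j * kCoef M q e (-e') i j = 1 := by
  rw [kCoef, kCoef, Units.val_neg, neg_mul, zpow_neg, mul_inv_cancel₀ (zpow_ne_zero _ hq)]

theorem str_isCartan (hq : q ≠ 0) : IsCartan (strK (M := M) (N := N) q) (strh q) where
  K_inv e i := by
    refine ind_ext q 1 fun x b => ?_
    have hK : lmK M N e i (lmK M N (-e) i b) = b :=
      LinearMap.congr_fun (lm_isCartan.K_inv e i) b
    have hs : (fun j : Node M N => kCoef M q 1 (-e) i j * kCoef M q 1 (- -e) i j) = fun _ => 1 :=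
      funext fun j => kCoef_mul_neg hq _ _ _ _
    simp only [strK, Module.End.mul_apply, indMap_itm, hK, AlgHom.toLinearMap_apply, nScale_comp,
      hs, nScale_one, Module.End.one_apply]
  K_K i j := by
    refine ind_ext q 1 fun x b => ?_
    have hK : lmK M N 1 i (lmK M N 1 j b) = lmK M N 1 j (lmK M N 1 i b) :=
      LinearMap.congr_fun (lm_isCartan.K_K i j) b
    simp only [strK, Module.End.mul_apply, indMap_itm, hK, AlgHom.toLinearMap_apply, nScale_comp,
      mul_comm]
  K_h i j s := by
    refine ind_ext q 1 fun x b => ?_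
    have hK : lmK M N 1 i (lmh M N j s b) = lmh M N j s (lmK M N 1 i b) :=
      LinearMap.congr_fun (lm_isCartan.K_h i j s) b
    simp only [strK, strh, Module.End.mul_apply, indMap_itm, LinearMap.sub_apply, map_sub,
      Module.End.one_apply, hK, AlgHom.toLinearMap_apply, nScale_nDer]
  h_h i j s t := by
    refine ind_ext q 1 fun x b => ?_
    have hK : lmh M N i s (lmh M N j t b) = lmh M N j t (lmh M N i s b) :=
      LinearMap.congr_fun (lm_isCartan.h_h i j s t) b
    simp only [strh, Module.End.mul_apply, indMap_itm, LinearMap.sub_apply, map_sub,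
      Module.End.one_apply, hK]
    rw [nDer_comm]
    abel

/-- Operators commuting with a Cartan family commute with everything it generates. -/
theorem IsCartan.lift_commute {A : Type} [Ring A] [Algebra ℂ A] {K : ℤˣ → Node M N → A}
    {h : Node M N → {s : ℤ // s ≠ 0} → A} (C : IsCartan K h) {T : A}
    (hK : ∀ e i, T * K e i = K e i * T) (hh : ∀ i s, T * h i s = h i s * T) (b : Laurent M N) :
    T * C.lift b = C.lift b * T := by
  have : C.lift b ∈ Subalgebra.centralizer ℂ {T} :=
    laurent_mem ((Subalgebra.centralizer ℂ {T}).comap C.lift)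
      (fun e i => by simpa [Subalgebra.mem_centralizer_iff] using hK e i)
      (fun i s => by simpa [Subalgebra.mem_centralizer_iff] using hh i s) b
  simpa [Subalgebra.mem_centralizer_iff] using this

variable (hq : q ≠ 0)

/-- The inverse of the straightening map. -/
def unstr : Module.End ℂ (Ind M N q 1 (Laurent M N)) :=
  indLift q 1 (LinearMap.mk₂ ℂ
    (fun y b => (str_isCartan hq).lift b (itm M N q 1 (Laurent M N) y 1))
    (fun x y b => by rw [map_add, LinearMap.add_apply, map_add])
    (fun c x b => by rw [map_smul, LinearMap.smul_apply, map_smul])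
    (fun x a b => by rw [map_add, LinearMap.add_apply])
    (fun c x b => by rw [map_smul, LinearMap.smul_apply]))

theorem unstr_itm (y : Nil M N q 1) (b : Laurent M N) :
    unstr hq (itm M N q 1 _ y b) = (str_isCartan hq).lift b (itm M N q 1 (Laurent M N) y 1) := rfl

/-- An operator on the first factor commuting with scalings and shift derivations commutes with
`strK` and `strh`, hence with all they generate. It applies to the scalings and the derivations
themselves. -/
theorem lift_indMap_left {f : Module.End ℂ (Nil M N q 1)}
    (hs : ∀ c x, f (nScale M N q 1 c x) = nScale M N q 1 c (f x))
    (hd : ∀ c s x, f (nDer M N q 1 c s x) = nDer M N q 1 c s (f x)) (b : Laurent M N)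
    (y : Nil M N q 1) :
    (str_isCartan hq).lift b (itm M N q 1 (Laurent M N) (f y) 1) =
      indMap f 1 (unstr hq (itm M N q 1 _ y b)) := by
  have := (str_isCartan (M := M) (N := N) hq).lift_commute (T := indMap f 1)
    (fun e i => ind_ext q 1 fun x b => by simp [strK, hs])
    (fun i s => ind_ext q 1 fun x b => by simp [strh, hd]) b
  have h2 := LinearMap.congr_fun this (itm M N q 1 (Laurent M N) y 1)
  simp only [Module.End.mul_apply, indMap_itm, Module.End.one_apply] at h2
  rw [← h2, unstr_itm]

theorem unstr_indK (e : ℤˣ) (i : Node M N) (v : Ind M N q 1 (Laurent M N)) :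
    unstr hq (indK q 1 (lmK M N) e i v) = indMap 1 (lmK M N e i) (unstr hq v) := by
  revert v
  refine LinearMap.congr_fun (f := unstr hq * indK q 1 (lmK M N) e i)
    (g := indMap 1 (lmK M N e i) * unstr hq) (ind_ext q 1 fun y b => ?_)
  have hm : strK q e i * indMap (nScale M N q 1 fun j => kCoef M q 1 e i j).toLinearMap 1 =
      indMap (M := M) (N := N) 1 (lmK M N e i) := by
    refine ind_ext q 1 fun x b => ?_
    have hs : (fun j : Node M N => kCoef M q 1 (-e) i j * kCoef M q 1 e i j) = fun _ => 1 :=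
      funext fun j => by rw [mul_comm, kCoef_mul_neg hq]
    simp only [strK, Module.End.mul_apply, indMap_itm, AlgHom.toLinearMap_apply, nScale_comp,
      hs, nScale_one, Module.End.one_apply]
  rw [Module.End.mul_apply, Module.End.mul_apply, indK_tmul, unstr_itm, lmK_apply,
    map_mul, Module.End.mul_apply, IsCartan.lift_lK,
    ← AlgHom.toLinearMap_apply (nScale M N q 1 fun j => kCoef M q 1 e i j),
    lift_indMap_left hq (fun c x => ?_) (fun c s x => ?_), ← Module.End.mul_apply, hm]
  · simp only [AlgHom.toLinearMap_apply, nScale_comp, mul_comm]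
  · simp only [AlgHom.toLinearMap_apply, nScale_nDer]

/-- The summand with the derivation in the action of `h_{i,s}` cancels the correction `-D_{i,s} ⊗ 1`
in `strh`, so straightening leaves `h_{i,s}` acting on the Laurent factor only. -/
theorem unstr_indh (i : Node M N) (s : {s : ℤ // s ≠ 0}) (v : Ind M N q 1 (Laurent M N)) :
    unstr hq (indh q 1 (lmh M N) i s v) = indMap 1 (lmh M N i s) (unstr hq v) := by
  revert v
  refine LinearMap.congr_fun (f := unstr hq * indh q 1 (lmh M N) i s)
    (g := indMap 1 (lmh M N i s) * unstr hq) (ind_ext q 1 fun y b => ?_)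
  rw [Module.End.mul_apply, Module.End.mul_apply, indh_tmul, map_add, unstr_itm, unstr_itm,
    lift_indMap_left hq (fun c x => (nScale_nDer _ _ _ _).symm) (fun c s x => nDer_comm _ _ _ _ _),
    lmh_apply, map_mul, Module.End.mul_apply, IsCartan.lift_lh, ← unstr_itm, strh,
    LinearMap.sub_apply, add_sub_cancel]

/-- The elements `b` whose action `unstr` turns into `1 ⊗ b` form a subalgebra containing the
generators, and `unstr` fixes `y ⊗ 1`. A left inverse of `y ⊗ b ↦ b·(y ⊗ 1)` is all that injectivity
requires. -/
theorem unstr_lift (b : Laurent M N) (y : Nil M N q 1) :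
    unstr hq ((ind_isCartan hq lm_isCartan).lift b (itm M N q 1 _ y 1)) = itm M N q 1 _ y b := by
  let S : Subalgebra ℂ (Laurent M N) :=
    { carrier := {b | ∀ v, unstr hq ((ind_isCartan hq lm_isCartan).lift b v) =
        indMap 1 (Algebra.lmul ℂ _ b) (unstr hq v)}
      mul_mem' := fun {a b} ha hb v => by
        rw [map_mul, Module.End.mul_apply, ha, hb, map_mul]
        refine LinearMap.congr_fun (f := indMap 1 (Algebra.lmul ℂ _ a) *
          indMap 1 (Algebra.lmul ℂ _ b)) (ind_ext q 1 fun x b => ?_) _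
        simp
      add_mem' := fun {a b} ha hb v => by
        rw [map_add, LinearMap.add_apply, map_add, ha, hb, map_add]
        refine LinearMap.congr_fun (f := indMap 1 (Algebra.lmul ℂ _ a) +
          indMap 1 (Algebra.lmul ℂ _ b)) (ind_ext q 1 fun x b => ?_) _
        simp
      algebraMap_mem' := fun c v => by
        rw [AlgHom.commutes, AlgHom.commutes, Module.algebraMap_end_apply, map_smul]
        refine LinearMap.congr_fun (f := c • (1 : Module.End ℂ (Ind M N q 1 (Laurent M N))))
          (ind_ext q 1 fun x b => ?_) _
        simp }
  have := laurent_mem S (fun e i v => ?_) (fun i s v => ?_) b (itm M N q 1 _ y 1)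
  · rw [this, unstr_itm, map_one]
    simp
  · rw [IsCartan.lift_lK]
    exact unstr_indK hq e i v
  · rw [IsCartan.lift_lh]
    exact unstr_indh hq i s v

end Straighten

/-! ### The action on `U^- ⊗ U^+ ⊗ U^0` -/

section Module

variable {M N : ℕ} {q : ℂ} (hq : q ≠ 0) (hq' : ∀ n : ℕ, 0 < n → q ^ n ≠ 1)

variable (M N q) in
/-- The module `U^+ ⊗ U^0` of the nonnegative part. -/
abbrev PosMod : Type := Ind M N q 1 (Laurent M N)

variable (M N q) in
/-- The module `U^- ⊗ U^+ ⊗ U^0`. -/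
abbrev RegMod : Type := Ind M N q (-1) (PosMod M N q)

theorem pos_isCartan (hq : q ≠ 0) : IsCartan (indK q 1 (lmK M N)) (indh q 1 (lmh M N)) :=
  ind_isCartan hq lm_isCartan

/-- The generators `X_{i,n}^e` acting on `RegMod`. -/
def regX (e : ℤˣ) (i : Node M N) (n : ℤ) : Module.End ℂ (RegMod M N q) :=
  if e = 1 then indE hq hq' (pos_isCartan hq) (indX q 1 (Laurent M N)) i n
  else indX q (-1) (PosMod M N q) i n

theorem regX_one : regX (M := M) (N := N) hq hq' 1 =
    indE hq hq' (pos_isCartan hq) (indX q 1 (Laurent M N)) :=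
  funext fun _ => funext fun _ => if_pos rfl

theorem regX_neg_one : regX (M := M) (N := N) hq hq' (-1) = indX q (-1) (PosMod M N q) :=
  funext fun _ => funext fun _ => if_neg (by decide)

theorem reg_isDrinfeld : IsDrinfeld q (indK q (-1) (indK q 1 (lmK M N)))
    (indh q (-1) (indh q 1 (lmh M N))) (regX hq hq') where
  cartan := ind_isCartan hq (pos_isCartan hq)
  weight e := by
    rcases units_cases e with rfl | rfl
    · rw [regX_one]
      exact indE_isWeight hq hq' _ (ind_isWeight hq lm_isCartan)
    · rw [regX_neg_one]
      exact ind_isWeight hq (pos_isCartan hq)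
  sat e := by
    rcases units_cases e with rfl | rfl
    · rw [regX_one]
      exact indE_sat hq hq' _ (ind_isWeight hq lm_isCartan) (indX_sat q 1)
    · rw [regX_neg_one]
      exact indX_sat q (-1)
  X_X i j m n := by
    rw [regX_one, regX_neg_one, sbr_eq, indE_mul_indX, mul_one, add_sub_cancel_left, add_comm m n]
    simp only [eq_comm (a := i)]
    rfl

/-- The action of `U_q(Lsl(M,N))` on `RegMod`. -/
def reg : U M N q →ₐ[ℂ] Module.End ℂ (RegMod M N q) := (reg_isDrinfeld hq hq').lift

/-! ### Comparison of the presented algebras with `U` -/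

variable (M N q) in
/-- The homomorphism from the presented algebra to `U_q(Lsl(M,N))`. -/
def nilToU (e : ℤˣ) : Nil M N q e →ₐ[ℂ] U M N q := nLift (u_isDrinfeld.sat e)

theorem nilToU_nX (e : ℤˣ) (i : Node M N) (n : ℤ) :
    nilToU M N q e (nX M N q e i n) = uX M N q e i n := nLift_nX _ _ _

variable (M N q) in
/-- The homomorphism from the Laurent polynomial algebra to `U_q(Lsl(M,N))`. -/
def laurentToU : Laurent M N →ₐ[ℂ] U M N q := (u_isDrinfeld (q := q)).cartan.lift

theorem laurentToU_lK (e : ℤˣ) (i : Node M N) : laurentToU M N q (lK M N e i) = uK M N q e i :=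
  IsCartan.lift_lK _ _ _

theorem laurentToU_lh (i : Node M N) (s : {s : ℤ // s ≠ 0}) :
    laurentToU M N q (lh M N i s) = uh M N q i s :=
  IsCartan.lift_lh _ _ _

theorem reg_neg (x : Nil M N q (-1)) :
    reg hq hq' (nilToU M N q (-1) x) = indMul M N q (-1) (PosMod M N q) x := by
  have : (reg hq hq').comp (nilToU M N q (-1)) = indMul M N q (-1) (PosMod M N q) := by
    refine nil_hom_ext fun i n => ?_
    rw [AlgHom.comp_apply, nilToU_nX, reg, IsDrinfeld.lift_uX, regX_neg_one]
    rfl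
  exact DFunLike.congr_fun this x

theorem reg_zero (b : Laurent M N) : reg hq hq' (laurentToU M N q b) =
    (ind_isCartan (e := -1) hq (pos_isCartan (M := M) (N := N) hq)).lift b := by
  refine laurent_mem (AlgHom.equalizer ((reg hq hq').comp (laurentToU M N q))
    (ind_isCartan (e := -1) hq (pos_isCartan (M := M) (N := N) hq)).lift)
      (fun e i => ?_) (fun i s => ?_) b
  · rw [AlgHom.mem_equalizer, AlgHom.comp_apply, laurentToU_lK, IsCartan.lift_lK]
    exact IsDrinfeld.lift_uK _ _ _
  · rw [AlgHom.mem_equalizer, AlgHom.comp_apply, laurentToU_lh, IsCartan.lift_lh]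
    exact IsDrinfeld.lift_uh _ _ _

/-- On `1 ⊗ W` there is nothing to commute past, so the positive half acts through its action on
`W`. -/
theorem reg_pos (y : Nil M N q 1) (w : PosMod M N q) :
    reg hq hq' (nilToU M N q 1 y) (itm M N q (-1) (PosMod M N q) 1 w) =
      itm M N q (-1) (PosMod M N q) 1 (indMul M N q 1 (Laurent M N) y w) := by
  obtain ⟨r, rfl⟩ := ev_nX_surjective y
  have h1 : (reg hq hq').comp ((nilToU M N q 1).comp (ev (nX M N q 1))) =
      ev (indE hq hq' (pos_isCartan hq) (indX q 1 (Laurent M N))) := by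
    refine FreeAlgebra.hom_ext (funext fun g => ?_)
    simp only [Function.comp_apply, AlgHom.comp_apply, ev_ι, nilToU_nX]
    rw [reg, IsDrinfeld.lift_uX, regX_one]
  have h2 : (indMul M N q 1 (Laurent M N)).comp (ev (nX M N q 1)) =
      ev (indX q 1 (Laurent M N)) := by
    refine FreeAlgebra.hom_ext (funext fun g => ?_)
    simp only [Function.comp_apply, AlgHom.comp_apply, ev_ι]
    rfl
  have h3 := ev_indE hq hq' (pos_isCartan hq) (Z := indX q 1 (Laurent M N)) r w
  rw [← h1, ← h2] at h3
  exact h3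

/-- The value at the cyclic vector determines the tensor. -/
theorem reg_apply (x : Nil M N q (-1)) (b : Laurent M N) (y : Nil M N q 1) :
    reg hq hq' (nilToU M N q (-1) x * laurentToU M N q b * nilToU M N q 1 y)
      (itm M N q (-1) (PosMod M N q) 1 (itm M N q 1 (Laurent M N) 1 1)) =
    itm M N q (-1) (PosMod M N q) x
      ((pos_isCartan hq).lift b (itm M N q 1 (Laurent M N) y 1)) := by
  rw [map_mul, map_mul, Module.End.mul_apply, Module.End.mul_apply, reg_pos, indMul_tmul, mul_one,
    reg_zero, ind_lift_one hq, reg_neg, indMul_tmul, mul_one]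

/-- The space of triangular decompositions. -/
abbrev Tri (M N : ℕ) (q : ℂ) : Type := (Nil M N q (-1) ⊗[ℂ] Laurent M N) ⊗[ℂ] Nil M N q 1

/-- Reads off the tensor from the value at the cyclic vector. -/
def readTri : RegMod M N q →ₗ[ℂ] Tri M N q :=
  (TensorProduct.assoc ℂ (Nil M N q (-1)) (Laurent M N) (Nil M N q 1)).symm.toLinearMap ∘ₗ
    TensorProduct.map LinearMap.id
      ((TensorProduct.comm ℂ (Nil M N q 1) (Laurent M N)).toLinearMap ∘ₗ
        (indEquiv M N q 1 (Laurent M N)).symm.toLinearMap ∘ₗ unstr hq) ∘ₗ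
    (indEquiv M N q (-1) (PosMod M N q)).symm.toLinearMap

theorem readTri_itm (x : Nil M N q (-1)) (b : Laurent M N) (y : Nil M N q 1) :
    readTri hq (itm M N q (-1) (PosMod M N q) x
      ((pos_isCartan hq).lift b (itm M N q 1 (Laurent M N) y 1))) = (x ⊗ₜ b) ⊗ₜ y := by
  have : readTri hq (itm M N q (-1) (PosMod M N q) x
      ((pos_isCartan hq).lift b (itm M N q 1 (Laurent M N) y 1))) =
      (TensorProduct.assoc ℂ (Nil M N q (-1)) (Laurent M N) (Nil M N q 1)).symm
        (x ⊗ₜ TensorProduct.comm ℂ (Nil M N q 1) (Laurent M N)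
          ((indEquiv M N q 1 (Laurent M N)).symm
            (unstr hq ((pos_isCartan hq).lift b (itm M N q 1 (Laurent M N) y 1))))) := rfl
  rw [this, unstr_lift]
  rfl

variable (M N q) in
/-- The presented algebra maps onto `U^±`. -/
def nilToSub (e : ℤˣ) : Nil M N q e →ₐ[ℂ] Unil M N q e :=
  (nilToU M N q e).codRestrict _ fun x =>
    nil_mem ((Subalgebra.toSubmodule (Unil M N q e)).comap (nilToU M N q e).toLinearMap)
      (by
        rw [Submodule.mem_comap, AlgHom.toLinearMap_apply, map_one]
        exact Subalgebra.one_mem _)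
      (fun i n y hy => by
        rw [Submodule.mem_comap, AlgHom.toLinearMap_apply] at hy ⊢
        rw [map_mul, nilToU_nX]
        exact Subalgebra.mul_mem _ (Algebra.subset_adjoin ⟨i, n, rfl⟩) hy) x

theorem nilToSub_surjective (e : ℤˣ) : Function.Surjective (nilToSub M N q e) := by
  rintro ⟨x, hx⟩
  have hle : Unil M N q e ≤ (nilToU M N q e).range := by
    refine Algebra.adjoin_le ?_
    rintro _ ⟨i, n, rfl⟩
    exact ⟨_, nilToU_nX e i n⟩
  obtain ⟨y, hy⟩ := hle hx
  exact ⟨y, Subtype.ext hy⟩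

variable (M N q) in
/-- The Laurent polynomial algebra maps onto `U^0`. -/
def laurentToSub : Laurent M N →ₐ[ℂ] Uzero M N q :=
  (laurentToU M N q).codRestrict _ fun x =>
    laurent_mem ((Uzero M N q).comap (laurentToU M N q))
      (fun e i => by
        rw [Subalgebra.mem_comap, laurentToU_lK]
        exact Algebra.subset_adjoin (Or.inl ⟨e, i, rfl⟩))
      (fun i s => by
        rw [Subalgebra.mem_comap, laurentToU_lh]
        exact Algebra.subset_adjoin (Or.inr ⟨i, s, rfl⟩)) x

theorem laurentToSub_surjective : Function.Surjective (laurentToSub M N q) := by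
  rintro ⟨x, hx⟩
  have hle : Uzero M N q ≤ (laurentToU M N q).range := by
    refine Algebra.adjoin_le ?_
    rintro _ (⟨e, i, rfl⟩ | ⟨i, s, rfl⟩)
    exacts [⟨_, laurentToU_lK e i⟩, ⟨_, laurentToU_lh i s⟩]
  obtain ⟨y, hy⟩ := hle hx
  exact ⟨y, Subtype.ext hy⟩

variable (M N q) in
/-- The map of triangular decompositions. -/
def triMap : Tri M N q →ₗ[ℂ] (Unil M N q (-1) ⊗[ℂ] Uzero M N q) ⊗[ℂ] Unil M N q 1 :=
  TensorProduct.map (TensorProduct.map (nilToSub M N q (-1)).toLinearMap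
    (laurentToSub M N q).toLinearMap) (nilToSub M N q 1).toLinearMap

theorem triMap_surjective : Function.Surjective (triMap M N q) :=
  TensorProduct.map_surjective (TensorProduct.map_surjective (nilToSub_surjective _)
    laurentToSub_surjective) (nilToSub_surjective _)

theorem triMul_triMap_injective (hq : q ≠ 0) (hq' : ∀ n : ℕ, 0 < n → q ^ n ≠ 1) :
    Function.Injective (triMul M N q ∘ triMap M N q) := by
  let ev₀ : Module.End ℂ (RegMod M N q) →ₗ[ℂ] RegMod M N q :=
    LinearMap.applyₗ (itm M N q (-1) (PosMod M N q) 1 (itm M N q 1 (Laurent M N) 1 1))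
  -- Acting on the cyclic vector and then undoing the order of `U^+` and `U^0` is a left inverse;
  -- this is checked on pure tensors.
  have key : (readTri hq ∘ₗ ev₀ ∘ₗ (reg hq hq').toLinearMap) ∘ₗ (triMul M N q ∘ₗ triMap M N q) =
      LinearMap.id := by
    refine TensorProduct.ext_threefold fun x b y => ?_
    exact (congrArg (readTri hq) (reg_apply hq hq' x b y)).trans (readTri_itm hq x b y)
  exact Function.LeftInverse.injective
    (g := readTri hq ∘ₗ ev₀ ∘ₗ (reg hq hq').toLinearMap) (LinearMap.congr_fun key)

/-- The composite with the surjection `triMap` is injective, so `triMul` itself is. -/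
theorem triMul_injective (hq : q ≠ 0) (hq' : ∀ n : ℕ, 0 < n → q ^ n ≠ 1) :
    Function.Injective (triMul M N q) := by
  intro a b hab
  obtain ⟨a, rfl⟩ := triMap_surjective a
  obtain ⟨b, rfl⟩ := triMap_surjective b
  rw [triMul_triMap_injective hq hq' hab]

theorem triMap_injective (hq : q ≠ 0) (hq' : ∀ n : ℕ, 0 < n → q ^ n ≠ 1) :
    Function.Injective (triMap M N q) :=
  (triMul_triMap_injective hq hq').of_comp

variable (M N) in
/-- The augmentation of the Laurent polynomial algebra. -/
def laurentAug : Laurent M N →ₐ[ℂ] ℂ :=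
  IsCartan.lift (K := fun _ _ => (1 : ℂ)) (h := fun _ _ => 0)
    ⟨by simp, by simp, by simp, by simp⟩

/-- Injectivity of `triMap` passes to each factor: put `1` in the other two places, then recover the
element by applying the augmentations there. -/
theorem nilToSub_injective (hq : q ≠ 0) (hq' : ∀ n : ℕ, 0 < n → q ^ n ≠ 1) (e : ℤˣ) :
    Function.Injective (nilToSub M N q e) := by
  intro x y hxy
  rcases units_cases e with rfl | rfl
  · have h1 : triMap M N q ((1 ⊗ₜ 1) ⊗ₜ x) = triMap M N q ((1 ⊗ₜ 1) ⊗ₜ y) :=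
      congrArg (fun z => (nilToSub M N q (-1) 1 ⊗ₜ[ℂ] laurentToSub M N q 1) ⊗ₜ[ℂ] z) hxy
    have h2 := congrArg ((TensorProduct.lid ℂ (Nil M N q 1)).toLinearMap ∘ₗ
      TensorProduct.map ((TensorProduct.lid ℂ ℂ).toLinearMap ∘ₗ TensorProduct.map
        (nAug M N q (-1)).toLinearMap (laurentAug M N).toLinearMap) LinearMap.id)
      (triMap_injective hq hq' h1)
    simpa using h2
  · have h1 : triMap M N q ((x ⊗ₜ 1) ⊗ₜ 1) = triMap M N q ((y ⊗ₜ 1) ⊗ₜ 1) :=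
      congrArg (fun z => (z ⊗ₜ[ℂ] laurentToSub M N q 1) ⊗ₜ[ℂ] nilToSub M N q 1 1) hxy
    have h2 := congrArg ((TensorProduct.rid ℂ (Nil M N q (-1))).toLinearMap ∘ₗ
      TensorProduct.map ((TensorProduct.rid ℂ (Nil M N q (-1))).toLinearMap ∘ₗ TensorProduct.map
        LinearMap.id (laurentAug M N).toLinearMap) (nAug M N q 1).toLinearMap)
      (triMap_injective hq hq' h1)
    simpa using h2

theorem laurentToSub_injective (hq : q ≠ 0) (hq' : ∀ n : ℕ, 0 < n → q ^ n ≠ 1) :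
    Function.Injective (laurentToSub M N q) := by
  intro x y hxy
  have h1 : triMap M N q ((1 ⊗ₜ x) ⊗ₜ 1) = triMap M N q ((1 ⊗ₜ y) ⊗ₜ 1) :=
    congrArg (fun z => (nilToSub M N q (-1) 1 ⊗ₜ[ℂ] z) ⊗ₜ[ℂ] nilToSub M N q 1 1) hxy
  have h2 := congrArg ((TensorProduct.rid ℂ (Laurent M N)).toLinearMap ∘ₗ
    TensorProduct.map ((TensorProduct.lid ℂ (Laurent M N)).toLinearMap ∘ₗ TensorProduct.map
      (nAug M N q (-1)).toLinearMap LinearMap.id) (nAug M N q 1).toLinearMap)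
    (triMap_injective hq hq' h1)
  simpa using h2

end Module

/-! ### Parities -/

section Parity

/-- Decompose a preimage of `w` into its even and odd parts. The image of the part of the wrong
parity lies in both pieces of the target and is therefore zero, so an inclusion of parity pieces
already gives equality. -/
theorem isSuperIso_of_le {V W : Type} [AddCommMonoid V] [Module ℂ V] [AddCommGroup W] [Module ℂ W]
    {𝒱 : ZMod 2 → Submodule ℂ V} {𝒲 : ZMod 2 → Submodule ℂ W} {f : V →ₗ[ℂ] W}
    (hf : Function.Bijective f) (hV : ⨆ ε, 𝒱 ε = ⊤) (hle : ∀ ε, (𝒱 ε).map f ≤ 𝒲 ε)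
    (hd : ∀ x ∈ 𝒲 0, x ∈ 𝒲 1 → x = 0) : IsSuperIso 𝒱 𝒲 f := by
  have h2 : ∀ a : ZMod 2, a = 0 ∨ a = 1 := by decide
  refine ⟨hf, fun ε => le_antisymm (hle ε) fun w hw => ?_⟩
  obtain ⟨v, rfl⟩ := hf.2 w
  have hv : v ∈ 𝒱 0 ⊔ 𝒱 1 := by
    have hsup : ⨆ ε, 𝒱 ε ≤ 𝒱 0 ⊔ 𝒱 1 := iSup_le fun ε => by
      rcases h2 ε with rfl | rfl
      exacts [le_sup_left, le_sup_right]
    exact hsup (hV ▸ Submodule.mem_top)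
  obtain ⟨a, ha, b, hb, rfl⟩ := Submodule.mem_sup.mp hv
  have ha' := hle 0 (Submodule.mem_map_of_mem ha)
  have hb' := hle 1 (Submodule.mem_map_of_mem hb)
  rw [map_add] at hw ⊢
  rcases h2 ε with rfl | rfl
  · rw [hd (f b) ((Submodule.add_mem_iff_right _ ha').mp hw) hb', add_zero]
    exact Submodule.mem_map_of_mem ha
  · rw [hd (f a) ha' ((Submodule.add_mem_iff_left _ hb').mp hw), zero_add]
    exact Submodule.mem_map_of_mem hb

theorem tensorGrade_sup {V W : Type} [AddCommMonoid V] [Module ℂ V] [AddCommMonoid W] [Module ℂ W]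
    {𝒱 : ZMod 2 → Submodule ℂ V} {𝒲 : ZMod 2 → Submodule ℂ W} (hV : ⨆ ε, 𝒱 ε = ⊤)
    (hW : ⨆ ε, 𝒲 ε = ⊤) : ⨆ ε, tensorGrade 𝒱 𝒲 ε = ⊤ := by
  rw [eq_top_iff]
  rintro x -
  induction x using TensorProduct.induction_on with
  | zero => exact Submodule.zero_mem _
  | add x y hx hy => exact Submodule.add_mem _ hx hy
  | tmul v w =>
    have hv : v ∈ ⨆ ε, 𝒱 ε := hV ▸ Submodule.mem_top
    have hw : w ∈ ⨆ ε, 𝒲 ε := hW ▸ Submodule.mem_top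
    induction hv using Submodule.iSup_induction' with
    | zero => rw [TensorProduct.zero_tmul]; exact Submodule.zero_mem _
    | add x y _ _ hx hy => rw [TensorProduct.add_tmul]; exact Submodule.add_mem _ hx hy
    | mem a v hv =>
      induction hw using Submodule.iSup_induction' with
      | zero => rw [TensorProduct.tmul_zero]; exact Submodule.zero_mem _
      | add x y _ _ hx hy => rw [TensorProduct.tmul_add]; exact Submodule.add_mem _ hx hy
      | mem b w hw =>
        refine Submodule.mem_iSup_of_mem (a + b) (Submodule.mem_iSup_of_mem a ?_)
        exact ⟨(⟨v, hv⟩ : 𝒱 a) ⊗ₜ (⟨w, by rwa [add_sub_cancel_left]⟩ : 𝒲 (a + b - a)), rfl⟩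

theorem tensorGrade_map_mul_le {A V W : Type} [Ring A] [Algebra ℂ A] [AddCommMonoid V] [Module ℂ V]
    [AddCommMonoid W] [Module ℂ W] {𝒱 : ZMod 2 → Submodule ℂ V} {𝒲 : ZMod 2 → Submodule ℂ W}
    (𝒜 : ZMod 2 → Submodule ℂ A) [SetLike.GradedMonoid 𝒜] {f : V →ₗ[ℂ] A} {g : W →ₗ[ℂ] A}
    (hf : ∀ ε, (𝒱 ε).map f ≤ 𝒜 ε) (hg : ∀ ε, (𝒲 ε).map g ≤ 𝒜 ε) (ε : ZMod 2) :
    (tensorGrade 𝒱 𝒲 ε).map (LinearMap.mul' ℂ A ∘ₗ TensorProduct.map f g) ≤ 𝒜 ε := by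
  rw [tensorGrade, Submodule.map_iSup]
  refine iSup_le fun a => ?_
  rintro _ ⟨_, ⟨x, rfl⟩, rfl⟩
  induction x using TensorProduct.induction_on with
  | zero => simp only [map_zero]; exact Submodule.zero_mem _
  | add x y hx hy => simp only [map_add]; exact Submodule.add_mem _ hx hy
  | tmul v w =>
    have := SetLike.GradedMul.mul_mem (hf a (Submodule.mem_map_of_mem v.2))
      (hg (ε - a) (Submodule.mem_map_of_mem w.2))
    rw [add_sub_cancel] at this
    exact this

/-- A homomorphism from a free algebra that is even on generators is even. -/
theorem freeGrade_map_le {G A : Type} [Ring A] [Algebra ℂ A] {p : G → ZMod 2}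
    (𝒜 : ZMod 2 → Submodule ℂ A) [SetLike.GradedMonoid 𝒜] (f : FreeAlgebra ℂ G →ₐ[ℂ] A)
    (hf : ∀ g, f (FreeAlgebra.ι ℂ g) ∈ 𝒜 (p g)) (ε : ZMod 2) :
    (freeGrade p ε).map f.toLinearMap ≤ 𝒜 ε := by
  rw [freeGrade, Submodule.map_span_le]
  rintro _ ⟨w, rfl, rfl⟩
  induction w with
  | nil =>
    simp only [List.map_nil, List.prod_nil, List.sum_nil, AlgHom.toLinearMap_apply, map_one]
    exact SetLike.GradedOne.one_mem
  | cons g w ih =>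
    simp only [List.map_cons, List.prod_cons, List.sum_cons, AlgHom.toLinearMap_apply,
      map_mul] at ih ⊢
    exact SetLike.GradedMul.mul_mem (hf g) ih

theorem mul_isSuperIso {A : Type} [Ring A] [Algebra ℂ A] (𝒜 : ZMod 2 → Submodule ℂ A)
    [SetLike.GradedMonoid 𝒜] {B₁ B₂ B₃ : Subalgebra ℂ A} (h₁ : ⨆ ε, subGrade 𝒜 B₁ ε = ⊤)
    (h₂ : ⨆ ε, subGrade 𝒜 B₂ ε = ⊤) (h₃ : ⨆ ε, subGrade 𝒜 B₃ ε = ⊤)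
    (hd : ∀ x ∈ 𝒜 0, x ∈ 𝒜 1 → x = 0)
    (hb : Function.Bijective (LinearMap.mul' ℂ A ∘ₗ TensorProduct.map (LinearMap.mul' ℂ A ∘ₗ
      TensorProduct.map B₁.val.toLinearMap B₂.val.toLinearMap) B₃.val.toLinearMap)) :
    IsSuperIso (tensorGrade (tensorGrade (subGrade 𝒜 B₁) (subGrade 𝒜 B₂)) (subGrade 𝒜 B₃)) 𝒜
      (LinearMap.mul' ℂ A ∘ₗ TensorProduct.map (LinearMap.mul' ℂ A ∘ₗ
        TensorProduct.map B₁.val.toLinearMap B₂.val.toLinearMap) B₃.val.toLinearMap) := by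
  have hle : ∀ (B : Subalgebra ℂ A) ε, (subGrade 𝒜 B ε).map B.val.toLinearMap ≤ 𝒜 ε :=
    fun B ε => Submodule.map_le_iff_le_comap.mpr le_rfl
  exact isSuperIso_of_le hb (tensorGrade_sup (tensorGrade_sup h₁ h₂) h₃)
    (tensorGrade_map_mul_le 𝒜 (tensorGrade_map_mul_le 𝒜 (hle _) (hle _)) (hle _)) hd

theorem isSuperIso_subGrade {A V : Type} [Ring A] [Algebra ℂ A] [AddCommMonoid V] [Module ℂ V]
    {𝒱 : ZMod 2 → Submodule ℂ V} (𝒜 : ZMod 2 → Submodule ℂ A) {B : Subalgebra ℂ A}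
    {f : V →ₗ[ℂ] B} (hf : Function.Bijective f) (hV : ⨆ ε, 𝒱 ε = ⊤)
    (hle : ∀ ε, ∀ v ∈ 𝒱 ε, (f v : A) ∈ 𝒜 ε) (hd : ∀ x ∈ 𝒜 0, x ∈ 𝒜 1 → x = 0) :
    IsSuperIso 𝒱 (subGrade 𝒜 B) f :=
  isSuperIso_of_le hf hV (fun ε => by rintro _ ⟨v, hv, rfl⟩; exact hle ε v hv)
    fun x h0 h1 => Subtype.ext (hd x h0 h1)

variable {M N : ℕ} {q : ℂ}

theorem uGrade_disjoint (x : U M N q) (h0 : x ∈ UGrade M N q 0) (h1 : x ∈ UGrade M N q 1) : x = 0 :=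
  presGrade_disjoint _ rel_homogeneous x h0 h1

theorem triMul_isSuperIso (hq : q ≠ 0) (hq' : ∀ n : ℕ, 0 < n → q ^ n ≠ 1) :
    IsSuperIso (tensorGrade (tensorGrade (subGrade (UGrade M N q) (Unil M N q (-1)))
      (subGrade (UGrade M N q) (Uzero M N q))) (subGrade (UGrade M N q) (Unil M N q 1)))
      (UGrade M N q) (triMul M N q) := by
  refine mul_isSuperIso (UGrade M N q) (Unil_isInternal _).submodule_iSup_eq_top
    Uzero_isInternal.submodule_iSup_eq_top (Unil_isInternal _).submodule_iSup_eq_top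
    uGrade_disjoint ?_
  exact ⟨triMul_injective hq hq', triMul_surjective hq⟩

variable (M N) in
/-- The presented algebra is isomorphic to `U^±`. -/
def nilIso (hq : q ≠ 0) (hq' : ∀ n : ℕ, 0 < n → q ^ n ≠ 1) (e : ℤˣ) :
    PNil M N q e ≃ₐ[ℂ] Unil M N q e :=
  (nilEquiv M N q e).trans
    (AlgEquiv.ofBijective (nilToSub M N q e) ⟨nilToSub_injective hq hq' e, nilToSub_surjective e⟩)

theorem nilIso_pX (hq : q ≠ 0) (hq' : ∀ n : ℕ, 0 < n → q ^ n ≠ 1) (e : ℤˣ) (i : Node M N) (n : ℤ) :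
    (nilIso M N hq hq' e (pX M N q e i n) : U M N q) = uX M N q e i n := nilToU_nX e i n

theorem nilIso_isSuperIso (hq : q ≠ 0) (hq' : ∀ n : ℕ, 0 < n → q ^ n ≠ 1) (e : ℤˣ) :
    IsSuperIso (PGrade M N q e) (subGrade (UGrade M N q) (Unil M N q e))
      (nilIso M N hq hq' e).toLinearMap := by
  refine isSuperIso_subGrade (UGrade M N q) (nilIso M N hq hq' e).bijective
    (PGrade_isInternal e).submodule_iSup_eq_top ?_ uGrade_disjoint
  rintro ε _ ⟨r, hr, rfl⟩
  refine freeGrade_map_le (UGrade M N q) ((Unil M N q e).val.comp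
    ((nilIso M N hq hq' e).toAlgHom.comp (RingQuot.mkAlgHom ℂ (PRel M N q e)))) (fun g => ?_) ε
    (Submodule.mem_map_of_mem hr)
  have : (Unil M N q e).val.comp ((nilIso M N hq hq' e).toAlgHom.comp
      (RingQuot.mkAlgHom ℂ (PRel M N q e))) (FreeAlgebra.ι ℂ g) = uX M N q e g.1 g.2 :=
    nilIso_pX hq hq' e g.1 g.2
  rw [this]
  exact ⟨_, fX_mem e g.1 g.2, rfl⟩

end Parity

end

end QAffine

theorem theorem3p2 (M N : ℕ) (hM : 1 ≤ M) (hN : 1 ≤ N) (q : ℂ) (hq0 : q ≠ 0)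
    (hq : ∀ n : ℕ, 0 < n → q ^ n ≠ 1) :
    QAffine.IsSuperIso
      (QAffine.tensorGrade
        (QAffine.tensorGrade
          (QAffine.subGrade (QAffine.UGrade M N q) (QAffine.Unil M N q (-1)))
          (QAffine.subGrade (QAffine.UGrade M N q) (QAffine.Uzero M N q)))
        (QAffine.subGrade (QAffine.UGrade M N q) (QAffine.Unil M N q 1)))
      (QAffine.UGrade M N q)
      (QAffine.triMul M N q) ∧
    (∀ e : ℤˣ, ∃ f : QAffine.PNil M N q e ≃ₐ[ℂ] QAffine.Unil M N q e,
      (∀ i n, (f (QAffine.pX M N q e i n) : QAffine.U M N q) = QAffine.uX M N q e i n) ∧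
      QAffine.IsSuperIso (QAffine.PGrade M N q e)
        (QAffine.subGrade (QAffine.UGrade M N q) (QAffine.Unil M N q e)) f.toLinearMap) ∧
    (∃ g : QAffine.Laurent M N ≃ₐ[ℂ] QAffine.Uzero M N q,
      (∀ i s, (g (QAffine.lh M N i s) : QAffine.U M N q) = QAffine.uh M N q i s) ∧
      (∀ e i, (g (QAffine.lK M N e i) : QAffine.U M N q) = QAffine.uK M N q e i)) :=
  ⟨QAffine.triMul_isSuperIso hq0 hq,
    fun e => ⟨QAffine.nilIso M N hq0 hq e, QAffine.nilIso_pX hq0 hq e,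
      QAffine.nilIso_isSuperIso hq0 hq e⟩,
    AlgEquiv.ofBijective (QAffine.laurentToSub M N q)
      ⟨QAffine.laurentToSub_injective hq0 hq, QAffine.laurentToSub_surjective⟩,
    QAffine.laurentToU_lh, QAffine.laurentToU_lK⟩
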